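/- **Setting.** Let $T>0$, $Q=(0,1)\times(0,T)$; let $\omega,\omega_1,\omega_2\subseteq(0,1)$ be nonempty open sets with $\omega_i\cap\omega=\emptyset$, let $O_{1,d},O_{2,d}\subseteq(0,1)$ be measurable, $\alpha_1,\alpha_2>0$, $c\in L^\infty(Q)$ and $x_0\in\omega$. Let $a\in C^1([0,1]\setminus\{x_0\})$ with $a>0$ on $[0,1]\setminus\{x_0\}$, $a(x_0)=0$ and $(x-x_0)a'(x)\le K a(x)$ on $[0,1]\setminus\{x_0\}$, where either $K\in(0,1)$ (weakly degenerate case), or $K\in[1,2)$ and $a\in W^{1,\infty}(0,1)$, i.e. $a$ is Lipschitz on $[0,1]$ (strongly degenerate case). Let $H^1_a(0,1)$ be the space of all $z\in L^2(0,1)$ with $z(0)=z(1)=0$ and $\sqrt a\,z_x\in L^2(0,1)$ that are absolutely continuous on $[0,1]$ in the weakly degenerate case, and locally absolutely continuous on $[0,x_0)\cup(x_0,1]$ in the strongly degenerate case. Solutions of parabolic problems are weak solutions in $C([0,T];L^2(0,1))\cap L^2(0,T;H^1_a(0,1))$. Let $s,c_1>0$ and $c_2>\max\left\{\frac{(1-x_0)^2}{a(1)(2-K)},\frac{x_0^2}{a(0)(2-K)}\right\}$,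 and put $$\psi(x)=c_1\Big[\int_{x_0}^x\frac{r-x_0}{a(r)}\,dr-c_2\Big],\qquad \varphi^*(t)=\min_{x\in[0,1]}\vartheta(t)\psi(x),\qquad \sigma(t)=e^{-s\varphi^*(t)/2},$$ where $\vartheta$ is either $\theta(t)=[t(T-t)]^{-4}$, or the function $\eta$ that equals $2^8/T^8$ on $[0,T/2]$ and $\theta$ on $(T/2,T)$. Given $y_0\in L^2(0,1)$, $f\in L^2(\omega\times(0,T))$ and $u_i\in S_i:=L^2(\omega_i\times(0,T))$, let $y=y(\cdot,\cdot;f,u_1,u_2)$ denote the solution of $$y_t-(ay_x)_x+cy=f\chi_\omega+u_1\chi_{\omega_1}+u_2\chi_{\omega_2}\ \text{in }Q,\qquad y(0,t)=y(1,t)=0,\qquad y(x,0)=y_0(x).$$ For $\mu_i>0$ and $y_{i,d}\in L^2(O_{i,d}\times(0,T))$ let $$J_i(f,u_1,u_2)=\frac{\alpha_i}{2}\int_{O_{i,d}\times(0,T)}|y-y_{i,d}|^2\,dx\,dt+\frac{\mu_i}{2}\int_{\omega_i\times(0,T)}\sigma^2|u_i|^2\,dx\,dt\in[0,\infty],\qquad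 i=1,2.$$ A pair $(\bar u_1,\bar u_2)\in S_1\times S_2$ is a Nash equilibrium pair for $f$ if $J_1(f,\bar u_1,\bar u_2)\le J_1(f,u_1,\bar u_2)$ for all $u_1\in S_1$ and $J_2(f,\bar u_1,\bar u_2)\le J_2(f,\bar u_1,u_2)$ for all $u_2\in S_2$. **Proposition.** There is $M>0$, depending only on $T,a,x_0,K,c,\omega,\omega_i,O_{i,d},\alpha_i$, such that for all $\mu_1,\mu_2\ge M$, all $s,c_1,c_2,\vartheta$ as above and all $y_0$, $y_{1,d}$, $y_{2,d}$ and $f$ as above, the following hold. For all $(u_1,u_2)\in S_1\times S_2$ the state $y(\cdot,\cdot;f,u_1,u_2)$ exists and is unique. There is exactly one Nash equilibrium pair $(\bar u_1,\bar u_2)\in S_1\times S_2$ for $f$. The coupled system $$\left\{\begin{array}{ll} y_t-(ay_x)_x+cy=f\chi_\omega-\frac1{\mu_1}\sigma^{-2}q^1\chi_{\omega_1}-\frac1{\mu_2}\sigma^{-2}q^2\chi_{\omega_2}&\text{in }Q,\\ -q^i_t-(aq^i_x)_x+cq^i=\alpha_i(y-y_{i,d})\chi_{O_{i,d}}&\text{in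 }Q,\ i=1,2,\\ y(0,t)=y(1,t)=0,\quad q^i(0,t)=q^i(1,t)=0&\text{in }(0,T),\\ y(x,0)=y_0(x),\quad q^i(x,T)=0&\text{in }(0,1) \end{array}\right.$$ has exactly one solution $(y,q^1,q^2)$. Finally, a pair $(\bar u_1,\bar u_2)\in S_1\times S_2$ is the Nash equilibrium pair for $f$ if and only if $\bar u_i=-\frac1{\mu_i}\sigma^{-2}q^i$ almost everywhere in $\omega_i\times(0,T)$ for $i=1,2$ and $y=y(\cdot,\cdot;f,\bar u_1,\bar u_2)$. -/

import Mathlib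

open MeasureTheory Set
open scoped ENNReal NNReal

noncomputable section

namespace StackelbergNash

/-- The Hilbert space `L²(0,1)`. -/
abbrev L2 : Type := Lp ℝ 2 (volume.restrict (Ioo (0 : ℝ) 1))

/-- The two types of interior degeneracy. -/
inductive Degeneracy
  | weak
  | strong

/-- The data of the control problem that are fixed before the weights, the initial state, the
targets and the controls are chosen. The two followers and everything belonging to them are
indexed by `Fin 2`. -/
structure Data where
  /-- the time horizon -/
  T : ℝ
  /-- the diffusion coefficient, relevant on `[0,1]` only -/
  a : ℝ → ℝ
  /-- the point of degeneracy -/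
  x₀ : ℝ
  kind : Degeneracy
  /-- the exponent in the degeneracy condition -/
  K : ℝ
  /-- the potential, a function of `(x,t)` -/
  c : ℝ × ℝ → ℝ
  /-- the region of the leader -/
  ω : Set ℝ
  /-- the regions of the followers -/
  ωF : Fin 2 → Set ℝ
  /-- the observation regions -/
  O : Fin 2 → Set ℝ
  α : Fin 2 → ℝ

namespace Data

variable (P : Data)

/-- The time interval `(0,T)`. -/
def time : Set ℝ := Ioo 0 P.T

/-- The standing assumptions on the data. -/
structure Standing : Prop where
  T_pos : 0 < P.T
  ω_open : IsOpen P.ω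
  ω_subset : P.ω ⊆ Ioo 0 1
  ωF_open : ∀ i, IsOpen (P.ωF i)
  ωF_nonempty : ∀ i, (P.ωF i).Nonempty
  ωF_subset : ∀ i, P.ωF i ⊆ Ioo 0 1
  ω_disjoint : ∀ i, Disjoint (P.ωF i) P.ω
  O_meas : ∀ i, MeasurableSet (P.O i)
  O_subset : ∀ i, P.O i ⊆ Ioo 0 1
  α_pos : ∀ i, 0 < P.α i
  c_bdd : MemLp P.c ∞ (volume.restrict (Ioo (0 : ℝ) 1 ×ˢ P.time))
  x₀_mem : P.x₀ ∈ P.ω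
  a_C1 : ContDiffOn ℝ 1 P.a (Icc 0 1 \ {P.x₀})
  a_pos : ∀ x ∈ Icc (0 : ℝ) 1 \ {P.x₀}, 0 < P.a x
  a_zero : P.a P.x₀ = 0
  a_growth : ∀ x ∈ Icc (0 : ℝ) 1 \ {P.x₀},
    (x - P.x₀) * derivWithin P.a (Icc 0 1 \ {P.x₀}) x ≤ P.K * P.a x
  a_weak : P.kind = .weak → P.K ∈ Ioo (0 : ℝ) 1
  /-- Strong degeneracy: `K ∈ [1,2)` and `a ∈ W^{1,∞}(0,1)`. -/
  a_strong : P.kind = .strong →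
    P.K ∈ Ico (1 : ℝ) 2 ∧ ∃ L : ℝ≥0, LipschitzOnWith L P.a (Icc 0 1)

/-! ### The weighted space -/

/-- The regularity in the definition of `H¹ₐ(0,1)`: absolute continuity on `[0,1]` in the weakly
degenerate case, local absolute continuity on `[0,x₀) ∪ (x₀,1]` in the strongly degenerate case. -/
def IsAC (g : ℝ → ℝ) : Prop :=
  match P.kind with
  | .weak => AbsolutelyContinuousOnInterval g 0 1
  | .strong => (∀ b ∈ Ioo 0 P.x₀, AbsolutelyContinuousOnInterval g 0 b) ∧
      ∀ b ∈ Ioo P.x₀ 1, AbsolutelyContinuousOnInterval g b 1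

/-- `z ∈ H¹ₐ(0,1)` and `w = √a zₓ` (as elements of `L²(0,1)`): some representative `g` of `z`
is (locally) absolutely continuous, vanishes at `0` and `1`, and `√a g'` is in `L²(0,1)` with
class `w`. -/
def HasWeightedDeriv (z w : L2) : Prop :=
  ∃ g : ℝ → ℝ, z =ᵐ[volume.restrict (Ioo 0 1)] g ∧ P.IsAC g ∧ g 0 = 0 ∧ g 1 = 0 ∧
    w =ᵐ[volume.restrict (Ioo 0 1)] fun x => √(P.a x) * deriv g x

/-! ### Weak solutions -/

/-- The space `C([0,T]; L²(0,1))`. -/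
abbrev Path : Type := C(Icc (0 : ℝ) P.T, L2)

/-- The value `y(·,t)`, for `t ∈ [0,T]` (and zero for other `t`). -/
def slice (y : P.Path) (t : ℝ) : L2 :=
  open Classical in if h : t ∈ Icc (0 : ℝ) P.T then y ⟨t, h⟩ else 0

/-- `p = √a yₓ` along `y`, and `p ∈ L²(0,T; L²(0,1))`; such a `p` exists if and only if
`y ∈ L²(0,T; H¹ₐ(0,1))`. -/
def IsGradient (y : P.Path) (p : ℝ → L2) : Prop :=
  MemLp p 2 (volume.restrict P.time) ∧
    ∀ᵐ t ∂volume.restrict P.time, P.HasWeightedDeriv (P.slice y t) (p t)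

/-- For `v ∈ H¹ₐ(0,1)` with `w = √a vₓ`, the bilinear form
`∫₀¹ (a yₓ vₓ + c(x,t) y v) dx` at the time `t`; here `z = y(·,t)` and `p = √a yₓ(·,t)`. -/
def form (t : ℝ) (z p v w : L2) : ℝ :=
  inner ℝ p w + ∫ x in Ioo (0 : ℝ) 1, P.c (x, t) * z x * v x

/-- `y ∈ C([0,T]; L²(0,1)) ∩ L²(0,T; H¹ₐ(0,1))` is the weak solution of
`yₜ - (a yₓ)ₓ + c y = F` in `Q`, `y(0,t) = y(1,t) = 0`, `y(x,0) = y₀(x)`: the equation holds in the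
dual of `H¹ₐ(0,1)`, integrated over `(0,t)` for every `t`. -/
def IsForwardSol (F : ℝ → ℝ → ℝ) (y₀ : L2) (y : P.Path) : Prop :=
  P.slice y 0 = y₀ ∧ ∃ p : ℝ → L2, P.IsGradient y p ∧
    ∀ v w : L2, P.HasWeightedDeriv v w → ∀ t ∈ Icc (0 : ℝ) P.T,
      inner ℝ (P.slice y t) v - inner ℝ y₀ v + ∫ τ in (0 : ℝ)..t, P.form τ (P.slice y τ) (p τ) v w
        = ∫ τ in (0 : ℝ)..t, ∫ x in Ioo (0 : ℝ) 1, F x τ * v x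

/-- `q ∈ C([0,T]; L²(0,1)) ∩ L²(0,T; H¹ₐ(0,1))` is the weak solution of
`-qₜ - (a qₓ)ₓ + c q = F` in `Q`, `q(0,t) = q(1,t) = 0`, `q(x,T) = 0`. -/
def IsBackwardSol (F : ℝ → ℝ → ℝ) (q : P.Path) : Prop :=
  P.slice q P.T = 0 ∧ ∃ p : ℝ → L2, P.IsGradient q p ∧
    ∀ v w : L2, P.HasWeightedDeriv v w → ∀ t ∈ Icc (0 : ℝ) P.T,
      inner ℝ (P.slice q t) v + ∫ τ in t..P.T, P.form τ (P.slice q τ) (p τ) v w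
        = ∫ τ in t..P.T, ∫ x in Ioo (0 : ℝ) 1, F x τ * v x

/-! ### Controls, targets, and the state -/

/-- The leader controls `L²(ω × (0,T))`. -/
abbrev Leader : Type := Lp ℝ 2 (volume.restrict (P.ω ×ˢ P.time))

/-- The controls `Sᵢ = L²(ωᵢ × (0,T))` of the `i`-th follower. -/
abbrev Follower (i : Fin 2) : Type := Lp ℝ 2 (volume.restrict (P.ωF i ×ˢ P.time))

/-- The targets `y_{i,d} ∈ L²(O_{i,d} × (0,T))`. -/
abbrev Target (i : Fin 2) : Type := Lp ℝ 2 (volume.restrict (P.O i ×ˢ P.time))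

/-- `y = y(·,·; f,u₁,u₂)`: the solution of
`yₜ - (a yₓ)ₓ + c y = f χ_ω + u₁ χ_{ω₁} + u₂ χ_{ω₂}` with initial state `y₀`. -/
def IsState (y₀ : L2) (f : P.Leader) (u : ∀ i, P.Follower i) (y : P.Path) : Prop :=
  P.IsForwardSol
    (fun x t => P.ω.indicator (fun ξ => f (ξ, t)) x
      + ∑ i, (P.ωF i).indicator (fun ξ => u i (ξ, t)) x) y₀ y

open Classical in
/-- The state as a function of the controls (and zero if there were none). -/
def state (y₀ : L2) (f : P.Leader) (u : ∀ i, P.Follower i) : P.Path :=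
  if h : ∃ y, P.IsState y₀ f u y then h.choose else 0

/-! ### The weight -/

/-- `θ(t) = 1 / [t (T - t)]⁴`. -/
def θ (t : ℝ) : ℝ := 1 / (t * (P.T - t)) ^ 4

/-- The modification of `θ` that is constant on `[0,T/2]`. -/
def η (t : ℝ) : ℝ := if t ≤ P.T / 2 then 2 ^ 8 / P.T ^ 8 else P.θ t

/-- `ψ(x) = c₁ (∫_{x₀}^x (r - x₀) / a(r) dr - c₂)`. -/
def ψ (c₁ c₂ x : ℝ) : ℝ := c₁ * ((∫ r in P.x₀..x, (r - P.x₀) / P.a r) - c₂)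

/-- `σ(t) = exp (-s φ*(t) / 2)`, where `φ*(t)` is the minimum over `x ∈ [0,1]` of
`φ(x,t) = ϑ(t) ψ(x)`. -/
def σ (ϑ : ℝ → ℝ) (c₁ c₂ s t : ℝ) : ℝ :=
  Real.exp (-(s * sInf ((fun x => ϑ t * P.ψ c₁ c₂ x) '' Icc 0 1)) / 2)

/-! ### Costs, equilibria, and the optimality system -/

/-- The cost `Jᵢ(f,u₁,u₂)` of the `i`-th follower. As `σ` may be unbounded,
the value `+∞` is possible. -/
def J (μ : Fin 2 → ℝ) (σ : ℝ → ℝ) (y₀ : L2) (yd : ∀ i, P.Target i) (i : Fin 2)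
    (f : P.Leader) (u : ∀ i, P.Follower i) : ℝ≥0∞ :=
  ENNReal.ofReal (P.α i / 2) *
      (∫⁻ t in P.time, ∫⁻ x in P.O i,
        ENNReal.ofReal ((P.slice (P.state y₀ f u) t x - yd i (x, t)) ^ 2))
    + ENNReal.ofReal (μ i / 2) *
      (∫⁻ z in P.ωF i ×ˢ P.time, ENNReal.ofReal (σ z.2 ^ 2 * u i z ^ 2))

/-- Nash equilibrium pairs for the leader control `f`. -/
def IsNash (μ : Fin 2 → ℝ) (σ : ℝ → ℝ) (y₀ : L2) (yd : ∀ i, P.Target i)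
    (f : P.Leader) (u : ∀ i, P.Follower i) : Prop :=
  ∀ (i : Fin 2) (v : P.Follower i),
    P.J μ σ y₀ yd i f u ≤ P.J μ σ y₀ yd i f (Function.update u i v)

/-- `(y,q¹,q²)` solves the coupled forward-backward system
`yₜ - (a yₓ)ₓ + c y = f χ_ω - ∑ᵢ (1/μᵢ) σ⁻² qⁱ χ_{ωᵢ}`, `y(x,0) = y₀(x)`,
`-qⁱₜ - (a qⁱₓ)ₓ + c qⁱ = αᵢ (y - y_{i,d}) χ_{O_{i,d}}`, `qⁱ(x,T) = 0`,
with zero boundary values. -/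
def IsOptimalitySol (μ : Fin 2 → ℝ) (σ : ℝ → ℝ) (y₀ : L2) (yd : ∀ i, P.Target i)
    (f : P.Leader) (y : P.Path) (q : Fin 2 → P.Path) : Prop :=
  P.IsForwardSol
    (fun x t => P.ω.indicator (fun ξ => f (ξ, t)) x
      - ∑ i, (P.ωF i).indicator (fun ξ => 1 / μ i * (σ t ^ 2)⁻¹ * P.slice (q i) t ξ) x) y₀ y ∧
  ∀ i, P.IsBackwardSol
    (fun x t => (P.O i).indicator (fun ξ => P.α i * (P.slice y t ξ - yd i (ξ, t))) x) (q i)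

/-- `uᵢ = -(1/μᵢ) σ⁻² qⁱ` almost everywhere in `ωᵢ × (0,T)`, for `i = 1, 2`. -/
def IsFeedback (μ : Fin 2 → ℝ) (σ : ℝ → ℝ) (u : ∀ i, P.Follower i) (q : Fin 2 → P.Path) : Prop :=
  ∀ i, ∀ᵐ t ∂volume.restrict P.time, ∀ᵐ x ∂volume.restrict (P.ωF i),
    u i (x, t) = -(1 / μ i) * (σ t ^ 2)⁻¹ * P.slice (q i) t x

end Data

end StackelbergNash

end

/-!
The operator `z ↦ -(a z')'` comes from the closed quadratic form `∫ a z'²` on `H¹ₐ(0,1)`. The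
integral representation of `z` through `√a z'` (`Data.Standing.hasWeightedDeriv_iff`) shows that
the graph of `D z = √a z'` is closed in `L² × L²`, in both cases of degeneracy, and its domain is
dense. From there on the parabolic theory is that of `y' + D* D y + B y = F` in a separable Hilbert
space, with a bounded measurable family `B` of symmetric operators. Solutions are limits of Yosida
approximations (`exists_isWeakSol`). As a weak solution need not be differentiable in `H`, the
energy estimate and the duality between forward and backward solutions (`IsWeakSol.norm_sq_le`,
`IsWeakSol.duality`) are proved for its image under the resolvent, which is a primitive of an
integrable function, and then carried to the limit.

Only two properties of the weight matter: it is measurable in time, and `σ ≥ 1`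
(`Data.Standing.one_le_σ`), since the minimum `-c₁ c₂` of `ψ` is attained at `x₀` and `c₂ > 0`.

The cost `Jᵢ` is a quadratic function of the `i`-th control, with values in `[0,∞]`. By duality, the
adjoint state `qⁱ` of `y` is the derivative of its tracking part
(`Data.Standing.tracking_update`), and therefore the control is optimal against the other one if
and only if `uᵢ = -(1/μᵢ) σ⁻² qⁱ` on `ωᵢ × (0,T)`; the unbounded weight is dealt with in
`isMin_weighted_iff`. Hence the Nash equilibria are the fixed points of the map
`u ↦ y ↦ (q¹,q²) ↦ (-(1/μᵢ) σ⁻² qⁱ)ᵢ` (`Data.Standing.isNash_iff`), and the solutions of the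
optimality system correspond to the same fixed points (`Data.Standing.isOptimalitySol_iff`). By the
energy estimates and `σ⁻² ≤ 1` this map has a Lipschitz constant of order `maxᵢ αᵢ/μᵢ`, so it is a
contraction for large `μᵢ` (`Data.Standing.norm_response_sub_le`), uniformly in the weight, and
Banach's fixed point theorem gives existence and uniqueness.
-/

open Filter Topology

namespace StackelbergNash

/-! ### Calculus in a Hilbert space -/

section Calculus

variable {H : Type*} [NormedAddCommGroup H] [InnerProductSpace ℝ H]

theorem absolutelyContinuousOnInterval_of_dist_le {X Y : Type*} [PseudoMetricSpace X]
    [PseudoMetricSpace Y] {f : ℝ → X} {N : ℝ → Y} {a b : ℝ}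
    (hN : AbsolutelyContinuousOnInterval N a b)
    (h : ∀ s ∈ uIcc a b, ∀ t ∈ uIcc a b, dist (f s) (f t) ≤ dist (N s) (N t)) :
    AbsolutelyContinuousOnInterval f a b := by
  rw [absolutelyContinuousOnInterval_iff] at hN ⊢
  intro ε hε
  obtain ⟨δ, hδ, H⟩ := hN ε hε
  refine ⟨δ, hδ, fun E hE hlen => lt_of_le_of_lt ?_ (H E hE hlen)⟩
  exact Finset.sum_le_sum fun i hi => h _ (hE.1 i hi).1 _ (hE.1 i hi).2

theorem continuousOn_primitive_Icc {k : ℝ → H} {T : ℝ} (hT : 0 ≤ T)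
    (hk : IntervalIntegrable k volume 0 T) :
    ContinuousOn (fun t => ∫ τ in (0 : ℝ)..t, k τ) (Icc 0 T) := by
  have := intervalIntegral.continuousOn_primitive_interval' hk left_mem_uIcc
  rwa [uIcc_of_le hT] at this

/-- The product rule for the inner product of two primitives of integrable functions. -/
theorem inner_primitive_sub [CompleteSpace H] {g h : ℝ → H} {x₀ z₀ : H} {T : ℝ} (hT : 0 ≤ T)
    (hg : IntervalIntegrable g volume 0 T) (hh : IntervalIntegrable h volume 0 T)
    {x z : ℝ → H} (hx : ∀ t ∈ Icc 0 T, x t = x₀ + ∫ τ in (0 : ℝ)..t, g τ)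
    (hz : ∀ t ∈ Icc 0 T, z t = z₀ + ∫ τ in (0 : ℝ)..t, h τ) :
    inner ℝ (x T) (z T) - inner ℝ x₀ z₀
      = ∫ τ in (0 : ℝ)..T, (inner ℝ (g τ) (z τ) + inner ℝ (x τ) (h τ)) := by
  have sub : ∀ {s t : ℝ}, s ∈ Icc 0 T → t ∈ Icc 0 T → uIcc s t ⊆ uIcc 0 T := by
    intro s t hs ht
    rw [uIcc_of_le hT]
    exact uIcc_subset_Icc hs ht
  have h0 : (0 : ℝ) ∈ Icc 0 T := ⟨le_rfl, hT⟩
  -- replace `x` and `z` by the primitives themselves, which are defined on the whole line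
  set X : ℝ → H := fun t => x₀ + ∫ τ in (0 : ℝ)..t, g τ with hX
  set Z : ℝ → H := fun t => z₀ + ∫ τ in (0 : ℝ)..t, h τ with hZ
  have key : ∀ {k : ℝ → H} (k₀ : H), IntervalIntegrable k volume 0 T → ∀ s ∈ Icc 0 T,
      ∀ t ∈ Icc 0 T, dist (k₀ + ∫ τ in (0 : ℝ)..s, k τ) (k₀ + ∫ τ in (0 : ℝ)..t, k τ)
        ≤ |∫ τ in s..t, ‖k τ‖| := by
    intro k k₀ hk s hs t ht
    rw [dist_comm, dist_eq_norm, add_sub_add_left_eq_sub,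
      intervalIntegral.integral_interval_sub_left (hk.mono_set (sub h0 ht))
        (hk.mono_set (sub h0 hs))]
    exact intervalIntegral.norm_integral_le_abs_integral_norm
  have hcont : ∀ {k : ℝ → H} (k₀ : H), IntervalIntegrable k volume 0 T →
      ContinuousOn (fun t => k₀ + ∫ τ in (0 : ℝ)..t, k τ) (Icc 0 T) := by
    intro k k₀ hk
    refine continuousOn_const.add ?_
    exact continuousOn_primitive_Icc hT hk
  obtain ⟨C, hC⟩ := isCompact_Icc.exists_bound_of_continuousOn (hcont x₀ hg)
  obtain ⟨D, hD⟩ := isCompact_Icc.exists_bound_of_continuousOn (hcont z₀ hh)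
  have hC0 : 0 ≤ C := (norm_nonneg _).trans (hC 0 h0)
  have hD0 : 0 ≤ D := (norm_nonneg _).trans (hD 0 h0)
  have hNint : IntervalIntegrable (fun τ => D * ‖g τ‖ + C * ‖h τ‖) volume 0 T :=
    (hg.norm.const_mul D).add (hh.norm.const_mul C)
  have hac : AbsolutelyContinuousOnInterval (fun t => inner ℝ (X t) (Z t)) 0 T := by
    refine absolutelyContinuousOnInterval_of_dist_le
      (hNint.absolutelyContinuousOnInterval_intervalIntegral (c := 0) (by simp)) ?_
    intro s hs t ht
    rw [uIcc_of_le hT] at hs ht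
    have e1 : dist (inner ℝ (X s) (Z s)) (inner ℝ (X t) (Z t))
        ≤ D * dist (X s) (X t) + C * dist (Z s) (Z t) := by
      have : inner ℝ (X s) (Z s) - inner ℝ (X t) (Z t)
          = inner ℝ (X s - X t) (Z s) + inner ℝ (X t) (Z s - Z t) := by
        rw [inner_sub_left, inner_sub_right]; ring
      rw [Real.dist_eq, this]
      refine (abs_add_le _ _).trans (add_le_add ?_ ?_)
      · refine (abs_real_inner_le_norm _ _).trans ?_
        rw [mul_comm, dist_eq_norm]
        exact mul_le_mul_of_nonneg_right (hD s hs) (norm_nonneg _)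
      · refine (abs_real_inner_le_norm _ _).trans ?_
        rw [dist_eq_norm]
        exact mul_le_mul_of_nonneg_right (hC t ht) (norm_nonneg _)
    refine e1.trans ?_
    have hsub := sub hs ht
    rw [dist_comm (∫ v in (0 : ℝ)..s, _), Real.dist_eq, intervalIntegral.integral_interval_sub_left
      (hNint.mono_set (sub h0 ht)) (hNint.mono_set (sub h0 hs)),
      intervalIntegral.integral_add ((hg.norm.const_mul D).mono_set hsub)
        ((hh.norm.const_mul C).mono_set hsub),
      intervalIntegral.integral_const_mul, intervalIntegral.integral_const_mul]
    have a1 := key x₀ hg s hs t ht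
    have a2 := key z₀ hh s hs t ht
    rcases le_total s t with hst | hst
    · have p1 : 0 ≤ ∫ τ in s..t, ‖g τ‖ :=
        intervalIntegral.integral_nonneg hst fun _ _ => norm_nonneg _
      have p2 : 0 ≤ ∫ τ in s..t, ‖h τ‖ :=
        intervalIntegral.integral_nonneg hst fun _ _ => norm_nonneg _
      rw [abs_of_nonneg p1] at a1
      rw [abs_of_nonneg p2] at a2
      rw [abs_of_nonneg (by positivity)]
      gcongr
    · have p1 : 0 ≤ ∫ τ in t..s, ‖g τ‖ :=
        intervalIntegral.integral_nonneg hst fun _ _ => norm_nonneg _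
      have p2 : 0 ≤ ∫ τ in t..s, ‖h τ‖ :=
        intervalIntegral.integral_nonneg hst fun _ _ => norm_nonneg _
      rw [intervalIntegral.integral_symm t s, abs_neg, abs_of_nonneg p1] at a1
      rw [intervalIntegral.integral_symm t s, abs_neg, abs_of_nonneg p2] at a2
      rw [intervalIntegral.integral_symm t s, intervalIntegral.integral_symm t s,
        mul_neg, mul_neg, ← neg_add, abs_neg, abs_of_nonneg (by positivity)]
      gcongr
  have hTT : T ∈ Icc 0 T := ⟨hT, le_rfl⟩
  have hfin := hac.integral_deriv_eq_sub
  have e0 : inner ℝ (X 0) (Z 0) = (inner ℝ x₀ z₀ : ℝ) := by simp [hX, hZ]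
  rw [e0] at hfin
  rw [hx T hTT, hz T hTT, ← hfin]
  refine intervalIntegral.integral_congr_ae ?_
  filter_upwards [hg.ae_hasDerivAt_integral, hh.ae_hasDerivAt_integral] with t h1 h2 ht
  have ht' := uIoc_subset_uIcc ht
  have d1 : HasDerivAt X (g t) t := (h1 ht' 0 (by simp)).const_add x₀
  have d2 : HasDerivAt Z (h t) t := (h2 ht' 0 (by simp)).const_add z₀
  rw [(d1.inner ℝ d2).deriv]
  rw [uIcc_of_le hT] at ht'
  rw [hx t ht', hz t ht', add_comm]

/-- Grönwall's inequality in integrated form, with a nonnegative dissipation `D`. -/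
theorem gronwall_integral {u D : ℝ → ℝ} {T A k : ℝ} (hA : 0 ≤ A) (hk : 0 ≤ k)
    (hu : ContinuousOn u (Icc 0 T)) (hD : ∀ t ∈ Icc 0 T, 0 ≤ D t)
    (h : ∀ t ∈ Icc 0 T, u t + D t ≤ A + k * ∫ τ in (0 : ℝ)..t, u τ) :
    ∀ t ∈ Icc 0 T, u t + D t ≤ A * Real.exp (k * T) := by
  intro t ht
  have hT : 0 ≤ T := ht.1.trans ht.2
  have hui : IntervalIntegrable u volume 0 T := by
    refine ContinuousOn.intervalIntegrable ?_
    rwa [uIcc_of_le hT]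
  set U : ℝ → ℝ := fun t => ∫ τ in (0 : ℝ)..t, u τ with hU
  have hUc : ContinuousOn U (Icc 0 T) :=
    continuousOn_primitive_Icc hT hui
  have hUd : ∀ s ∈ Ioo 0 T, HasDerivAt U (u s) s := by
    intro s hs
    refine intervalIntegral.integral_hasDerivAt_right ?_ ?_ ?_
    · refine hui.mono_set ?_
      rw [uIcc_of_le hT]
      exact uIcc_subset_Icc ⟨le_rfl, hT⟩ ⟨hs.1.le, hs.2.le⟩
    · exact (hu.mono Ioo_subset_Icc_self).stronglyMeasurableAtFilter isOpen_Ioo s hs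
    · exact hu.continuousAt (Icc_mem_nhds hs.1 hs.2)
  set g : ℝ → ℝ := fun s => Real.exp (-(k * s)) * (A + k * U s) with hg
  have hanti : AntitoneOn g (Icc 0 T) := by
    have hd : ∀ s ∈ Ioo 0 T, HasDerivAt g
        (Real.exp (-(k * s)) * (-(k * 1)) * (A + k * U s) + Real.exp (-(k * s)) * (k * u s)) s := by
      intro s hs
      exact ((((hasDerivAt_id s).const_mul k).neg).exp).mul
        (((hUd s hs).const_mul k).const_add A)
    refine antitoneOn_of_deriv_nonpos (convex_Icc _ _) ?_ ?_ ?_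
    · refine ContinuousOn.mul (by fun_prop) (continuousOn_const.add (continuousOn_const.mul hUc))
    · rw [interior_Icc]
      exact fun s hs => (hd s hs).differentiableAt.differentiableWithinAt
    · rw [interior_Icc]
      intro s hs
      rw [(hd s hs).deriv]
      have h1 := h s ⟨hs.1.le, hs.2.le⟩
      have h2 := hD s ⟨hs.1.le, hs.2.le⟩
      have : Real.exp (-(k * s)) * (-(k * 1)) * (A + k * U s) + Real.exp (-(k * s)) * (k * u s)
          = Real.exp (-(k * s)) * k * (u s - (A + k * U s)) := by ring
      rw [this]
      exact mul_nonpos_of_nonneg_of_nonpos (by positivity) (by linarith)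
  have h0 : g t ≤ A := by
    have := hanti ⟨le_rfl, hT⟩ ht ht.1
    simpa [hg, hU] using this
  have h3 : A + k * U t ≤ A * Real.exp (k * t) := by
    have := mul_le_mul_of_nonneg_right h0 (Real.exp_pos (k * t)).le
    have e : g t * Real.exp (k * t) = A + k * U t := by
      simp only [hg]
      rw [mul_right_comm, ← Real.exp_add]; simp
    linarith
  have h4 : A * Real.exp (k * t) ≤ A * Real.exp (k * T) := by
    have := ht.2
    gcongr
  linarith [h t ht]

end Calculus

end StackelbergNash

namespace StackelbergNash

/-! ### Volterra equations and measurable families of operators -/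

section Volterra

variable {H : Type*} [NormedAddCommGroup H] [NormedSpace ℝ H] [CompleteSpace H]

/-- Linear Volterra equations with bounded, merely measurable coefficients have continuous
solutions: some iterate of the Picard map is a contraction. -/
theorem exists_volterra {T ℓ : ℝ} (hT : 0 < T) {L : ℝ → H →L[ℝ] H} (hℓ : ∀ τ, ‖L τ‖ ≤ ℓ)
    (hL : ∀ y : ℝ → H, Continuous y →
      AEStronglyMeasurable (fun τ => L τ (y τ)) (volume.restrict (Ioo 0 T)))
    {F : ℝ → H} (hF : IntervalIntegrable F volume 0 T) (y₀ : H) :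
    ∃ y : ℝ → H, Continuous y ∧ ∀ t ∈ Icc 0 T, y t = y₀ + ∫ τ in (0 : ℝ)..t, (L τ (y τ) + F τ) := by
  have hℓ0 : 0 ≤ ℓ := (norm_nonneg _).trans (hℓ 0)
  set ext : C(Icc (0 : ℝ) T, H) → ℝ → H := fun y => IccExtend hT.le y with hext
  have hextc : ∀ y, Continuous (ext y) := fun y => y.continuous.Icc_extend'
  have hint : ∀ y, IntervalIntegrable (fun τ => L τ (ext y τ)) volume 0 T := by
    intro y
    rw [intervalIntegrable_iff_integrableOn_Ioo_of_le hT.le]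
    refine Integrable.mono' (g := fun _ => ℓ * ‖y‖) (integrable_const _) (hL _ (hextc y)) ?_
    refine Eventually.of_forall fun τ => ?_
    exact ((L τ).le_opNorm _).trans
      (mul_le_mul (hℓ τ) (y.norm_coe_le_norm _) (norm_nonneg _) hℓ0)
  have hsub : ∀ {t}, t ∈ Icc 0 T → uIcc 0 t ⊆ uIcc 0 T := by
    intro t ht
    rw [uIcc_of_le ht.1, uIcc_of_le hT.le]
    exact Icc_subset_Icc_right ht.2
  set Φ : C(Icc (0 : ℝ) T, H) → C(Icc (0 : ℝ) T, H) := fun y =>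
    ⟨fun t => y₀ + ∫ τ in (0 : ℝ)..t, (L τ (ext y τ) + F τ),
      continuous_const.add (continuousOn_iff_continuous_domRestrict.1
        (by
          have := intervalIntegral.continuousOn_primitive_interval' ((hint y).add hF)
            left_mem_uIcc
          rwa [uIcc_of_le hT.le] at this))⟩ with hΦ
  have hdiff : ∀ n (y z : C(Icc (0 : ℝ) T, H)) (t : Icc (0 : ℝ) T),
      ‖(Φ^[n] y) t - (Φ^[n] z) t‖ ≤ (ℓ * t) ^ n / n.factorial * dist y z := by
    intro n y z
    induction n with
    | zero =>
      intro t
      simpa [dist_eq_norm] using (ContinuousMap.dist_apply_le_dist (f := y) (g := z) t)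
    | succ n ih =>
      intro t
      rw [Function.iterate_succ_apply', Function.iterate_succ_apply']
      have e : (Φ (Φ^[n] y)) t - (Φ (Φ^[n] z)) t
          = ∫ τ in (0 : ℝ)..t, L τ (ext (Φ^[n] y) τ - ext (Φ^[n] z) τ) := by
        simp only [hΦ, ContinuousMap.coe_mk, add_sub_add_left_eq_sub]
        rw [← intervalIntegral.integral_sub
          (((hint _).add hF).mono_set (hsub t.2)) (((hint _).add hF).mono_set (hsub t.2))]
        refine intervalIntegral.integral_congr fun τ _ => ?_
        simp only [map_sub]
        abel
      rw [e]
      calc ‖∫ τ in (0 : ℝ)..t, L τ (ext (Φ^[n] y) τ - ext (Φ^[n] z) τ)‖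
          ≤ ∫ τ in (0 : ℝ)..t, ℓ * ((ℓ * τ) ^ n / n.factorial * dist y z) := by
            refine intervalIntegral.norm_integral_le_of_norm_le t.2.1 ?_
              (Continuous.intervalIntegrable (by fun_prop) _ _)
            refine Eventually.of_forall fun τ hτ => ?_
            have hτ' : τ ∈ Icc 0 T := ⟨hτ.1.le, hτ.2.trans t.2.2⟩
            refine ((L τ).le_opNorm _).trans (mul_le_mul (hℓ τ) ?_ (norm_nonneg _) hℓ0)
            simp only [hext, IccExtend_of_mem hT.le _ hτ']
            exact ih ⟨τ, hτ'⟩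
        _ = (ℓ * t) ^ (n + 1) / (n + 1).factorial * dist y z := by
            have : (fun τ : ℝ => ℓ * ((ℓ * τ) ^ n / n.factorial * dist y z))
                = fun τ => (ℓ ^ (n + 1) / n.factorial * dist y z) * τ ^ n := by
              funext τ; ring
            rw [this, intervalIntegral.integral_const_mul, integral_pow]
            have h1 : ((n + 1).factorial : ℝ) = (n + 1) * n.factorial := by
              push_cast [Nat.factorial_succ]; ring
            rw [h1]
            have : (n.factorial : ℝ) ≠ 0 := by positivity
            have : (n : ℝ) + 1 ≠ 0 := by positivity
            field_simp
            simp only [mul_pow, ne_eq, Nat.add_eq_zero_iff, one_ne_zero, and_false,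
              not_false_eq_true, zero_pow, sub_zero]
            ring
  obtain ⟨n, hn⟩ : ∃ n : ℕ, (ℓ * T) ^ n / n.factorial < 1 := by
    exact ((FloorSemiring.tendsto_pow_div_factorial_atTop (ℓ * T)).eventually
      (gt_mem_nhds one_pos)).exists
  have hcon : ContractingWith ⟨(ℓ * T) ^ n / n.factorial, by positivity⟩ Φ^[n] := by
    refine ⟨hn, LipschitzWith.of_dist_le_mul fun y z => ?_⟩
    refine (ContinuousMap.dist_le (mul_nonneg (NNReal.coe_nonneg _) dist_nonneg)).2 fun t => ?_
    rw [dist_eq_norm]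
    refine (hdiff n y z t).trans ?_
    have h1 := mul_nonneg hℓ0 t.2.1
    have h2 := t.2.2
    change _ ≤ (ℓ * T) ^ n / n.factorial * dist y z
    gcongr
  have hfix := hcon.isFixedPt_fixedPoint_iterate
  set y := ContractingWith.fixedPoint _ hcon
  refine ⟨ext y, hextc y, fun t ht => ?_⟩
  have : (Φ y) ⟨t, ht⟩ = y ⟨t, ht⟩ := by rw [hfix]
  rw [hext]
  simp only [IccExtend_of_mem hT.le _ ht]
  exact this.symm

end Volterra

section Measurability

variable {H : Type*} [NormedAddCommGroup H] [InnerProductSpace ℝ H]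

theorem countable_of_orthonormal [SecondCountableTopology H] {ι : Type*} {b : ι → H}
    (hb : Orthonormal ℝ b) : Countable ι := by
  have hd : Pairwise (Function.onFun Disjoint fun i => Metric.ball (b i) (1 / 2)) := by
    intro i j hij
    refine Metric.ball_disjoint_ball ?_
    have h : ‖b i - b j‖ ^ 2 = 2 := by
      rw [norm_sub_sq_real, hb.1 i, hb.1 j, hb.2 hij]; norm_num
    rw [dist_eq_norm]
    nlinarith [norm_nonneg (b i - b j)]
  refine countable_univ_iff.1 (Set.PairwiseDisjoint.countable_of_isOpen
    (s := fun i => Metric.ball (b i) (1 / 2)) (fun i _ j _ hij => hd hij)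
    (fun _ _ => Metric.isOpen_ball) fun i _ => ⟨b i, ?_⟩)
  exact Metric.mem_ball_self (by norm_num)

/-- Pettis' theorem: in a separable Hilbert space, weak measurability is strong measurability. -/
theorem aestronglyMeasurable_of_inner [CompleteSpace H] [SecondCountableTopology H] {α : Type*}
    [MeasurableSpace α] {m : Measure α} {f : α → H}
    (hf : ∀ v : H, AEStronglyMeasurable (fun x => inner ℝ (f x) v) m) :
    AEStronglyMeasurable f m := by
  obtain ⟨w, b, -⟩ := exists_hilbertBasis ℝ H
  have : Countable w := countable_of_orthonormal b.orthonormal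
  refine aestronglyMeasurable_of_tendsto_ae (u := atTop)
    (f := fun (s : Finset w) x => ∑ i ∈ s, (inner ℝ (f x) (b i) : ℝ) • b i) ?_ ?_
  · intro s
    exact Finset.aestronglyMeasurable_fun_sum s fun i _ => (hf (b i)).smul_const (b i)
  · refine Eventually.of_forall fun x => ?_
    have := b.hasSum_repr (f x)
    simp only [b.repr_apply_apply] at this
    simp_rw [fun i => real_inner_comm (b i) (f x)]
    exact this

/-- A bounded measurable family of symmetric operators on a Hilbert space, the abstract form of
the multiplication by a bounded potential `c(·,t)`. -/
structure IsPotential (B : ℝ → H →L[ℝ] H) (b T : ℝ) : Prop where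
  norm_le : ∀ τ, ‖B τ‖ ≤ b
  symm : ∀ τ x y, inner ℝ (B τ x) y = inner ℝ x (B τ y)
  meas : ∀ v, AEStronglyMeasurable (fun τ => B τ v) (volume.restrict (Ioo 0 T))

variable {B : ℝ → H →L[ℝ] H} {b T : ℝ}

theorem IsPotential.nonneg (hB : IsPotential B b T) : 0 ≤ b :=
  (norm_nonneg _).trans (hB.norm_le 0)

theorem IsPotential.apply_le (hB : IsPotential B b T) (τ : ℝ) (x : H) : ‖B τ x‖ ≤ b * ‖x‖ :=
  ((B τ).le_opNorm x).trans (mul_le_mul_of_nonneg_right (hB.norm_le τ) (norm_nonneg _))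

theorem IsPotential.aestronglyMeasurable [CompleteSpace H] [SecondCountableTopology H]
    (hB : IsPotential B b T) {y : ℝ → H}
    (hy : AEStronglyMeasurable y (volume.restrict (Ioo 0 T))) :
    AEStronglyMeasurable (fun τ => B τ (y τ)) (volume.restrict (Ioo 0 T)) := by
  refine aestronglyMeasurable_of_inner fun v => ?_
  simp_rw [hB.symm]
  exact hy.inner (hB.meas v)

theorem IsPotential.memLp [CompleteSpace H] [SecondCountableTopology H]
    (hB : IsPotential B b T) {y : ℝ → H} (hy : MemLp y 2 (volume.restrict (Ioo 0 T))) :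
    MemLp (fun τ => B τ (y τ)) 2 (volume.restrict (Ioo 0 T)) :=
  hy.of_le_mul (hB.aestronglyMeasurable hy.1) (Eventually.of_forall fun τ => hB.apply_le τ (y τ))

theorem measurePreserving_reverse (T : ℝ) : MeasurePreserving (fun τ => T - τ)
    (volume.restrict (Ioo 0 T)) (volume.restrict (Ioo 0 T)) := by
  have := (Measure.measurePreserving_sub_left volume T).restrict_preimage
    (measurableSet_Ioo (a := 0) (b := T))
  simpa using this

theorem IsPotential.reverse (hB : IsPotential B b T) : IsPotential (fun τ => B (T - τ)) b T :=
  ⟨fun _ => hB.norm_le _, fun _ => hB.symm _, fun v =>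
    (hB.meas v).comp_measurePreserving (measurePreserving_reverse T)⟩

end Measurability

end StackelbergNash

namespace StackelbergNash

/-! ### Resolvents of the operator of a closed quadratic form -/

/-- The resolvent `R = (1 + ε² A)⁻¹` of the operator `A = D* D`, where `G` is the graph of the
gradient `D`, together with `W = D R`. Both are determined by the variational equation. -/
structure Resolvent {H : Type*} [NormedAddCommGroup H] [InnerProductSpace ℝ H]
    (G : Submodule ℝ (H × H)) (ε : ℝ) where
  R : H →L[ℝ] H
  W : H →L[ℝ] H
  mem : ∀ h, (R h, W h) ∈ G
  eq : ∀ h, ∀ p ∈ G, inner ℝ (R h) p.1 + ε ^ 2 * inner ℝ (W h) p.2 = inner ℝ h p.1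

section

variable {H : Type*} [NormedAddCommGroup H] [InnerProductSpace ℝ H] {G : Submodule ℝ (H × H)}

/-- Resolvents exist: `(R h, ε W h)` is the orthogonal projection of `(h, 0)` onto the rescaled
graph. -/
theorem Resolvent.nonempty [CompleteSpace H] (hG : IsClosed (G : Set (H × H))) {ε : ℝ}
    (hε : 0 < ε) : Nonempty (Resolvent G ε) := by
  let S : WithLp 2 (H × H) →L[ℝ] H × H :=
    (WithLp.fstL 2 ℝ H H).prod (ε⁻¹ • WithLp.sndL 2 ℝ H H)
  let K : Submodule ℝ (WithLp 2 (H × H)) := G.comap S.toLinearMap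
  have hK : IsClosed (K : Set (WithLp 2 (H × H))) := hG.preimage S.continuous
  have : CompleteSpace K := hK.completeSpace_coe
  let I : H →L[ℝ] WithLp 2 (H × H) :=
    (WithLp.prodContinuousLinearEquiv 2 ℝ H H).symm.toContinuousLinearMap.comp
      (ContinuousLinearMap.inl ℝ H H)
  refine ⟨⟨(WithLp.fstL 2 ℝ H H).comp (K.starProjection.comp I),
    (ε⁻¹ • WithLp.sndL 2 ℝ H H).comp (K.starProjection.comp I), fun h => ?_, fun h p hp => ?_⟩⟩
  · exact K.starProjection_apply_mem (I h)
  · have hp' : (WithLp.toLp 2 (p.1, ε • p.2) : WithLp 2 (H × H)) ∈ K := by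
      change (p.1, ε⁻¹ • ε • p.2) ∈ G
      rwa [inv_smul_smul₀ hε.ne']
    have := K.starProjection_inner_eq_zero (I h) _ hp'
    rw [inner_sub_left, WithLp.prod_inner_apply, WithLp.prod_inner_apply] at this
    have e2 : (I h).ofLp.2 = 0 := rfl
    have e1 : (I h).ofLp.1 = h := rfl
    rw [e1, e2, inner_zero_left] at this
    simp only [inner_smul_right] at this
    change inner ℝ (K.starProjection (I h)).ofLp.1 p.1
      + ε ^ 2 * inner ℝ (ε⁻¹ • (K.starProjection (I h)).ofLp.2) p.2 = _
    rw [real_inner_smul_left]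
    have e3 : ε ^ 2 * (ε⁻¹ * inner ℝ (K.starProjection (I h)).ofLp.2 p.2)
        = ε * inner ℝ (K.starProjection (I h)).ofLp.2 p.2 := by
      field_simp
    linarith

namespace Resolvent

variable {ε : ℝ} (Q : Resolvent G ε)

/-- The Yosida approximation `A (1 + ε² A)⁻¹ = ε⁻² (1 - R)`. -/
noncomputable def A : H →L[ℝ] H := (ε ^ 2)⁻¹ • (ContinuousLinearMap.id ℝ H - Q.R)

theorem A_apply (h : H) : Q.A h = (ε ^ 2)⁻¹ • (h - Q.R h) := rfl

theorem inner_W (hε : 0 < ε) (h : H) {p : H × H} (hp : p ∈ G) :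
    inner ℝ (Q.W h) p.2 = (inner ℝ (Q.A h) p.1 : ℝ) := by
  have := Q.eq h p hp
  rw [A_apply, real_inner_smul_left, inner_sub_left]
  have h2 : ε ^ 2 ≠ 0 := by positivity
  field_simp
  linarith

theorem R_add_A (hε : 0 < ε) (h : H) : Q.R h + ε ^ 2 • Q.A h = h := by
  rw [A_apply, smul_inv_smul₀ (by positivity)]
  abel

theorem inner_A_R (hε : 0 < ε) (h k : H) :
    inner ℝ (Q.A h) (Q.R k) = (inner ℝ (Q.W h) (Q.W k) : ℝ) :=
  (Q.inner_W hε h (Q.mem k)).symm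

theorem R_symm (h k : H) : inner ℝ (Q.R h) k = (inner ℝ h (Q.R k) : ℝ) := by
  have h1 := Q.eq h _ (Q.mem k)
  have h2 := Q.eq k _ (Q.mem h)
  simp only at h1 h2
  rw [real_inner_comm (Q.R k) (Q.R h), real_inner_comm (Q.W k) (Q.W h)] at h1
  rw [real_inner_comm k (Q.R h)]
  linarith

theorem A_symm (h k : H) : inner ℝ (Q.A h) k = (inner ℝ h (Q.A k) : ℝ) := by
  rw [A_apply, A_apply, real_inner_smul_left, real_inner_smul_right, inner_sub_left,
    inner_sub_right, R_symm]

theorem norm_R_le (h : H) : ‖Q.R h‖ ≤ ‖h‖ := by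
  have h1 := Q.eq h _ (Q.mem h)
  simp only [real_inner_self_eq_norm_sq] at h1
  have h2 := real_inner_le_norm h (Q.R h)
  have h3 := mul_nonneg (sq_nonneg ε) (sq_nonneg ‖Q.W h‖)
  by_contra! hc
  nlinarith [norm_nonneg h, norm_nonneg (Q.R h)]

theorem inner_A_self (hε : 0 < ε) (h : H) :
    inner ℝ (Q.A h) h = ‖Q.W h‖ ^ 2 + ε ^ 2 * ‖Q.A h‖ ^ 2 := by
  have := Q.inner_A_R hε h h
  nth_rewrite 2 [← Q.R_add_A hε h]
  rw [inner_add_right, this, real_inner_smul_right, real_inner_self_eq_norm_sq,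
    real_inner_self_eq_norm_sq]

theorem norm_W_le (hε : 0 < ε) {h w : H} (hw : (h, w) ∈ G) : ‖Q.W h‖ ≤ ‖w‖ := by
  have h1 := Q.inner_W hε h hw
  simp only at h1
  rw [Q.inner_A_self hε] at h1
  have h2 := real_inner_le_norm (Q.W h) w
  have h3 := mul_nonneg (sq_nonneg ε) (sq_nonneg ‖Q.A h‖)
  by_contra! hc
  nlinarith [norm_nonneg w, norm_nonneg (Q.W h)]

theorem inner_A_self_le (hε : 0 < ε) {h w : H} (hw : (h, w) ∈ G) :
    inner ℝ (Q.A h) h ≤ ‖w‖ ^ 2 := by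
  have h1 := Q.inner_W hε h hw
  simp only at h1
  have h2 := real_inner_le_norm (Q.W h) w
  have h3 := Q.norm_W_le hε hw
  rw [← h1]
  nlinarith [norm_nonneg w, norm_nonneg (Q.W h)]

theorem norm_sub_R_le (hε : 0 < ε) {h w : H} (hw : (h, w) ∈ G) : ‖h - Q.R h‖ ≤ ε * ‖w‖ := by
  have h1 := Q.inner_A_self_le hε hw
  rw [Q.inner_A_self hε] at h1
  have h2 : h - Q.R h = ε ^ 2 • Q.A h := by
    nth_rewrite 1 [← Q.R_add_A hε h]; abel
  rw [h2, norm_smul, Real.norm_of_nonneg (by positivity)]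
  have h3 : (ε * ‖Q.A h‖) ^ 2 ≤ ‖w‖ ^ 2 := by nlinarith [sq_nonneg ‖Q.W h‖]
  have h4 := abs_le_of_sq_le_sq h3 (norm_nonneg w)
  have h5 := (abs_le.1 h4).2
  nlinarith

/-- The coercivity behind the convergence of the Yosida approximations: the gradients of the
regularized states are compared at the price of `(ε² + δ²) ‖A y‖²`. -/
theorem inner_A_sub (hε : 0 < ε) {δ : ℝ} (hδ : 0 < δ) (Q' : Resolvent G δ) (h k : H) :
    ‖Q.W h - Q'.W k‖ ^ 2 - (ε ^ 2 + δ ^ 2) * (‖Q.A h‖ ^ 2 + ‖Q'.A k‖ ^ 2)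
      ≤ inner ℝ (Q.A h - Q'.A k) (h - k) := by
  have hmem : (Q.R h - Q'.R k, Q.W h - Q'.W k) ∈ G := G.sub_mem (Q.mem h) (Q'.mem k)
  have e1 : inner ℝ (Q.A h - Q'.A k) (Q.R h - Q'.R k) = ‖Q.W h - Q'.W k‖ ^ 2 := by
    have a := Q.inner_W hε h hmem
    have b := Q'.inner_W hδ k hmem
    simp only at a b
    rw [inner_sub_left, ← a, ← b, ← inner_sub_left, real_inner_self_eq_norm_sq]
  have e2 : h - k = (Q.R h - Q'.R k) + (ε ^ 2 • Q.A h - δ ^ 2 • Q'.A k) := by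
    nth_rewrite 1 [← Q.R_add_A hε h, ← Q'.R_add_A hδ k]; abel
  rw [e2, inner_add_right, e1, inner_sub_right, inner_sub_left, inner_sub_left]
  simp only [real_inner_smul_right, real_inner_self_eq_norm_sq]
  have b1 := (abs_le.1 (abs_real_inner_le_norm (Q.A h) (Q'.A k))).2
  have b2 : inner ℝ (Q'.A k) (Q.A h) = (inner ℝ (Q.A h) (Q'.A k) : ℝ) := real_inner_comm _ _
  rw [b2]
  have hx := norm_nonneg (Q.A h)
  have hy := norm_nonneg (Q'.A k)
  have b3 : inner ℝ (Q.A h) (Q'.A k) ≤ ‖Q.A h‖ ^ 2 + ‖Q'.A k‖ ^ 2 := by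
    nlinarith [sq_nonneg (‖Q.A h‖ - ‖Q'.A k‖)]
  nlinarith [mul_le_mul_of_nonneg_left b3 (sq_nonneg ε), mul_le_mul_of_nonneg_left b3 (sq_nonneg δ),
    mul_nonneg (sq_nonneg ε) (sq_nonneg ‖Q.A h‖), mul_nonneg (sq_nonneg δ) (sq_nonneg ‖Q'.A k‖)]

end Resolvent

/-- Resolvents converge strongly to the identity. -/
theorem tendsto_resolvent (hd : Dense (Prod.fst '' (G : Set (H × H)))) {ε : ℕ → ℝ}
    (hε : ∀ n, 0 < ε n) (hlim : Tendsto ε atTop (𝓝 0)) (Q : ∀ n, Resolvent G (ε n)) (h : H) :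
    Tendsto (fun n => (Q n).R h) atTop (𝓝 h) := by
  rw [Metric.tendsto_atTop]
  intro r hr
  obtain ⟨_, ⟨⟨k, w⟩, hkw, rfl⟩, hk⟩ := hd.exists_dist_lt h (show 0 < r / 3 by positivity)
  have h1 : Tendsto (fun n => ε n * ‖w‖) atTop (𝓝 0) := by simpa using hlim.mul_const ‖w‖
  obtain ⟨N, hN⟩ := eventually_atTop.1 (h1.eventually (gt_mem_nhds (show 0 < r / 3 by positivity)))
  refine ⟨N, fun n hn => ?_⟩
  have h2 := (Q n).norm_sub_R_le (hε n) hkw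
  have h3 := (Q n).norm_R_le (h - k)
  have h4 := hN n hn
  rw [dist_eq_norm] at hk ⊢
  simp only at hk
  have e : (Q n).R h - h = (Q n).R (h - k) - (h - k) - (k - (Q n).R k) := by
    rw [map_sub]; abel
  rw [e]
  have h5 := norm_sub_le ((Q n).R (h - k) - (h - k)) (k - (Q n).R k)
  have h6 := norm_sub_le ((Q n).R (h - k)) (h - k)
  linarith

end

end StackelbergNash

namespace StackelbergNash

/-! ### Energy estimates and duality for weak solutions -/

section

variable {H : Type*} [NormedAddCommGroup H] [InnerProductSpace ℝ H]

theorem intervalIntegrable_of_memLp {E : Type*} [NormedAddCommGroup E] {F : ℝ → E} {T : ℝ}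
    (hT : 0 ≤ T) (hF : MemLp F 2 (volume.restrict (Ioo 0 T))) :
    IntervalIntegrable F volume 0 T := by
  rw [intervalIntegrable_iff_integrableOn_Ioo_of_le hT]
  exact hF.integrable one_le_two

theorem intervalIntegrable_norm_sq_of_memLp {E : Type*} [NormedAddCommGroup E] {F : ℝ → E} {T : ℝ}
    (hT : 0 ≤ T) (hF : MemLp F 2 (volume.restrict (Ioo 0 T))) :
    IntervalIntegrable (fun t => ‖F t‖ ^ 2) volume 0 T := by
  rw [intervalIntegrable_iff_integrableOn_Ioo_of_le hT]
  exact hF.integrable_norm_pow (by norm_num)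

theorem memLp_of_continuousOn_Icc {E : Type*} [NormedAddCommGroup E] {y : ℝ → E} {T : ℝ}
    (hy : ContinuousOn y (Icc 0 T)) : MemLp y 2 (volume.restrict (Ioo 0 T)) := by
  obtain ⟨C, hC⟩ := isCompact_Icc.exists_bound_of_continuousOn hy
  refine MemLp.of_bound ((hy.mono Ioo_subset_Icc_self).aestronglyMeasurable measurableSet_Ioo) C ?_
  filter_upwards [ae_restrict_mem measurableSet_Ioo] with t ht using hC t (Ioo_subset_Icc_self ht)

theorem intervalIntegrable_inner {F y : ℝ → H} {T : ℝ} (hT : 0 ≤ T)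
    (hF : IntervalIntegrable F volume 0 T) (hy : ContinuousOn y (Icc 0 T)) :
    IntervalIntegrable (fun t => (inner ℝ (F t) (y t) : ℝ)) volume 0 T := by
  rw [intervalIntegrable_iff_integrableOn_Ioo_of_le hT] at hF ⊢
  obtain ⟨C, hC⟩ := isCompact_Icc.exists_bound_of_continuousOn hy
  refine Integrable.mono' (hF.norm.const_mul C)
    (hF.1.inner ((hy.mono Ioo_subset_Icc_self).aestronglyMeasurable measurableSet_Ioo)) ?_
  filter_upwards [ae_restrict_mem measurableSet_Ioo] with t ht
  refine (norm_inner_le_norm _ _).trans ?_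
  rw [mul_comm]
  exact mul_le_mul_of_nonneg_right (hC t (Ioo_subset_Icc_self ht)) (norm_nonneg _)

theorem uIcc_zero_subset {t T : ℝ} (ht : t ∈ Icc 0 T) : uIcc 0 t ⊆ uIcc 0 T := by
  rw [uIcc_of_le ht.1, uIcc_of_le (ht.1.trans ht.2)]
  exact Icc_subset_Icc_right ht.2

theorem integral_le_integral_zero {u : ℝ → ℝ} {t T : ℝ} (hu : IntervalIntegrable u volume 0 T)
    (h0 : ∀ τ, 0 ≤ u τ) (ht : t ∈ Icc 0 T) :
    ∫ τ in (0 : ℝ)..t, u τ ≤ ∫ τ in (0 : ℝ)..T, u τ :=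
  intervalIntegral.integral_mono_interval le_rfl ht.1 ht.2 (Eventually.of_forall h0) hu

/-- `∫₀ᵗ` only sees the values almost everywhere in `(0,T)`. -/
theorem integral_zero_congr_ae {E : Type*} [NormedAddCommGroup E] [NormedSpace ℝ E]
    {f g : ℝ → E} {t T : ℝ} (ht : t ∈ Icc 0 T)
    (h : ∀ᵐ τ ∂volume.restrict (Ioo 0 T), f τ = g τ) :
    ∫ τ in (0 : ℝ)..t, f τ = ∫ τ in (0 : ℝ)..t, g τ := by
  refine intervalIntegral.integral_congr_ae ?_
  rw [ae_restrict_iff' measurableSet_Ioo] at h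
  have h2 : ∀ᵐ τ : ℝ, τ ≠ T := by simp [ae_iff, measure_singleton]
  filter_upwards [h, h2] with τ h1 h2 h3
  rw [uIoc_of_le ht.1] at h3
  exact h1 ⟨h3.1, lt_of_le_of_ne (h3.2.trans ht.2) h2⟩

/-- The energy identity of a primitive. -/
theorem norm_sq_primitive [CompleteSpace H] {g x : ℝ → H} {x₀ : H} {T : ℝ}
    (hg : IntervalIntegrable g volume 0 T)
    (hx : ∀ t ∈ Icc 0 T, x t = x₀ + ∫ τ in (0 : ℝ)..t, g τ) {t : ℝ} (ht : t ∈ Icc 0 T) :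
    ‖x t‖ ^ 2 = ‖x₀‖ ^ 2 + ∫ τ in (0 : ℝ)..t, 2 * inner ℝ (g τ) (x τ) := by
  have hg' := hg.mono_set (uIcc_zero_subset ht)
  have hx' : ∀ s ∈ Icc 0 t, x s = x₀ + ∫ τ in (0 : ℝ)..s, g τ :=
    fun s hs => hx s ⟨hs.1, hs.2.trans ht.2⟩
  have := inner_primitive_sub ht.1 hg' hg' hx' hx'
  rw [real_inner_self_eq_norm_sq, real_inner_self_eq_norm_sq] at this
  have e : ∀ τ, inner ℝ (g τ) (x τ) + inner ℝ (x τ) (g τ) = 2 * (inner ℝ (g τ) (x τ) : ℝ) := by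
    intro τ
    rw [real_inner_comm (g τ) (x τ)]; ring
  simp_rw [e] at this
  linarith

/-- The abstract weak solutions of `y' + D* D y + B y = F`, `y(0) = y₀`, where `G` is the graph of
the gradient `D` and `p = D y`. -/
structure IsWeakSol (G : Submodule ℝ (H × H)) (B : ℝ → H →L[ℝ] H) (T : ℝ) (F : ℝ → H) (y₀ : H)
    (y p : ℝ → H) : Prop where
  cont : ContinuousOn y (Icc 0 T)
  init : y 0 = y₀
  memLp : MemLp p 2 (volume.restrict (Ioo 0 T))
  mem : ∀ᵐ t ∂volume.restrict (Ioo 0 T), (y t, p t) ∈ G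
  eq : ∀ q ∈ G, ∀ t ∈ Icc 0 T, inner ℝ (y t) q.1 - inner ℝ y₀ q.1
    + ∫ τ in (0 : ℝ)..t, (inner ℝ (p τ) q.2 + inner ℝ (B τ (y τ)) q.1)
      = ∫ τ in (0 : ℝ)..t, (inner ℝ (F τ) q.1 : ℝ)

theorem IsWeakSol.congr {G : Submodule ℝ (H × H)} {B : ℝ → H →L[ℝ] H} {T : ℝ} {F : ℝ → H} {y₀ : H}
    {y y' p : ℝ → H} (hT : 0 ≤ T) (h : IsWeakSol G B T F y₀ y p) (hy : ∀ t ∈ Icc 0 T, y' t = y t) :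
    IsWeakSol G B T F y₀ y' p := by
  refine ⟨h.cont.congr hy, (hy 0 ⟨le_rfl, hT⟩).trans h.init, h.memLp, ?_, fun q hq t ht => ?_⟩
  · filter_upwards [h.mem, ae_restrict_mem measurableSet_Ioo] with t h1 h2
    rwa [hy t (Ioo_subset_Icc_self h2)]
  · rw [hy t ht, ← h.eq q hq t ht]
    congr 1
    refine intervalIntegral.integral_congr fun τ hτ => ?_
    rw [uIcc_of_le ht.1] at hτ
    rw [hy τ ⟨hτ.1, hτ.2.trans ht.2⟩]

variable [CompleteSpace H] [SecondCountableTopology H] {G : Submodule ℝ (H × H)}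
  {B : ℝ → H →L[ℝ] H} {b T : ℝ}

theorem IsWeakSol.sub (hB : IsPotential B b T) (hT : 0 ≤ T) {F F' : ℝ → H} {y₀ y₀' : H}
    {y p y' p' : ℝ → H} (hF : MemLp F 2 (volume.restrict (Ioo 0 T)))
    (hF' : MemLp F' 2 (volume.restrict (Ioo 0 T)))
    (h : IsWeakSol G B T F y₀ y p) (h' : IsWeakSol G B T F' y₀' y' p') :
    IsWeakSol G B T (fun t => F t - F' t) (y₀ - y₀') (fun t => y t - y' t)
      (fun t => p t - p' t) := by
  refine ⟨h.cont.sub h'.cont, by simp [h.init, h'.init], h.memLp.sub h'.memLp, ?_, ?_⟩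
  · filter_upwards [h.mem, h'.mem] with t h1 h2 using G.sub_mem h1 h2
  · intro q hq t ht
    have e1 := h.eq q hq t ht
    have e2 := h'.eq q hq t ht
    have hi : ∀ {k : ℝ → H} (c : H), MemLp k 2 (volume.restrict (Ioo 0 T)) →
        IntervalIntegrable (fun τ => (inner ℝ (k τ) c : ℝ)) volume 0 t := fun c hk =>
      (intervalIntegrable_inner hT (intervalIntegrable_of_memLp hT hk)
        continuousOn_const).mono_set (uIcc_zero_subset ht)
    have hy := hB.memLp (memLp_of_continuousOn_Icc h.cont)
    have hy' := hB.memLp (memLp_of_continuousOn_Icc h'.cont)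
    simp only [inner_sub_left, map_sub]
    rw [intervalIntegral.integral_sub (hi _ hF) (hi _ hF'), ← e1, ← e2]
    have : ∀ τ, (inner ℝ (p τ) q.2 : ℝ) - inner ℝ (p' τ) q.2
        + (inner ℝ (B τ (y τ)) q.1 - inner ℝ (B τ (y' τ)) q.1)
        = (inner ℝ (p τ) q.2 + inner ℝ (B τ (y τ)) q.1)
          - (inner ℝ (p' τ) q.2 + inner ℝ (B τ (y' τ)) q.1) := fun τ => by ring
    simp_rw [this]
    rw [intervalIntegral.integral_sub ((hi _ h.memLp).add (hi _ hy))
      ((hi _ h'.memLp).add (hi _ hy'))]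
    ring

/-- Testing with the range of the resolvent turns the weak equation into an equation in `H`. -/
theorem IsWeakSol.resolvent_eq (hB : IsPotential B b T) {F : ℝ → H} {y₀ : H}
    {y p : ℝ → H} (hF : MemLp F 2 (volume.restrict (Ioo 0 T)))
    (h : IsWeakSol G B T F y₀ y p) {ε : ℝ} (hε : 0 < ε) (Q : Resolvent G ε) {t : ℝ}
    (ht : t ∈ Icc 0 T) :
    Q.R (y t) = Q.R y₀ + ∫ τ in (0 : ℝ)..t, (Q.R (F τ - B τ (y τ)) - Q.A (y τ)) := by
  have hT : 0 ≤ T := ht.1.trans ht.2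
  have hBy := hB.memLp (memLp_of_continuousOn_Icc h.cont)
  have hint : ∀ {k : ℝ → H}, MemLp k 2 (volume.restrict (Ioo 0 T)) →
      IntervalIntegrable k volume 0 t := fun hk =>
    (intervalIntegrable_of_memLp hT hk).mono_set (uIcc_zero_subset ht)
  have hi : ∀ {k : ℝ → H} (c : H), MemLp k 2 (volume.restrict (Ioo 0 T)) →
      IntervalIntegrable (fun τ => (inner ℝ (k τ) c : ℝ)) volume 0 t := fun c hk =>
    (intervalIntegrable_inner hT (intervalIntegrable_of_memLp hT hk)
      continuousOn_const).mono_set (uIcc_zero_subset ht)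
  have hRF : MemLp (fun τ => Q.R (F τ - B τ (y τ)) - Q.A (y τ)) 2 (volume.restrict (Ioo 0 T)) :=
    (Q.R.comp_memLp' (hF.sub hBy)).sub (Q.A.comp_memLp' (memLp_of_continuousOn_Icc h.cont))
  refine ext_inner_left ℝ fun k => ?_
  rw [inner_add_right, ← innerSL_apply_apply ℝ k (∫ τ in (0 : ℝ)..t, _),
    ← ContinuousLinearMap.intervalIntegral_comp_comm (innerSL ℝ k) (hint hRF)]
  have e := h.eq _ (Q.mem k) t ht
  have e2 : ∫ τ in (0 : ℝ)..t, (innerSL ℝ k) (Q.R (F τ - B τ (y τ)) - Q.A (y τ))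
      = ∫ τ in (0 : ℝ)..t, (inner ℝ (F τ) (Q.R k)
        - (inner ℝ (p τ) (Q.W k) + inner ℝ (B τ (y τ)) (Q.R k))) := by
    refine integral_zero_congr_ae ht ?_
    filter_upwards [h.mem] with τ hτ
    have a := Q.inner_W hε k hτ
    simp only at a
    rw [innerSL_apply_apply, inner_sub_right, ← Q.R_symm, ← Q.A_symm, ← a, inner_sub_right,
      real_inner_comm (p τ), real_inner_comm (F τ), real_inner_comm (B τ (y τ))]
    ring
  rw [e2, intervalIntegral.integral_sub (hi _ hF) ((hi _ h.memLp).add (hi _ hBy)), ← e,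
    ← Q.R_symm, ← Q.R_symm, real_inner_comm (y t), real_inner_comm y₀]
  ring

/-- The energy estimate, from the energy identity of the regularization `R y` and `R → 1`. -/
theorem IsWeakSol.norm_sq_le (hG : IsClosed (G : Set (H × H)))
    (hd : Dense (Prod.fst '' (G : Set (H × H)))) (hB : IsPotential B b T) {F : ℝ → H} {y₀ : H}
    {y p : ℝ → H} (hF : MemLp F 2 (volume.restrict (Ioo 0 T)))
    (h : IsWeakSol G B T F y₀ y p) {t : ℝ} (ht : t ∈ Icc 0 T) :
    ‖y t‖ ^ 2 ≤ (‖y₀‖ ^ 2 + ∫ τ in (0 : ℝ)..T, ‖F τ‖ ^ 2) * Real.exp ((1 + 2 * b) * T) := by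
  have hT : 0 ≤ T := ht.1.trans ht.2
  have hb := hB.nonneg
  have hyL := memLp_of_continuousOn_Icc h.cont
  have hBy := hB.memLp hyL
  have hFi := intervalIntegrable_norm_sq_of_memLp hT hF
  have hyi := intervalIntegrable_norm_sq_of_memLp hT hyL
  have hε : ∀ n : ℕ, (0 : ℝ) < 1 / ((n : ℝ) + 1) := fun n => by positivity
  have Q : ∀ n : ℕ, Resolvent G (1 / ((n : ℝ) + 1)) := fun n =>
    (Resolvent.nonempty hG (hε n)).some
  have hQ := tendsto_resolvent hd hε tendsto_one_div_add_atTop_nhds_zero_nat Q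
  have main : ∀ t ∈ Icc 0 T, ‖y t‖ ^ 2 ≤ (‖y₀‖ ^ 2 + ∫ τ in (0 : ℝ)..T, ‖F τ‖ ^ 2)
      + (1 + 2 * b) * ∫ τ in (0 : ℝ)..t, ‖y τ‖ ^ 2 := by
    intro t ht
    refine le_of_tendsto ((hQ (y t)).norm.pow 2) (Eventually.of_forall fun n => ?_)
    have hg : IntervalIntegrable (fun τ => (Q n).R (F τ - B τ (y τ)) - (Q n).A (y τ)) volume 0 T :=
      intervalIntegrable_of_memLp hT (((Q n).R.comp_memLp' (hF.sub hBy)).sub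
        ((Q n).A.comp_memLp' hyL))
    have hx := fun t ht => h.resolvent_eq hB hF (hε n) (Q n) (t := t) ht
    have e := norm_sq_primitive (x := fun t => (Q n).R (y t)) hg hx ht
    rw [e]
    have h1 : ‖(Q n).R y₀‖ ^ 2 ≤ ‖y₀‖ ^ 2 := by
      have := (Q n).norm_R_le y₀
      gcongr
    have h2 : ∫ τ in (0 : ℝ)..t,
        2 * inner ℝ ((Q n).R (F τ - B τ (y τ)) - (Q n).A (y τ)) ((Q n).R (y τ))
        ≤ ∫ τ in (0 : ℝ)..t, (‖F τ‖ ^ 2 + (1 + 2 * b) * ‖y τ‖ ^ 2) := by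
      refine intervalIntegral.integral_mono_on ht.1 ?_ ?_ fun τ _ => ?_
      · exact ((intervalIntegrable_inner hT hg
          ((Q n).R.continuous.comp_continuousOn h.cont)).const_mul 2).mono_set
            (uIcc_zero_subset ht)
      · exact (hFi.add (hyi.const_mul _)).mono_set (uIcc_zero_subset ht)
      · rw [inner_sub_left, (Q n).inner_A_R (hε n), real_inner_self_eq_norm_sq]
        have a1 := real_inner_le_norm ((Q n).R (F τ - B τ (y τ))) ((Q n).R (y τ))
        have a2 := (Q n).norm_R_le (F τ - B τ (y τ))
        have a3 := (Q n).norm_R_le (y τ)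
        have a4 := (norm_sub_le (F τ) (B τ (y τ))).trans
          (add_le_add_right (hB.apply_le τ (y τ)) _)
        have a5 : ‖(Q n).R (F τ - B τ (y τ))‖ * ‖(Q n).R (y τ)‖
            ≤ (‖F τ‖ + b * ‖y τ‖) * ‖y τ‖ :=
          mul_le_mul (a2.trans a4) a3 (norm_nonneg _) (by positivity)
        nlinarith [sq_nonneg (‖F τ‖ - ‖y τ‖), sq_nonneg ‖(Q n).W (y τ)‖]
    have h3 : ∫ τ in (0 : ℝ)..t, (‖F τ‖ ^ 2 + (1 + 2 * b) * ‖y τ‖ ^ 2)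
        = (∫ τ in (0 : ℝ)..t, ‖F τ‖ ^ 2) + (1 + 2 * b) * ∫ τ in (0 : ℝ)..t, ‖y τ‖ ^ 2 := by
      rw [intervalIntegral.integral_add (hFi.mono_set (uIcc_zero_subset ht))
        ((hyi.const_mul _).mono_set (uIcc_zero_subset ht)), intervalIntegral.integral_const_mul]
    have h4 := integral_le_integral_zero hFi (fun τ => sq_nonneg _) ht
    linarith
  have hI : 0 ≤ ∫ τ in (0 : ℝ)..T, ‖F τ‖ ^ 2 :=
    intervalIntegral.integral_nonneg hT fun _ _ => sq_nonneg _
  have := gronwall_integral (u := fun t => ‖y t‖ ^ 2) (D := fun _ => 0)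
    (add_nonneg (sq_nonneg ‖y₀‖) hI) (k := 1 + 2 * b) (by positivity) (h.cont.norm.pow 2)
    (fun _ _ => le_rfl) (fun t ht => by simpa using main t ht) t ht
  simpa using this

theorem IsWeakSol.unique (hG : IsClosed (G : Set (H × H)))
    (hd : Dense (Prod.fst '' (G : Set (H × H)))) (hB : IsPotential B b T) {F : ℝ → H} {y₀ : H}
    {y p y' p' : ℝ → H} (hF : MemLp F 2 (volume.restrict (Ioo 0 T)))
    (h : IsWeakSol G B T F y₀ y p) (h' : IsWeakSol G B T F y₀ y' p') {t : ℝ}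
    (ht : t ∈ Icc 0 T) : y t = y' t := by
  have := (h.sub hB (ht.1.trans ht.2) hF hF h').norm_sq_le hG hd hB (hF.sub hF) ht
  simp only [Pi.sub_apply, sub_self, norm_zero, ne_eq, OfNat.ofNat_ne_zero, not_false_eq_true,
    zero_pow, intervalIntegral.integral_zero, add_zero, zero_mul] at this
  rw [← sub_eq_zero, ← norm_eq_zero]
  exact pow_eq_zero_iff two_ne_zero |>.1 (le_antisymm this (sq_nonneg _))

/-- The duality between a forward solution `y` and a backward solution, given as the time
reversal of the forward solution `z` for the reversed potential. The product rule holds for the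
regularizations `R y` and `R z`, which are primitives in `H`; the terms with the operator `A`
cancel before the passage to the limit. -/
theorem IsWeakSol.duality (hG : IsClosed (G : Set (H × H)))
    (hd : Dense (Prod.fst '' (G : Set (H × H)))) (hT : 0 ≤ T) (hB : IsPotential B b T)
    {F K : ℝ → H} {y p z r : ℝ → H} (hF : MemLp F 2 (volume.restrict (Ioo 0 T)))
    (hK : MemLp (fun τ => K (T - τ)) 2 (volume.restrict (Ioo 0 T)))
    (h : IsWeakSol G B T F 0 y p)
    (h' : IsWeakSol G (fun τ => B (T - τ)) T (fun τ => K (T - τ)) 0 z r) :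
    ∫ τ in (0 : ℝ)..T, inner ℝ (F τ) (z (T - τ))
      = ∫ τ in (0 : ℝ)..T, (inner ℝ (y τ) (K τ) : ℝ) := by
  have hyL := memLp_of_continuousOn_Icc h.cont
  have hzL := memLp_of_continuousOn_Icc h'.cont
  have hBy := hB.memLp hyL
  have hBz := hB.reverse.memLp hzL
  have hb := hB.nonneg
  have hε : ∀ n : ℕ, (0 : ℝ) < 1 / ((n : ℝ) + 1) := fun n => by positivity
  have Q : ∀ n : ℕ, Resolvent G (1 / ((n : ℝ) + 1)) := fun n =>
    (Resolvent.nonempty hG (hε n)).some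
  have hQ := tendsto_resolvent hd hε tendsto_one_div_add_atTop_nhds_zero_nat Q
  have hmaps : ∀ τ ∈ Icc 0 T, T - τ ∈ Icc 0 T := fun τ hτ => ⟨by linarith [hτ.2], by linarith [hτ.1]⟩
  have hzc : ContinuousOn (fun τ => z (T - τ)) (Icc 0 T) :=
    h'.cont.comp (by fun_prop) hmaps
  have hKi : MemLp K 2 (volume.restrict (Ioo 0 T)) := by
    simpa [Function.comp_def] using hK.comp_measurePreserving (measurePreserving_reverse T)
  have hBz' := hB.memLp (memLp_of_continuousOn_Icc hzc)
  -- the regularized identity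
  have reg : ∀ n, ∫ τ in (0 : ℝ)..T, (inner ℝ ((Q n).R (F τ - B τ (y τ))) ((Q n).R (z (T - τ)))
      - inner ℝ ((Q n).R (y τ)) ((Q n).R (K τ - B τ (z (T - τ))))) = (0 : ℝ) := by
    intro n
    set g := fun τ => (Q n).R (F τ - B τ (y τ)) - (Q n).A (y τ) with hg
    set k := fun τ => (Q n).R (K (T - τ) - B (T - τ) (z τ)) - (Q n).A (z τ) with hk
    have gi : IntervalIntegrable g volume 0 T := intervalIntegrable_of_memLp hT
      (((Q n).R.comp_memLp' (hF.sub hBy)).sub ((Q n).A.comp_memLp' hyL))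
    have ki : IntervalIntegrable k volume 0 T := intervalIntegrable_of_memLp hT
      (((Q n).R.comp_memLp' (hK.sub hBz)).sub ((Q n).A.comp_memLp' hzL))
    have ki' : IntervalIntegrable (fun τ => -k (T - τ)) volume 0 T := by
      have := ki.comp_sub_left T
      simp only [sub_zero, sub_self] at this
      exact this.symm.neg
    have hx : ∀ t ∈ Icc 0 T, (Q n).R (y t) = 0 + ∫ τ in (0 : ℝ)..t, g τ := by
      intro t ht
      have := h.resolvent_eq hB hF (hε n) (Q n) ht
      rwa [map_zero] at this
    have hz : ∀ t ∈ Icc 0 T, (Q n).R (z t) = ∫ τ in (0 : ℝ)..t, k τ := by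
      intro t ht
      have := h'.resolvent_eq hB.reverse hK (hε n) (Q n) ht
      rwa [map_zero, zero_add] at this
    have hz' : ∀ t ∈ Icc 0 T, (Q n).R (z (T - t))
        = (Q n).R (z T) + ∫ τ in (0 : ℝ)..t, -k (T - τ) := by
      intro t ht
      have ht' := hmaps t ht
      rw [hz _ ht', hz T ⟨hT, le_rfl⟩, intervalIntegral.integral_neg,
        intervalIntegral.integral_comp_sub_left k T, sub_zero, ← sub_eq_add_neg,
        ← intervalIntegral.integral_interval_sub_left ki (ki.mono_set (uIcc_zero_subset ht'))]
      abel
    have e := inner_primitive_sub (x := fun t => (Q n).R (y t))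
      (z := fun t => (Q n).R (z (T - t))) hT gi ki' hx hz'
    simp only [sub_self, h'.init, map_zero, inner_zero_left, inner_zero_right] at e
    refine Eq.trans ?_ e.symm
    refine intervalIntegral.integral_congr fun τ _ => ?_
    simp only [hg, hk, sub_sub_cancel]
    rw [inner_sub_left, inner_neg_right, inner_sub_right, (Q n).inner_A_R (hε n),
      real_inner_comm _ ((Q n).R (y τ)), real_inner_comm ((Q n).A (z (T - τ))) ((Q n).R (y τ)),
      (Q n).inner_A_R (hε n), real_inner_comm ((Q n).W (y τ))]
    ring
  -- the limit of the regularized identity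
  obtain ⟨C, hC⟩ := isCompact_Icc.exists_bound_of_continuousOn h.cont
  obtain ⟨D, hD⟩ := isCompact_Icc.exists_bound_of_continuousOn hzc
  have lim : Tendsto (fun n => ∫ τ in (0 : ℝ)..T,
      (inner ℝ ((Q n).R (F τ - B τ (y τ))) ((Q n).R (z (T - τ)))
      - inner ℝ ((Q n).R (y τ)) ((Q n).R (K τ - B τ (z (T - τ)))))) atTop
      (𝓝 (∫ τ in (0 : ℝ)..T, ((inner ℝ (F τ - B τ (y τ)) (z (T - τ)) : ℝ)
      - inner ℝ (y τ) (K τ - B τ (z (T - τ)))))) := by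
    refine intervalIntegral.tendsto_integral_filter_of_dominated_convergence
      (fun τ => ‖F τ - B τ (y τ)‖ * D + C * ‖K τ - B τ (z (T - τ))‖) ?_ ?_ ?_ ?_
    · refine Eventually.of_forall fun n => ?_
      rw [uIoc_of_le hT, ← restrict_Ioo_eq_restrict_Ioc]
      have a1 := ((Q n).R.comp_memLp' (hF.sub hBy)).1
      have a2 := ((Q n).R.comp_memLp' (hKi.sub hBz')).1
      have a3 := ((Q n).R.comp_memLp' (memLp_of_continuousOn_Icc hzc)).1
      have a4 := ((Q n).R.comp_memLp' hyL).1
      exact (a1.inner a3).sub (a4.inner a2)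
    · refine Eventually.of_forall fun n => Eventually.of_forall fun τ hτ => ?_
      rw [uIoc_of_le hT] at hτ
      have hτ' : τ ∈ Icc 0 T := ⟨hτ.1.le, hτ.2⟩
      refine (norm_sub_le _ _).trans (add_le_add ?_ ?_)
      · refine (norm_inner_le_norm _ _).trans (mul_le_mul ((Q n).norm_R_le _)
          (((Q n).norm_R_le _).trans (hD τ hτ')) (norm_nonneg _) (norm_nonneg _))
      · refine (norm_inner_le_norm _ _).trans (mul_le_mul (((Q n).norm_R_le _).trans (hC τ hτ'))
          ((Q n).norm_R_le _) (norm_nonneg _) ((norm_nonneg _).trans (hC τ hτ')))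
    · exact ((intervalIntegrable_of_memLp hT (hF.sub hBy)).norm.mul_const D).add
        ((intervalIntegrable_of_memLp hT (hKi.sub hBz')).norm.const_mul C)
    · exact Eventually.of_forall fun τ _ => ((hQ _).inner (hQ _)).sub ((hQ _).inner (hQ _))
  simp_rw [reg] at lim
  have fin := tendsto_nhds_unique lim tendsto_const_nhds
  have e : ∀ τ, (inner ℝ (F τ - B τ (y τ)) (z (T - τ)) : ℝ)
      - inner ℝ (y τ) (K τ - B τ (z (T - τ)))
      = inner ℝ (F τ) (z (T - τ)) - inner ℝ (K τ) (y τ) := by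
    intro τ
    rw [inner_sub_left, inner_sub_right, hB.symm, real_inner_comm (K τ) (y τ)]
    ring
  simp_rw [e] at fin
  rw [intervalIntegral.integral_sub (intervalIntegrable_inner hT
    (intervalIntegrable_of_memLp hT hF) hzc) (intervalIntegrable_inner hT
    (intervalIntegrable_of_memLp hT hKi) h.cont), sub_eq_zero] at fin
  rw [fin]
  exact intervalIntegral.integral_congr fun τ _ => real_inner_comm _ _

end

end StackelbergNash

namespace StackelbergNash

/-! ### Existence of weak solutions by Yosida approximation -/

section

variable {H : Type*} [NormedAddCommGroup H] [InnerProductSpace ℝ H] {G : Submodule ℝ (H × H)}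

/-- Solutions of `y' + A_ε y + B y = F`, `y(0) = y₀`, where `A_ε` is the Yosida approximation
of `D* D`. -/
structure IsYosidaSol {ε : ℝ} (Q : Resolvent G ε) (B : ℝ → H →L[ℝ] H) (T : ℝ) (F : ℝ → H) (y₀ : H)
    (y : ℝ → H) : Prop where
  cont : Continuous y
  eq : ∀ t ∈ Icc 0 T, y t = y₀ + ∫ τ in (0 : ℝ)..t, (F τ - B τ (y τ) - Q.A (y τ))

variable [CompleteSpace H] [SecondCountableTopology H]
  {B : ℝ → H →L[ℝ] H} {b T : ℝ} {F : ℝ → H} {y₀ : H} {y : ℝ → H} {ε : ℝ} {Q : Resolvent G ε}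

theorem exists_isYosidaSol (hT : 0 < T) (hB : IsPotential B b T)
    (hF : MemLp F 2 (volume.restrict (Ioo 0 T))) (Q : Resolvent G ε) (y₀ : H) :
    ∃ y, IsYosidaSol Q B T F y₀ y := by
  obtain ⟨y, hy, h⟩ := exists_volterra hT (L := fun τ => -(B τ) - Q.A) (ℓ := b + ‖Q.A‖)
    (fun τ => (norm_sub_le _ _).trans (by rw [norm_neg]; exact add_le_add_left (hB.norm_le τ) _))
    (fun y hy => by
      have h1 := hB.aestronglyMeasurable (y := y) hy.aestronglyMeasurable
      have h2 : AEStronglyMeasurable (fun τ => Q.A (y τ)) (volume.restrict (Ioo 0 T)) :=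
        (Q.A.continuous.comp hy).aestronglyMeasurable
      exact h1.neg.sub h2)
    (intervalIntegrable_of_memLp hT.le hF) y₀
  refine ⟨y, hy, fun t ht => ?_⟩
  rw [h t ht]
  congr 1
  refine intervalIntegral.integral_congr fun τ _ => ?_
  simp only [sub_apply, neg_apply]
  abel

namespace IsYosidaSol

omit [CompleteSpace H] [SecondCountableTopology H] in
theorem memLp (h : IsYosidaSol Q B T F y₀ y) : MemLp y 2 (volume.restrict (Ioo 0 T)) :=
  memLp_of_continuousOn_Icc h.cont.continuousOn

theorem integrable (hT : 0 ≤ T) (hB : IsPotential B b T)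
    (hF : MemLp F 2 (volume.restrict (Ioo 0 T))) (h : IsYosidaSol Q B T F y₀ y) :
    IntervalIntegrable (fun τ => F τ - B τ (y τ) - Q.A (y τ)) volume 0 T :=
  intervalIntegrable_of_memLp hT ((hF.sub (hB.memLp h.memLp)).sub (Q.A.comp_memLp' h.memLp))

theorem sub (hT : 0 ≤ T) (hB : IsPotential B b T) {F' : ℝ → H} {y₀' : H} {y' : ℝ → H}
    (hF : MemLp F 2 (volume.restrict (Ioo 0 T))) (hF' : MemLp F' 2 (volume.restrict (Ioo 0 T)))
    (h : IsYosidaSol Q B T F y₀ y) (h' : IsYosidaSol Q B T F' y₀' y') :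
    IsYosidaSol Q B T (fun τ => F τ - F' τ) (y₀ - y₀') (fun τ => y τ - y' τ) := by
  refine ⟨h.cont.sub h'.cont, fun t ht => ?_⟩
  rw [h.eq t ht, h'.eq t ht, add_sub_add_comm, ← intervalIntegral.integral_sub
    ((h.integrable hT hB hF).mono_set (uIcc_zero_subset ht))
    ((h'.integrable hT hB hF').mono_set (uIcc_zero_subset ht))]
  congr 1
  refine intervalIntegral.integral_congr fun τ _ => ?_
  simp only [map_sub]
  abel

/-- The energy estimate, uniform in the regularization parameter. -/
theorem energy_le (hT : 0 ≤ T) (hB : IsPotential B b T)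
    (hF : MemLp F 2 (volume.restrict (Ioo 0 T))) (hε : 0 < ε) (h : IsYosidaSol Q B T F y₀ y)
    {t : ℝ} (ht : t ∈ Icc 0 T) :
    ‖y t‖ ^ 2 + 2 * ∫ τ in (0 : ℝ)..t, ‖Q.W (y τ)‖ ^ 2
      ≤ (‖y₀‖ ^ 2 + ∫ τ in (0 : ℝ)..T, ‖F τ‖ ^ 2) * Real.exp ((1 + 2 * b) * T) := by
  have hb := hB.nonneg
  have hg := h.integrable hT hB hF
  have hFi := intervalIntegrable_norm_sq_of_memLp hT hF
  have hyi := intervalIntegrable_norm_sq_of_memLp hT h.memLp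
  have hWi := intervalIntegrable_norm_sq_of_memLp hT (Q.W.comp_memLp' h.memLp)
  simp only [Function.comp_apply] at hWi
  have hI : 0 ≤ ∫ τ in (0 : ℝ)..T, ‖F τ‖ ^ 2 :=
    intervalIntegral.integral_nonneg hT fun _ _ => sq_nonneg _
  refine gronwall_integral (u := fun t => ‖y t‖ ^ 2)
    (D := fun t => 2 * ∫ τ in (0 : ℝ)..t, ‖Q.W (y τ)‖ ^ 2) (add_nonneg (sq_nonneg _) hI)
    (by positivity) (h.cont.norm.pow 2).continuousOn (fun t ht => ?_) (fun t ht => ?_) t ht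
  · have := intervalIntegral.integral_nonneg (μ := volume) ht.1
      fun τ _ => sq_nonneg ‖Q.W (y τ)‖
    linarith
  · rw [norm_sq_primitive hg h.eq ht]
    have h2 : ∫ τ in (0 : ℝ)..t, 2 * inner ℝ (F τ - B τ (y τ) - Q.A (y τ)) (y τ)
        ≤ ∫ τ in (0 : ℝ)..t, (‖F τ‖ ^ 2 + (1 + 2 * b) * ‖y τ‖ ^ 2 - 2 * ‖Q.W (y τ)‖ ^ 2) := by
      refine intervalIntegral.integral_mono_on ht.1 ?_ ?_ fun τ _ => ?_
      · exact ((intervalIntegrable_inner hT hg h.cont.continuousOn).const_mul 2).mono_set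
          (uIcc_zero_subset ht)
      · exact ((hFi.add (hyi.const_mul _)).sub (hWi.const_mul 2)).mono_set (uIcc_zero_subset ht)
      · rw [inner_sub_left, inner_sub_left, Q.inner_A_self hε]
        have a1 := real_inner_le_norm (F τ) (y τ)
        have a2 := (abs_le.1 (abs_real_inner_le_norm (B τ (y τ)) (y τ))).1
        have a3 := mul_le_mul_of_nonneg_right (hB.apply_le τ (y τ)) (norm_nonneg (y τ))
        nlinarith [sq_nonneg (‖F τ‖ - ‖y τ‖), mul_nonneg (sq_nonneg ε) (sq_nonneg ‖Q.A (y τ)‖)]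
    have h3 : ∫ τ in (0 : ℝ)..t, (‖F τ‖ ^ 2 + (1 + 2 * b) * ‖y τ‖ ^ 2 - 2 * ‖Q.W (y τ)‖ ^ 2)
        = (∫ τ in (0 : ℝ)..t, ‖F τ‖ ^ 2) + (1 + 2 * b) * (∫ τ in (0 : ℝ)..t, ‖y τ‖ ^ 2)
          - 2 * ∫ τ in (0 : ℝ)..t, ‖Q.W (y τ)‖ ^ 2 := by
      rw [intervalIntegral.integral_sub
          ((hFi.add (hyi.const_mul _)).mono_set (uIcc_zero_subset ht))
          ((hWi.const_mul 2).mono_set (uIcc_zero_subset ht)),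
        intervalIntegral.integral_add (hFi.mono_set (uIcc_zero_subset ht))
          ((hyi.const_mul _).mono_set (uIcc_zero_subset ht)),
        intervalIntegral.integral_const_mul, intervalIntegral.integral_const_mul]
    have h4 := integral_le_integral_zero hFi (fun τ => sq_nonneg _) ht
    linarith

/-- The second energy estimate, for initial states in the domain of the gradient: it bounds the
path `A_ε y` in `L²(0,T)`, uniformly in `ε`. -/
theorem integral_A_sq_le (hT : 0 ≤ T) (hB : IsPotential B b T)
    (hF : MemLp F 2 (volume.restrict (Ioo 0 T))) (hε : 0 < ε) (h : IsYosidaSol Q B T F y₀ y)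
    {w₀ : H} (hw : (y₀, w₀) ∈ G) :
    ∫ τ in (0 : ℝ)..T, ‖Q.A (y τ)‖ ^ 2
      ≤ ‖w₀‖ ^ 2 + 2 * (∫ τ in (0 : ℝ)..T, ‖F τ‖ ^ 2) + 2 * b ^ 2 * T *
        ((‖y₀‖ ^ 2 + ∫ τ in (0 : ℝ)..T, ‖F τ‖ ^ 2) * Real.exp ((1 + 2 * b) * T)) := by
  have hb := hB.nonneg
  set g := fun τ => F τ - B τ (y τ) - Q.A (y τ) with hgdef
  have hg : IntervalIntegrable g volume 0 T := h.integrable hT hB hF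
  have hFi := intervalIntegrable_norm_sq_of_memLp hT hF
  have hAi := intervalIntegrable_norm_sq_of_memLp hT (Q.A.comp_memLp' h.memLp)
  simp only [Function.comp_apply] at hAi
  set E := (‖y₀‖ ^ 2 + ∫ τ in (0 : ℝ)..T, ‖F τ‖ ^ 2) * Real.exp ((1 + 2 * b) * T) with hE
  have hyE : ∀ t ∈ Icc 0 T, ‖y t‖ ^ 2 ≤ E := by
    intro t ht
    have h1 := h.energy_le hT hB hF hε ht
    have h2 := intervalIntegral.integral_nonneg (μ := volume) ht.1
      fun τ _ => sq_nonneg ‖Q.W (y τ)‖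
    linarith
  have hAg : IntervalIntegrable (fun τ => Q.A (g τ)) volume 0 T := by
    rw [intervalIntegrable_iff_integrableOn_Ioo_of_le hT] at hg ⊢
    exact Q.A.integrable_comp hg
  have hAy : ∀ t ∈ Icc 0 T, Q.A (y t) = Q.A y₀ + ∫ τ in (0 : ℝ)..t, Q.A (g τ) := by
    intro t ht
    rw [h.eq t ht, map_add, Q.A.intervalIntegral_comp_comm (hg.mono_set (uIcc_zero_subset ht))]
  have e := inner_primitive_sub hT hg hAg h.eq hAy
  have e1 : ∫ τ in (0 : ℝ)..T, (inner ℝ (g τ) (Q.A (y τ)) + inner ℝ (y τ) (Q.A (g τ)))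
      ≤ ∫ τ in (0 : ℝ)..T, (2 * ‖F τ‖ ^ 2 + 2 * b ^ 2 * E - ‖Q.A (y τ)‖ ^ 2) := by
    refine intervalIntegral.integral_mono_on hT ?_ ?_ fun τ hτ => ?_
    · refine (intervalIntegrable_inner hT hg (Q.A.continuous.comp h.cont).continuousOn).add ?_
      have := intervalIntegrable_inner hT hAg h.cont.continuousOn
      simp_rw [real_inner_comm (Q.A _) (y _)]
      exact this
    · exact ((hFi.const_mul 2).add intervalIntegrable_const).sub hAi
    · rw [← Q.A_symm (y τ) (g τ), real_inner_comm (g τ) (Q.A (y τ)), ← two_mul, hgdef]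
      simp only
      rw [inner_sub_left, real_inner_self_eq_norm_sq]
      have a1 := real_inner_le_norm (F τ - B τ (y τ)) (Q.A (y τ))
      have a2 := (norm_sub_le (F τ) (B τ (y τ))).trans
        (add_le_add_right (hB.apply_le τ (y τ)) _)
      have a3 := hyE τ hτ
      have a4 : ‖F τ - B τ (y τ)‖ ^ 2 ≤ 2 * ‖F τ‖ ^ 2 + 2 * b ^ 2 * E := by
        have c1 : ‖F τ - B τ (y τ)‖ ^ 2 ≤ (‖F τ‖ + b * ‖y τ‖) ^ 2 := by gcongr
        have c2 := mul_le_mul_of_nonneg_left a3 (sq_nonneg b)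
        nlinarith [sq_nonneg (‖F τ‖ - b * ‖y τ‖)]
      nlinarith [sq_nonneg (‖F τ - B τ (y τ)‖ - ‖Q.A (y τ)‖)]
  rw [intervalIntegral.integral_sub ((hFi.const_mul 2).add intervalIntegrable_const) hAi,
    intervalIntegral.integral_add (hFi.const_mul 2) intervalIntegrable_const,
    intervalIntegral.integral_const_mul, intervalIntegral.integral_const, smul_eq_mul,
    sub_zero] at e1
  have e2 := Q.inner_A_self_le hε hw
  have e3 := Q.inner_A_self hε (y T)
  rw [real_inner_comm] at e2 e3
  nlinarith [sq_nonneg ‖Q.W (y T)‖, mul_nonneg (sq_nonneg ε) (sq_nonneg ‖Q.A (y T)‖)]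

/-- The difference of two Yosida approximations with the same data. -/
theorem dist_le (hT : 0 ≤ T) (hB : IsPotential B b T)
    (hF : MemLp F 2 (volume.restrict (Ioo 0 T))) (hε : 0 < ε) (h : IsYosidaSol Q B T F y₀ y)
    {δ : ℝ} (hδ : 0 < δ) {Q' : Resolvent G δ} {y' : ℝ → H} (h' : IsYosidaSol Q' B T F y₀ y')
    {κ : ℝ} (hκ : ∫ τ in (0 : ℝ)..T, ‖Q.A (y τ)‖ ^ 2 ≤ κ)
    (hκ' : ∫ τ in (0 : ℝ)..T, ‖Q'.A (y' τ)‖ ^ 2 ≤ κ) {t : ℝ} (ht : t ∈ Icc 0 T) :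
    ‖y t - y' t‖ ^ 2 + 2 * ∫ τ in (0 : ℝ)..t, ‖Q.W (y τ) - Q'.W (y' τ)‖ ^ 2
      ≤ 2 * (ε ^ 2 + δ ^ 2) * (κ + κ) * Real.exp (2 * b * T) := by
  have hb := hB.nonneg
  have hg := h.integrable hT hB hF
  have hg' := h'.integrable hT hB hF
  have hzi := intervalIntegrable_norm_sq_of_memLp hT (h.memLp.sub h'.memLp)
  have hWi := intervalIntegrable_norm_sq_of_memLp hT
    ((Q.W.comp_memLp' h.memLp).sub (Q'.W.comp_memLp' h'.memLp))
  have hAi := intervalIntegrable_norm_sq_of_memLp hT (Q.A.comp_memLp' h.memLp)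
  have hAi' := intervalIntegrable_norm_sq_of_memLp hT (Q'.A.comp_memLp' h'.memLp)
  simp only [Pi.sub_apply, Function.comp_apply] at hzi hWi hAi hAi'
  have hκ0 : 0 ≤ κ := (intervalIntegral.integral_nonneg hT fun _ _ => sq_nonneg _).trans hκ
  have hz : ∀ t ∈ Icc 0 T, y t - y' t = 0 + ∫ τ in (0 : ℝ)..t,
      ((F τ - B τ (y τ) - Q.A (y τ)) - (F τ - B τ (y' τ) - Q'.A (y' τ))) := by
    intro t ht
    rw [h.eq t ht, h'.eq t ht, add_sub_add_left_eq_sub, zero_add, intervalIntegral.integral_sub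
      (hg.mono_set (uIcc_zero_subset ht)) (hg'.mono_set (uIcc_zero_subset ht))]
  refine gronwall_integral (u := fun t => ‖y t - y' t‖ ^ 2)
    (D := fun t => 2 * ∫ τ in (0 : ℝ)..t, ‖Q.W (y τ) - Q'.W (y' τ)‖ ^ 2) (by positivity)
    (by positivity) ((h.cont.sub h'.cont).norm.pow 2).continuousOn (fun t ht => ?_)
    (fun t ht => ?_) t ht
  · have := intervalIntegral.integral_nonneg (μ := volume) ht.1
      fun τ _ => sq_nonneg ‖Q.W (y τ) - Q'.W (y' τ)‖
    linarith
  · rw [norm_sq_primitive (x := fun t => y t - y' t) (hg.sub hg') hz ht]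
    have m := fun {u : ℝ → ℝ} (hu : IntervalIntegrable u volume 0 T) =>
      hu.mono_set (uIcc_zero_subset ht)
    have h2 : ∫ τ in (0 : ℝ)..t, 2 * inner ℝ ((F τ - B τ (y τ) - Q.A (y τ))
          - (F τ - B τ (y' τ) - Q'.A (y' τ))) (y τ - y' τ)
        ≤ ∫ τ in (0 : ℝ)..t, (2 * b * ‖y τ - y' τ‖ ^ 2
          - 2 * ‖Q.W (y τ) - Q'.W (y' τ)‖ ^ 2
          + 2 * (ε ^ 2 + δ ^ 2) * (‖Q.A (y τ)‖ ^ 2 + ‖Q'.A (y' τ)‖ ^ 2)) := by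
      refine intervalIntegral.integral_mono_on ht.1 ?_ ?_ fun τ _ => ?_
      · exact m ((intervalIntegrable_inner hT (hg.sub hg')
          (h.cont.sub h'.cont).continuousOn).const_mul 2)
      · exact m (((hzi.const_mul _).sub (hWi.const_mul 2)).add ((hAi.add hAi').const_mul _))
      · have a0 : (F τ - B τ (y τ) - Q.A (y τ)) - (F τ - B τ (y' τ) - Q'.A (y' τ))
            = -(B τ (y τ - y' τ)) - (Q.A (y τ) - Q'.A (y' τ)) := by
          rw [map_sub]; abel
        rw [a0, inner_sub_left, inner_neg_left]
        have a1 := Q.inner_A_sub hε hδ Q' (y τ) (y' τ)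
        have a2 := (abs_le.1 (abs_real_inner_le_norm (B τ (y τ - y' τ)) (y τ - y' τ))).1
        have a3 := mul_le_mul_of_nonneg_right (hB.apply_le τ (y τ - y' τ))
          (norm_nonneg (y τ - y' τ))
        nlinarith
    rw [intervalIntegral.integral_add (m ((hzi.const_mul _).sub (hWi.const_mul 2)))
        (m ((hAi.add hAi').const_mul _)),
      intervalIntegral.integral_sub (m (hzi.const_mul _)) (m (hWi.const_mul 2)),
      intervalIntegral.integral_const_mul, intervalIntegral.integral_const_mul,
      intervalIntegral.integral_const_mul, intervalIntegral.integral_const_mul,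
      intervalIntegral.integral_add (m hAi) (m hAi')] at h2
    have h4 := (integral_le_integral_zero hAi (fun τ => sq_nonneg _) ht).trans hκ
    have h5 := (integral_le_integral_zero hAi' (fun τ => sq_nonneg _) ht).trans hκ'
    have h6 := mul_le_mul_of_nonneg_left (add_le_add h4 h5)
      (show 0 ≤ 2 * (ε ^ 2 + δ ^ 2) by positivity)
    rw [norm_zero, intervalIntegral.integral_const_mul]
    linarith

end IsYosidaSol

end

theorem norm_toLp_sq {E : Type*} [NormedAddCommGroup E] [InnerProductSpace ℝ E] {α : Type*}
    [MeasurableSpace α] {m : Measure α} {F : α → E} (hF : MemLp F 2 m) :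
    ‖hF.toLp‖ ^ 2 = ∫ x, ‖F x‖ ^ 2 ∂m := by
  rw [← real_inner_self_eq_norm_sq, L2.inner_def]
  refine integral_congr_ae ?_
  filter_upwards [hF.coeFn_toLp] with x hx
  rw [hx, real_inner_self_eq_norm_sq]

section

variable {H : Type*} [NormedAddCommGroup H] [InnerProductSpace ℝ H] {G : Submodule ℝ (H × H)}
  [CompleteSpace H] [SecondCountableTopology H] {B : ℝ → H →L[ℝ] H} {b T : ℝ} {F : ℝ → H}

/-- The Yosida approximations converge uniformly, and so do their gradients in `L²`. The initial
state is approximated by elements of the domain of the gradient. -/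
theorem yosida_cauchy (hd : Dense (Prod.fst '' (G : Set (H × H)))) (hT : 0 < T)
    (hB : IsPotential B b T) (hF : MemLp F 2 (volume.restrict (Ioo 0 T))) {y₀ : H} {ε : ℕ → ℝ}
    (hε : ∀ n, 0 < ε n) (hlim : Tendsto ε atTop (𝓝 0)) {Q : ∀ n, Resolvent G (ε n)}
    {y : ℕ → ℝ → H} (hy : ∀ n, IsYosidaSol (Q n) B T F y₀ (y n)) {r : ℝ} (hr : 0 < r) :
    ∃ N, ∀ n ≥ N, ∀ m ≥ N, ∀ t ∈ Icc 0 T, ‖y n t - y m t‖ ^ 2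
      + 2 * ∫ τ in (0 : ℝ)..t, ‖(Q n).W (y n τ) - (Q m).W (y m τ)‖ ^ 2 ≤ r := by
  set X := Real.exp ((1 + 2 * b) * T) with hX
  have hXpos : 0 < X := Real.exp_pos _
  obtain ⟨_, ⟨⟨k, w⟩, hkw, rfl⟩, hk⟩ := hd.exists_dist_lt y₀
    (show 0 < √(r / (12 * X)) by positivity)
  simp only at hk
  have hkX : 3 * (‖y₀ - k‖ ^ 2 * X) ≤ r / 4 := by
    rw [dist_eq_norm] at hk
    have : ‖y₀ - k‖ ^ 2 ≤ r / (12 * X) := by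
      rw [← Real.sq_sqrt (show 0 ≤ r / (12 * X) by positivity)]
      gcongr
    rw [le_div_iff₀ (by positivity)] at this
    linarith
  choose z hz using fun n => exists_isYosidaSol hT hB hF (Q n) k
  set κ := ‖w‖ ^ 2 + 2 * (∫ τ in (0 : ℝ)..T, ‖F τ‖ ^ 2) + 2 * b ^ 2 * T *
        ((‖k‖ ^ 2 + ∫ τ in (0 : ℝ)..T, ‖F τ‖ ^ 2) * X)
  have hκ : ∀ n, ∫ τ in (0 : ℝ)..T, ‖(Q n).A (z n τ)‖ ^ 2 ≤ κ := fun n =>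
    (hz n).integral_A_sq_le hT.le hB hF (hε n) hkw
  have hlim2 : Tendsto (fun n => 3 * (2 * ε n ^ 2 * (κ + κ) * Real.exp (2 * b * T))) atTop
      (𝓝 0) := by
    have := ((((hlim.pow 2).const_mul 2).mul_const (κ + κ)).mul_const
      (Real.exp (2 * b * T))).const_mul 3
    simpa using this
  obtain ⟨N, hN⟩ := eventually_atTop.1
    (hlim2.eventually (gt_mem_nhds (show 0 < r / 4 by positivity)))
  have hdiff : ∀ n, ∀ t ∈ Icc 0 T, ‖y n t - z n t‖ ^ 2
      + 2 * ∫ τ in (0 : ℝ)..t, ‖(Q n).W (y n τ - z n τ)‖ ^ 2 ≤ ‖y₀ - k‖ ^ 2 * X := by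
    intro n t ht
    have := ((hy n).sub hT.le hB hF hF (hz n)).energy_le hT.le hB (hF.sub hF) (hε n) ht
    simpa using this
  refine ⟨N, fun n hn m hm t ht => ?_⟩
  have h1 := hdiff n t ht
  have h2 := hdiff m t ht
  have h3 := (hz n).dist_le hT.le hB hF (hε n) (hε m) (hz m) (hκ n) (hκ m) ht
  have h4 := hN n hn
  have h5 := hN m hm
  have tri : ∀ u v a c : H, ‖u - v‖ ^ 2 ≤ 3 * (‖u - a‖ ^ 2 + ‖a - c‖ ^ 2 + ‖v - c‖ ^ 2) := by
    intro u v a c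
    have e : u - v = (u - a) + (a - c) + -(v - c) := by abel
    have := (norm_add₃_le (a := u - a) (b := a - c) (c := -(v - c)))
    rw [← e, norm_neg] at this
    have : ‖u - v‖ ^ 2 ≤ (‖u - a‖ + ‖a - c‖ + ‖v - c‖) ^ 2 := by gcongr
    nlinarith [sq_nonneg (‖u - a‖ - ‖a - c‖), sq_nonneg (‖u - a‖ - ‖v - c‖),
      sq_nonneg (‖a - c‖ - ‖v - c‖)]
  have hi : ∀ n (u : ℝ → H), Continuous u →
      MemLp (fun τ => (Q n).W (u τ)) 2 (volume.restrict (Ioo 0 T)) := fun n u hu =>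
    (Q n).W.comp_memLp' (memLp_of_continuousOn_Icc hu.continuousOn)
  have hj : ∀ {u : ℝ → H}, MemLp u 2 (volume.restrict (Ioo 0 T)) →
      IntervalIntegrable (fun τ => ‖u τ‖ ^ 2) volume 0 t := fun hu =>
    (intervalIntegrable_norm_sq_of_memLp hT.le hu).mono_set (uIcc_zero_subset ht)
  have j1 : IntervalIntegrable (fun τ => ‖(Q n).W (y n τ - z n τ)‖ ^ 2) volume 0 t :=
    hj (hi n _ ((hy n).cont.sub (hz n).cont))
  have j2 : IntervalIntegrable (fun τ => ‖(Q m).W (y m τ - z m τ)‖ ^ 2) volume 0 t :=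
    hj (hi m _ ((hy m).cont.sub (hz m).cont))
  have j3 : IntervalIntegrable (fun τ => ‖(Q n).W (z n τ) - (Q m).W (z m τ)‖ ^ 2) volume 0 t :=
    hj ((hi n _ (hz n).cont).sub (hi m _ (hz m).cont))
  have j4 : IntervalIntegrable (fun τ => ‖(Q n).W (y n τ) - (Q m).W (y m τ)‖ ^ 2) volume 0 t :=
    hj ((hi n _ (hy n).cont).sub (hi m _ (hy m).cont))
  have h6 : ∫ τ in (0 : ℝ)..t, ‖(Q n).W (y n τ) - (Q m).W (y m τ)‖ ^ 2
      ≤ ∫ τ in (0 : ℝ)..t, 3 * (‖(Q n).W (y n τ - z n τ)‖ ^ 2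
        + ‖(Q n).W (z n τ) - (Q m).W (z m τ)‖ ^ 2 + ‖(Q m).W (y m τ - z m τ)‖ ^ 2) := by
    refine intervalIntegral.integral_mono_on ht.1 j4 (((j1.add j3).add j2).const_mul 3)
      fun τ _ => ?_
    have := tri ((Q n).W (y n τ)) ((Q m).W (y m τ)) ((Q n).W (z n τ)) ((Q m).W (z m τ))
    rwa [← map_sub, ← map_sub] at this
  rw [intervalIntegral.integral_const_mul, intervalIntegral.integral_add (j1.add j3) j2,
    intervalIntegral.integral_add j1 j3] at h6
  have h7 := tri (y n t) (y m t) (z n t) (z m t)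
  nlinarith

/-- Weak solutions exist: the Yosida approximations converge, and the limit of their gradients is
the gradient of the limit because `G` is closed. -/
theorem exists_isWeakSol (hG : IsClosed (G : Set (H × H)))
    (hd : Dense (Prod.fst '' (G : Set (H × H)))) (hT : 0 < T) (hB : IsPotential B b T)
    (hF : MemLp F 2 (volume.restrict (Ioo 0 T))) (y₀ : H) :
    ∃ y p, IsWeakSol G B T F y₀ y p := by
  have hε : ∀ n : ℕ, (0 : ℝ) < 1 / ((n : ℝ) + 1) := fun n => by positivity
  have hlim := tendsto_one_div_add_atTop_nhds_zero_nat (𝕜 := ℝ)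
  have Q : ∀ n : ℕ, Resolvent G (1 / ((n : ℝ) + 1)) := fun n =>
    (Resolvent.nonempty hG (hε n)).some
  have hQ := tendsto_resolvent hd hε hlim Q
  choose Y hY using fun n => exists_isYosidaSol hT hB hF (Q n) y₀
  have hcauchy := fun r (hr : 0 < r) => yosida_cauchy hd hT hB hF hε hlim hY hr
  -- the limit of the states
  have hU : UniformCauchySeqOn Y atTop (Icc 0 T) := by
    rw [Metric.uniformCauchySeqOn_iff]
    intro r hr
    obtain ⟨N, hN⟩ := hcauchy (r ^ 2 / 2) (by positivity)
    refine ⟨N, fun n hn m hm t ht => ?_⟩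
    have h1 := hN n hn m hm t ht
    have h2 := intervalIntegral.integral_nonneg (μ := volume) ht.1
      fun τ _ => sq_nonneg ‖(Q n).W (Y n τ) - (Q m).W (Y m τ)‖
    rw [dist_eq_norm]
    refine lt_of_pow_lt_pow_left₀ 2 hr.le ?_
    nlinarith
  have hpt : ∀ t ∈ Icc 0 T, ∃ z, Tendsto (fun n => Y n t) atTop (𝓝 z) := fun t ht =>
    cauchySeq_tendsto_of_complete (hU.cauchySeq ht)
  choose! y hy using hpt
  have hunif := hU.tendstoUniformlyOn_of_tendsto hy
  have hyc : ContinuousOn y (Icc 0 T) :=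
    hunif.continuousOn (Frequently.of_forall fun n => (hY n).cont.continuousOn)
  -- the limit of the gradients
  have hWm : ∀ n, MemLp (fun τ => (Q n).W (Y n τ)) 2 (volume.restrict (Ioo 0 T)) := fun n =>
    (Q n).W.comp_memLp' (hY n).memLp
  have hPc : CauchySeq fun n => (hWm n).toLp := by
    rw [Metric.cauchySeq_iff]
    intro r hr
    obtain ⟨N, hN⟩ := hcauchy (r ^ 2 / 2) (by positivity)
    refine ⟨N, fun n hn m hm => ?_⟩
    have h1 := hN n hn m hm T ⟨hT.le, le_rfl⟩
    rw [dist_eq_norm, ← MemLp.toLp_sub]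
    refine lt_of_pow_lt_pow_left₀ 2 hr.le ?_
    rw [norm_toLp_sq]
    rw [intervalIntegral.integral_of_le hT.le, ← restrict_Ioo_eq_restrict_Ioc] at h1
    simp only [Pi.sub_apply]
    nlinarith [sq_nonneg ‖Y n T - Y m T‖]
  obtain ⟨p, hp⟩ := cauchySeq_tendsto_of_complete hPc
  refine ⟨y, p, hyc, ?_, Lp.memLp p, ?_, ?_⟩
  · refine tendsto_nhds_unique (hy 0 ⟨le_rfl, hT.le⟩) ?_
    have : ∀ n, Y n 0 = y₀ := fun n => by
      rw [(hY n).eq 0 ⟨le_rfl, hT.le⟩]; simp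
    simp_rw [this]
    exact tendsto_const_nhds
  · obtain ⟨φ, hφ, hae⟩ := (tendstoInMeasure_of_tendsto_Lp hp).exists_seq_tendsto_ae
    have hcoe : ∀ᵐ τ ∂volume.restrict (Ioo 0 T), ∀ n,
        ((hWm n).toLp : ℝ → H) τ = (Q n).W (Y n τ) :=
      ae_all_iff.2 fun n => (hWm n).coeFn_toLp
    filter_upwards [hae, hcoe, ae_restrict_mem measurableSet_Ioo] with t h1 h2 h3
    have ht := Ioo_subset_Icc_self h3
    have hR : Tendsto (fun n => (Q n).R (Y n t)) atTop (𝓝 (y t)) := by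
      have a1 : Tendsto (fun n => (Q n).R (Y n t - y t)) atTop (𝓝 0) := by
        refine squeeze_zero_norm (fun n => (Q n).norm_R_le _) ?_
        have := ((hy t ht).sub_const (y t)).norm
        simpa using this
      have := a1.add (hQ (y t))
      simpa using this
    have hW : Tendsto (fun i => (Q (φ i)).W (Y (φ i) t)) atTop (𝓝 (p t)) := by
      simpa only [h2] using h1
    exact hG.mem_of_tendsto ((hR.comp hφ.tendsto_atTop).prodMk_nhds hW)
      (Eventually.of_forall fun i => (Q (φ i)).mem _)
  · intro q hq t ht
    have hy' := memLp_of_continuousOn_Icc hyc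
    have hi : ∀ {k : ℝ → H} (c : H), MemLp k 2 (volume.restrict (Ioo 0 T)) →
        IntervalIntegrable (fun τ => (inner ℝ (k τ) c : ℝ)) volume 0 t := fun c hk =>
      (intervalIntegrable_inner hT.le (intervalIntegrable_of_memLp hT.le hk)
        continuousOn_const).mono_set (uIcc_zero_subset ht)
    -- the approximate weak equation
    have happ : ∀ n, inner ℝ (Y n t) q.1 - inner ℝ y₀ q.1
        + ((∫ τ in (0 : ℝ)..t, inner ℝ ((Q n).W (Y n τ)) q.2)
          + ∫ τ in (0 : ℝ)..t, inner ℝ (B τ (Y n τ)) q.1)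
        = ∫ τ in (0 : ℝ)..t, (inner ℝ (F τ) q.1 : ℝ) := by
      intro n
      have e := (hY n).eq t ht
      have hg := ((hY n).integrable hT.le hB hF).mono_set (uIcc_zero_subset ht)
      have e2 := congrArg (fun u : H => (innerSL ℝ q.1) u) e
      simp only [map_add] at e2
      rw [← ContinuousLinearMap.intervalIntegral_comp_comm (innerSL ℝ q.1) hg] at e2
      simp only [innerSL_apply_apply] at e2
      have e3 : ∫ τ in (0 : ℝ)..t, inner ℝ q.1 (F τ - B τ (Y n τ) - (Q n).A (Y n τ))
          = ∫ τ in (0 : ℝ)..t, ((inner ℝ (F τ) q.1 : ℝ) - (inner ℝ ((Q n).W (Y n τ)) q.2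
            + inner ℝ (B τ (Y n τ)) q.1)) := by
        refine intervalIntegral.integral_congr fun τ _ => ?_
        rw [(Q n).inner_W (hε n) _ hq, inner_sub_right, inner_sub_right,
          real_inner_comm (F τ), real_inner_comm (B τ (Y n τ)), real_inner_comm ((Q n).A (Y n τ))]
        ring
      have i1 := hi q.1 hF
      have i2 := hi q.2 (hWm n)
      have i3 := hi q.1 (hB.memLp (hY n).memLp)
      rw [e3, intervalIntegral.integral_sub i1 (i2.add i3), intervalIntegral.integral_add i2 i3,
        real_inner_comm (Y n t), real_inner_comm y₀] at e2
      linarith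
    have l1 : Tendsto (fun n => (inner ℝ (Y n t) q.1 : ℝ)) atTop (𝓝 (inner ℝ (y t) q.1)) :=
      (hy t ht).inner tendsto_const_nhds
    have l2 : Tendsto (fun n => ∫ τ in (0 : ℝ)..t, (inner ℝ ((Q n).W (Y n τ)) q.2 : ℝ)) atTop
        (𝓝 (∫ τ in (0 : ℝ)..t, (inner ℝ (p τ) q.2 : ℝ))) := by
      have hs : MeasurableSet (Ioc 0 t) := measurableSet_Ioc
      have hμ : (volume.restrict (Ioo 0 T)) (Ioc 0 t) ≠ ∞ := measure_ne_top _ _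
      have key : ∀ {g : ℝ → H} (P : Lp H 2 (volume.restrict (Ioo 0 T))),
          (∀ᵐ τ ∂volume.restrict (Ioo 0 T), P τ = g τ) →
          ∫ τ in (0 : ℝ)..t, (inner ℝ (g τ) q.2 : ℝ)
            = inner ℝ (indicatorConstLp 2 hs hμ q.2) P := by
        intro g P hgP
        rw [L2.inner_indicatorConstLp_eq_setIntegral_inner ℝ P hs q.2 hμ,
          Measure.restrict_restrict hs, intervalIntegral.integral_of_le ht.1]
        have hae : (Ioc 0 t ∩ Ioo 0 T : Set ℝ) =ᵐ[volume] Ioc 0 t := by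
          rcases eq_or_lt_of_le ht.2 with h | h
          · subst h
            rw [inter_eq_right.2 Ioo_subset_Ioc_self]
            exact Ioo_ae_eq_Ioc
          · rw [inter_eq_left.2 (show Ioc 0 t ⊆ Ioo 0 T from fun τ hτ => ⟨hτ.1, hτ.2.trans_lt h⟩)]
            exact EventuallyEq.rfl
        rw [Measure.restrict_congr_set hae]
        refine integral_congr_ae ?_
        have hgP' : ∀ᵐ τ ∂volume.restrict (Ioc 0 t), P τ = g τ := by
          rw [← Measure.restrict_congr_set hae]
          exact ae_mono (Measure.restrict_mono inter_subset_right le_rfl) hgP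
        filter_upwards [hgP'] with τ hτ
        rw [hτ, real_inner_comm]
      rw [key p (Eventually.of_forall fun _ => rfl)]
      have := fun n => key (g := fun τ => (Q n).W (Y n τ)) ((hWm n).toLp) (hWm n).coeFn_toLp
      simp_rw [this]
      exact tendsto_const_nhds.inner hp
    have l3 : Tendsto (fun n => ∫ τ in (0 : ℝ)..t, (inner ℝ (B τ (Y n τ)) q.1 : ℝ)) atTop
        (𝓝 (∫ τ in (0 : ℝ)..t, (inner ℝ (B τ (y τ)) q.1 : ℝ))) := by
      set E := (‖y₀‖ ^ 2 + ∫ τ in (0 : ℝ)..T, ‖F τ‖ ^ 2) * Real.exp ((1 + 2 * b) * T)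
      refine intervalIntegral.tendsto_integral_filter_of_dominated_convergence
        (fun _ => b * √E * ‖q.1‖) ?_ ?_ intervalIntegrable_const ?_
      · refine Eventually.of_forall fun n => ?_
        have := hi q.1 (hB.memLp (hY n).memLp)
        rw [intervalIntegrable_iff] at this
        exact this.1
      · refine Eventually.of_forall fun n => Eventually.of_forall fun τ hτ => ?_
        rw [uIoc_of_le ht.1] at hτ
        have hτ' : τ ∈ Icc 0 T := ⟨hτ.1.le, hτ.2.trans ht.2⟩
        have h1 := (hY n).energy_le hT.le hB hF (hε n) hτ'
        have h2 := intervalIntegral.integral_nonneg (μ := volume) hτ'.1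
          fun τ _ => sq_nonneg ‖(Q n).W (Y n τ)‖
        have h3 : ‖Y n τ‖ ≤ √E := Real.le_sqrt_of_sq_le (by linarith)
        refine (norm_inner_le_norm _ _).trans ?_
        have h4 := hB.apply_le τ (Y n τ)
        have h5 := mul_le_mul_of_nonneg_left h3 hB.nonneg
        gcongr
        linarith
      · refine Eventually.of_forall fun τ hτ => ?_
        rw [uIoc_of_le ht.1] at hτ
        have hτ' : τ ∈ Icc 0 T := ⟨hτ.1.le, hτ.2.trans ht.2⟩
        exact (((B τ).continuous.tendsto _).comp (hy τ hτ')).inner tendsto_const_nhds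
    have hlimit := (l1.sub_const (inner ℝ y₀ q.1)).add (l2.add l3)
    simp_rw [happ] at hlimit
    have := tendsto_nhds_unique hlimit tendsto_const_nhds
    rw [intervalIntegral.integral_add (hi q.2 (Lp.memLp p)) (hi q.1 (hB.memLp hy'))]
    exact this

end

end StackelbergNash

namespace StackelbergNash

/-! ### The weighted space -/

/-- A function with `r b'(r) ≤ K b(r)` decays at `0` at most like `r ^ K`. -/
theorem rpow_le_of_growth {b b' : ℝ → ℝ} {ℓ K : ℝ} (hc : ContinuousOn b (Ioc 0 ℓ))
    (hd : ∀ r ∈ Ioo 0 ℓ, HasDerivAt b (b' r) r) (hg : ∀ r ∈ Ioo 0 ℓ, r * b' r ≤ K * b r)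
    {r : ℝ} (hr : r ∈ Ioc 0 ℓ) : b ℓ * ℓ ^ (-K) * r ^ K ≤ b r := by
  have hℓ : 0 < ℓ := hr.1.trans_le hr.2
  have hder : ∀ s ∈ Ioo 0 ℓ, HasDerivAt (fun s => b s * s ^ (-K))
      (b' s * s ^ (-K) + b s * (-K * s ^ (-K - 1))) s := fun s hs =>
    (hd s hs).mul (Real.hasDerivAt_rpow_const (Or.inl hs.1.ne'))
  have hanti : AntitoneOn (fun s => b s * s ^ (-K)) (Ioc 0 ℓ) := by
    refine antitoneOn_of_deriv_nonpos (convex_Ioc _ _) ?_ ?_ ?_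
    · exact hc.mul (continuousOn_id.rpow_const fun s hs => Or.inl hs.1.ne')
    · rw [interior_Ioc]
      exact fun s hs => (hder s hs).differentiableAt.differentiableWithinAt
    · rw [interior_Ioc]
      intro s hs
      rw [(hder s hs).deriv]
      have e : s ^ (-K) = s * s ^ (-K - 1) := by
        rw [Real.rpow_sub_one hs.1.ne']
        field_simp [hs.1.ne']
      rw [e]
      have h1 := hg s hs
      have h2 : 0 < s ^ (-K - 1) := Real.rpow_pos_of_pos hs.1 _
      have : b' s * (s * s ^ (-K - 1)) + b s * (-K * s ^ (-K - 1))
          = s ^ (-K - 1) * (s * b' s - K * b s) := by ring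
      rw [this]
      exact mul_nonpos_of_nonneg_of_nonpos h2.le (by linarith)
  have h1 := hanti hr ⟨hℓ, le_rfl⟩ hr.2
  simp only at h1
  have h2 : r ^ (-K) * r ^ K = 1 := by
    rw [← Real.rpow_add hr.1]; simp
  calc b ℓ * ℓ ^ (-K) * r ^ K ≤ b r * r ^ (-K) * r ^ K :=
        mul_le_mul_of_nonneg_right h1 (Real.rpow_nonneg hr.1.le _)
    _ = b r := by rw [mul_assoc, h2, mul_one]

namespace Data

variable (P : Data)

/-- The function `1/√a`. -/
noncomputable def invSqrt (x : ℝ) : ℝ := (√(P.a x))⁻¹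

/-- The kernel `k_x` with `z(x) = ⟪k_x, √a z'⟫` for `z ∈ H¹ₐ`: one integrates from the endpoint of
`[0,1]` that lies on the same side of `x₀` as `x`. -/
noncomputable def kern (x : ℝ) : ℝ → ℝ :=
  if x < P.x₀ then (Ioo 0 x).indicator P.invSqrt else -(Ioo x 1).indicator P.invSqrt

/-- The class of a function in `L²(0,1)`, and zero if it is not square integrable. -/
noncomputable def _root_.StackelbergNash.toL2 (f : ℝ → ℝ) : L2 :=
  open Classical in if h : MemLp f 2 (volume.restrict (Ioo (0 : ℝ) 1)) then h.toLp else 0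

theorem _root_.StackelbergNash.toL2_coeFn {f : ℝ → ℝ}
    (h : MemLp f 2 (volume.restrict (Ioo (0 : ℝ) 1))) :
    toL2 f =ᵐ[volume.restrict (Ioo 0 1)] f := by
  rw [toL2, dif_pos h]
  exact h.coeFn_toLp

theorem _root_.StackelbergNash.inner_eq_integral (f g : L2) :
    inner ℝ f g = ∫ x in Ioo (0 : ℝ) 1, f x * g x := by
  rw [L2.inner_def]
  refine integral_congr_ae (Eventually.of_forall fun x => ?_)
  simp [mul_comm]

theorem _root_.StackelbergNash.inner_toL2 {f : ℝ → ℝ}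
    (h : MemLp f 2 (volume.restrict (Ioo (0 : ℝ) 1))) (g : L2) :
    inner ℝ (toL2 f) g = ∫ x in Ioo (0 : ℝ) 1, f x * g x := by
  rw [inner_eq_integral]
  refine integral_congr_ae ?_
  filter_upwards [toL2_coeFn h] with x hx
  rw [hx]

namespace Standing

variable {P} (hP : P.Standing)
include hP

theorem x₀_mem_Ioo : P.x₀ ∈ Ioo (0 : ℝ) 1 := hP.ω_subset hP.x₀_mem

theorem continuousOn_invSqrt : ContinuousOn P.invSqrt (Icc 0 1 \ {P.x₀}) := by
  refine ContinuousOn.inv₀ hP.a_C1.continuousOn.sqrt fun x hx => ?_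
  exact (Real.sqrt_pos.2 (hP.a_pos x hx)).ne'

theorem memLp_kern {x : ℝ} (hx : x ∈ Ioo (0 : ℝ) 1) (hx₀ : x ≠ P.x₀) :
    MemLp (P.kern x) 2 (volume.restrict (Ioo (0 : ℝ) 1)) := by
  have aux : ∀ c d : ℝ, Icc c d ⊆ Icc 0 1 \ {P.x₀} →
      MemLp ((Ioo c d).indicator P.invSqrt) 2 (volume.restrict (Ioo (0 : ℝ) 1)) := by
    intro c d hcd
    have hc := hP.continuousOn_invSqrt.mono hcd
    obtain ⟨C, hC⟩ := isCompact_Icc.exists_bound_of_continuousOn hc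
    rw [memLp_indicator_iff_restrict measurableSet_Ioo]
    have hsub : Ioo c d ⊆ Icc c d := Ioo_subset_Icc_self
    refine MemLp.of_bound ?_ C ?_
    · exact ((hc.mono hsub).aestronglyMeasurable measurableSet_Ioo).mono_measure
        (Measure.restrict_mono_measure Measure.restrict_le_self _)
    · filter_upwards [ae_restrict_mem measurableSet_Ioo] with y hy using hC y (hsub hy)
  rw [kern]
  split_ifs with h
  · exact aux 0 x fun y hy => ⟨⟨hy.1, hy.2.trans hx.2.le⟩, (hy.2.trans_lt h).ne⟩
  · have h' : P.x₀ < x := lt_of_le_of_ne (not_lt.1 h) (Ne.symm hx₀)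
    exact (aux x 1 fun y hy => ⟨⟨hx.1.le.trans hy.1, hy.2⟩, (h'.trans_le hy.1).ne'⟩).neg

theorem inner_kern {x : ℝ} (hx : x ∈ Ioo (0 : ℝ) 1) (hx₀ : x ≠ P.x₀) (w : L2) :
    inner ℝ (toL2 (P.kern x)) w = if x < P.x₀ then ∫ r in (0 : ℝ)..x, P.invSqrt r * w r
      else ∫ r in (1 : ℝ)..x, P.invSqrt r * w r := by
  rw [inner_toL2 (hP.memLp_kern hx hx₀)]
  have aux : ∀ c d : ℝ, 0 ≤ c → d ≤ 1 →
      ∫ r in Ioo (0 : ℝ) 1, (Ioo c d).indicator P.invSqrt r * w r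
        = ∫ r in Ioo c d, P.invSqrt r * w r := by
    intro c d hc hd
    have : (fun r => (Ioo c d).indicator P.invSqrt r * w r)
        = (Ioo c d).indicator fun r => P.invSqrt r * w r := by
      funext r
      by_cases hr : r ∈ Ioo c d <;> simp [hr]
    rw [this, setIntegral_indicator measurableSet_Ioo,
      inter_eq_right.2 (Ioo_subset_Ioo hc hd)]
  simp only [kern]
  split_ifs with h
  · rw [aux 0 x le_rfl hx.2.le, intervalIntegral.integral_of_le hx.1.le,
      restrict_Ioo_eq_restrict_Ioc]
  · simp only [Pi.neg_apply, neg_mul]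
    rw [integral_neg, aux x 1 hx.1.le le_rfl, intervalIntegral.integral_of_ge hx.2.le,
      restrict_Ioo_eq_restrict_Ioc]

theorem intervalIntegrable_left {x : ℝ} (hx : x ∈ Ioo (0 : ℝ) P.x₀) (w : L2) :
    IntervalIntegrable (fun r => P.invSqrt r * w r) volume 0 x := by
  have hx1 : x ∈ Ioo (0 : ℝ) 1 := ⟨hx.1, hx.2.trans hP.x₀_mem_Ioo.2⟩
  rw [intervalIntegrable_iff_integrableOn_Ioo_of_le hx.1.le]
  have h1 : Integrable (P.kern x * ⇑w) (volume.restrict (Ioo (0 : ℝ) 1)) :=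
    MemLp.integrable_mul (hP.memLp_kern hx1 hx.2.ne) (Lp.memLp w)
  have h2 : IntegrableOn (P.kern x * ⇑w) (Ioo 0 x) volume :=
    h1.mono_measure (Measure.restrict_mono (Ioo_subset_Ioo le_rfl hx1.2.le) le_rfl)
  refine h2.congr_fun (fun r hr => ?_) measurableSet_Ioo
  simp [kern, hx.2, hr.1, hr.2]

theorem intervalIntegrable_right {x : ℝ} (hx : x ∈ Ioo P.x₀ (1 : ℝ)) (w : L2) :
    IntervalIntegrable (fun r => P.invSqrt r * w r) volume x 1 := by
  have hx1 : x ∈ Ioo (0 : ℝ) 1 := ⟨hP.x₀_mem_Ioo.1.trans hx.1, hx.2⟩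
  rw [intervalIntegrable_iff_integrableOn_Ioo_of_le hx.2.le]
  have h1 : Integrable (P.kern x * ⇑w) (volume.restrict (Ioo (0 : ℝ) 1)) :=
    MemLp.integrable_mul (hP.memLp_kern hx1 hx.1.ne') (Lp.memLp w)
  have h2 : IntegrableOn (P.kern x * ⇑w) (Ioo x 1) volume :=
    h1.mono_measure (Measure.restrict_mono (Ioo_subset_Ioo hx1.1.le le_rfl) le_rfl)
  refine h2.neg.congr_fun (fun r hr => ?_) measurableSet_Ioo
  simp [kern, hx.1.le.not_gt, hr.1, hr.2]

/-- In the weakly degenerate case `1/a` is integrable. -/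
theorem memLp_invSqrt (hk : P.kind = .weak) :
    MemLp P.invSqrt 2 (volume.restrict (Ioo (0 : ℝ) 1)) := by
  obtain ⟨hx0, hx1⟩ := hP.x₀_mem_Ioo
  obtain ⟨hK0, hK1⟩ := hP.a_weak hk
  have hmeas : AEStronglyMeasurable P.invSqrt (volume.restrict (Ioo (0 : ℝ) 1)) := by
    have : (Ioo (0 : ℝ) 1 \ {P.x₀} : Set ℝ) =ᵐ[volume] Ioo (0 : ℝ) 1 :=
      sdiff_null_ae_eq_self (by simp)
    rw [← Measure.restrict_congr_set this]
    exact (hP.continuousOn_invSqrt.mono (sdiff_subset_sdiff_left Ioo_subset_Icc_self)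
      ).aestronglyMeasurable (measurableSet_Ioo.diff (measurableSet_singleton _))
  rw [memLp_two_iff_integrable_sq hmeas]
  have hinv : ∀ x, P.invSqrt x ^ 2 = (√(P.a x) ^ 2)⁻¹ := fun x => by rw [invSqrt, inv_pow]
  have hderiv : ∀ x ∈ Ioo (0 : ℝ) 1, x ≠ P.x₀ →
      HasDerivAt P.a (derivWithin P.a (Icc 0 1 \ {P.x₀}) x) x := by
    intro x hx hne
    have hmem : Icc 0 1 \ {P.x₀} ∈ 𝓝 x := by
      rw [sdiff_eq]
      exact inter_mem (Icc_mem_nhds hx.1 hx.2) (isOpen_compl_singleton.mem_nhds hne)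
    have := (hP.a_C1.differentiableOn (by simp)) x (mem_of_mem_nhds hmem)
    exact this.hasDerivWithinAt.hasDerivAt hmem
  -- one half-interval, parametrized by the distance to `x₀`
  have half : ∀ (ℓ e : ℝ), 0 < ℓ → (e = 1 ∨ e = -1) →
      (∀ r ∈ Ioc 0 ℓ, P.x₀ + e * r ∈ Icc (0 : ℝ) 1 \ {P.x₀}) →
      (∀ r ∈ Ioo 0 ℓ, P.x₀ + e * r ∈ Ioo (0 : ℝ) 1) →
      ∃ C, ∀ r ∈ Ioc 0 ℓ, P.invSqrt (P.x₀ + e * r) ^ 2 ≤ C * r ^ (-P.K) := by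
    intro ℓ e hℓ he hm hm'
    have he2 : e * e = 1 := by rcases he with rfl | rfl <;> norm_num
    have hcont : ContinuousOn (fun r => P.a (P.x₀ + e * r)) (Ioc 0 ℓ) :=
      hP.a_C1.continuousOn.comp (by fun_prop) hm
    have hd : ∀ r ∈ Ioo 0 ℓ, HasDerivAt (fun r => P.a (P.x₀ + e * r))
        (derivWithin P.a (Icc 0 1 \ {P.x₀}) (P.x₀ + e * r) * e) r := by
      intro r hr
      have h1 : HasDerivAt (fun r => P.x₀ + e * r) e r := by
        simpa using ((hasDerivAt_id r).const_mul e).const_add P.x₀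
      exact (hderiv _ (hm' r hr) (hm r ⟨hr.1, hr.2.le⟩).2).comp r h1
    have hgr : ∀ r ∈ Ioo 0 ℓ, r * (derivWithin P.a (Icc 0 1 \ {P.x₀}) (P.x₀ + e * r) * e)
        ≤ P.K * P.a (P.x₀ + e * r) := by
      intro r hr
      have := hP.a_growth _ (hm r ⟨hr.1, hr.2.le⟩)
      rw [add_sub_cancel_left] at this
      linarith
    have hpos : 0 < P.a (P.x₀ + e * ℓ) * ℓ ^ (-P.K) :=
      mul_pos (hP.a_pos _ (hm ℓ ⟨hℓ, le_rfl⟩)) (Real.rpow_pos_of_pos hℓ _)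
    refine ⟨(P.a (P.x₀ + e * ℓ) * ℓ ^ (-P.K))⁻¹, fun r hr => ?_⟩
    have h1 := rpow_le_of_growth hcont hd hgr hr
    rw [hinv, Real.sq_sqrt (hP.a_pos _ (hm r hr)).le, Real.rpow_neg hr.1.le, ← mul_inv]
    exact inv_anti₀ (mul_pos hpos (Real.rpow_pos_of_pos hr.1 _)) h1
  have hpow : ∀ ℓ : ℝ, IntervalIntegrable (fun r : ℝ => r ^ (-P.K)) volume 0 ℓ := fun ℓ =>
    intervalIntegral.intervalIntegrable_rpow' (by linarith)
  have hsplit : Ioo (0 : ℝ) 1 ⊆ Ioc 0 P.x₀ ∪ Ioo P.x₀ 1 := fun x hx =>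
    (le_or_gt x P.x₀).imp (fun h => ⟨hx.1, h⟩) fun h => ⟨h, hx.2⟩
  have hms := hmeas.pow 2
  have left : IntegrableOn (fun x => P.invSqrt x ^ 2) (Ioc 0 P.x₀) := by
    obtain ⟨C, hC⟩ := half P.x₀ (-1) hx0 (Or.inr rfl)
      (fun r hr => ⟨⟨by linarith [hr.2], by linarith [hr.1]⟩, by
        simp only [mem_singleton_iff]; linarith [hr.1]⟩)
      (fun r hr => ⟨by linarith [hr.2], by linarith [hr.1]⟩)
    rw [integrableOn_Ioc_iff_integrableOn_Ioo]
    have h1 : IntervalIntegrable (fun x : ℝ => C * (P.x₀ - x) ^ (-P.K)) volume 0 P.x₀ := by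
      have := ((hpow P.x₀).comp_sub_left P.x₀).symm
      simp only [sub_zero, sub_self] at this
      exact this.const_mul C
    rw [intervalIntegrable_iff_integrableOn_Ioo_of_le hx0.le] at h1
    refine Integrable.mono' h1
      (hms.mono_measure (Measure.restrict_mono (Ioo_subset_Ioo le_rfl hx1.le) le_rfl)) ?_
    filter_upwards [ae_restrict_mem measurableSet_Ioo] with x hx
    rw [Real.norm_of_nonneg (sq_nonneg _)]
    have := hC (P.x₀ - x) ⟨by linarith [hx.2], by linarith [hx.1]⟩
    have e : P.x₀ + -1 * (P.x₀ - x) = x := by ring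
    rwa [e] at this
  have right : IntegrableOn (fun x => P.invSqrt x ^ 2) (Ioo P.x₀ 1) := by
    obtain ⟨C, hC⟩ := half (1 - P.x₀) 1 (by linarith) (Or.inl rfl)
      (fun r hr => ⟨⟨by linarith [hr.1], by linarith [hr.2]⟩, by
        simp only [mem_singleton_iff]; linarith [hr.1]⟩)
      (fun r hr => ⟨by linarith [hr.1], by linarith [hr.2]⟩)
    have h1 : IntervalIntegrable (fun x : ℝ => C * (x - P.x₀) ^ (-P.K)) volume P.x₀ 1 := by
      have := (hpow (1 - P.x₀)).comp_sub_right P.x₀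
      simp only [zero_add, sub_add_cancel] at this
      exact this.const_mul C
    rw [intervalIntegrable_iff_integrableOn_Ioo_of_le hx1.le] at h1
    refine Integrable.mono' h1
      (hms.mono_measure (Measure.restrict_mono (Ioo_subset_Ioo hx0.le le_rfl) le_rfl)) ?_
    filter_upwards [ae_restrict_mem measurableSet_Ioo] with x hx
    rw [Real.norm_of_nonneg (sq_nonneg _)]
    have := hC (x - P.x₀) ⟨by linarith [hx.1], by linarith [hx.2]⟩
    have e : P.x₀ + 1 * (x - P.x₀) = x := by ring
    rwa [e] at this
  exact (left.union right).mono_set hsplit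

end Standing

end Data

end StackelbergNash

namespace StackelbergNash

namespace Data

variable (P : Data)

/-- The graph of the weighted derivative `z ↦ √a z'` on `H¹ₐ(0,1)`, described by the integral
representation `z(x) = ⟪k_x, √a z'⟫`. In the weakly degenerate case the two branches meet at `x₀`,
which is the condition `∫₀¹ z' = 0`. -/
noncomputable def graph : Submodule ℝ (L2 × L2) where
  carrier := {p | (∀ᵐ x ∂volume.restrict (Ioo (0 : ℝ) 1), p.1 x = inner ℝ (toL2 (P.kern x)) p.2) ∧
    (P.kind = .weak → inner ℝ (toL2 P.invSqrt) p.2 = (0 : ℝ))}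
  add_mem' := by
    rintro ⟨z, w⟩ ⟨z', w'⟩ ⟨h1, h2⟩ ⟨h1', h2'⟩
    refine ⟨?_, fun hk => ?_⟩
    · filter_upwards [h1, h1', Lp.coeFn_add z z'] with x a b c
      simp only [Prod.mk_add_mk, inner_add_right]
      rw [c, Pi.add_apply, a, b]
    · simp only [Prod.mk_add_mk, inner_add_right]
      rw [h2 hk, h2' hk, add_zero]
  zero_mem' := by
    refine ⟨?_, fun _ => by simp⟩
    filter_upwards [Lp.coeFn_zero ℝ 2 (volume.restrict (Ioo (0 : ℝ) 1))] with x hx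
    simpa using hx
  smul_mem' := by
    rintro c ⟨z, w⟩ ⟨h1, h2⟩
    refine ⟨?_, fun hk => ?_⟩
    · filter_upwards [h1, Lp.coeFn_smul c z] with x a b
      simp only [Prod.smul_mk, real_inner_smul_right]
      rw [b, Pi.smul_apply, a, smul_eq_mul]
    · simp only [Prod.smul_mk, real_inner_smul_right]
      rw [h2 hk, mul_zero]

theorem mem_graph {z w : L2} : (z, w) ∈ P.graph ↔
    (∀ᵐ x ∂volume.restrict (Ioo (0 : ℝ) 1), z x = inner ℝ (toL2 (P.kern x)) w) ∧
    (P.kind = .weak → inner ℝ (toL2 P.invSqrt) w = (0 : ℝ)) := Iff.rfl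

theorem isClosed_graph : IsClosed (P.graph : Set (L2 × L2)) := by
  refine IsSeqClosed.isClosed fun u p hu hp => ?_
  obtain ⟨h1, h2⟩ := Prod.tendsto_iff _ _ |>.1 hp
  refine ⟨?_, fun hk => ?_⟩
  · obtain ⟨φ, hφ, hae⟩ := (tendstoInMeasure_of_tendsto_Lp h1).exists_seq_tendsto_ae
    have hall := ae_all_iff.2 fun n => (hu n).1
    filter_upwards [hae, hall] with x hx hx'
    simp_rw [hx'] at hx
    exact tendsto_nhds_unique hx
      ((tendsto_const_nhds.inner (h2.comp hφ.tendsto_atTop)))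
  · have := fun n => (hu n).2 hk
    have h3 : Tendsto (fun n => (inner ℝ (toL2 P.invSqrt) (u n).2 : ℝ)) atTop
        (𝓝 (inner ℝ (toL2 P.invSqrt) p.2)) := tendsto_const_nhds.inner h2
    simp_rw [this] at h3
    exact (tendsto_nhds_unique h3 tendsto_const_nhds)

theorem isAC_of_contDiff {g : ℝ → ℝ} (hg : ContDiff ℝ 1 g) : P.IsAC g := by
  unfold IsAC
  cases P.kind with
  | weak => exact hg.contDiffOn.absolutelyContinuousOnInterval
  | strong => exact ⟨fun _ _ => hg.contDiffOn.absolutelyContinuousOnInterval,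
      fun _ _ => hg.contDiffOn.absolutelyContinuousOnInterval⟩

theorem ae_ne (x₀ : ℝ) {μ : Measure ℝ} [NullSingletonClass μ] : ∀ᵐ x ∂μ, x ≠ x₀ := by
  simp [ae_iff]

namespace Standing

variable {P} (hP : P.Standing)
include hP

theorem sqrt_mul_invSqrt {x : ℝ} (hx : x ∈ Ioo (0 : ℝ) 1) (hne : x ≠ P.x₀) (r : ℝ) :
    √(P.a x) * (P.invSqrt x * r) = r := by
  have := (Real.sqrt_pos.2 (hP.a_pos x ⟨Ioo_subset_Icc_self hx, hne⟩)).ne'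
  rw [invSqrt, mul_inv_cancel_left₀ this]

theorem isAC_left {g : ℝ → ℝ} (hg : P.IsAC g) {b : ℝ} (hb : b ∈ Ioo 0 P.x₀) :
    AbsolutelyContinuousOnInterval g 0 b := by
  have hx1 := hP.x₀_mem_Ioo.2
  unfold IsAC at hg
  rcases hk : P.kind with _ | _ <;> rw [hk] at hg
  · refine AbsolutelyContinuousOnInterval.mono hg ?_
    rw [uIcc_of_le hb.1.le, uIcc_of_le zero_le_one]
    exact Icc_subset_Icc_right (hb.2.trans hx1).le
  · exact hg.1 b hb

theorem isAC_right {g : ℝ → ℝ} (hg : P.IsAC g) {b : ℝ} (hb : b ∈ Ioo P.x₀ 1) :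
    AbsolutelyContinuousOnInterval g b 1 := by
  have hx0 := hP.x₀_mem_Ioo.1
  unfold IsAC at hg
  rcases hk : P.kind with _ | _ <;> rw [hk] at hg
  · refine AbsolutelyContinuousOnInterval.mono hg ?_
    rw [uIcc_of_le hb.2.le, uIcc_of_le zero_le_one]
    exact Icc_subset_Icc_left (hx0.trans hb.1).le
  · exact hg.2 b hb

/-- The integral representation of the functions in `H¹ₐ`. -/
theorem mem_graph_of_hasWeightedDeriv {z w : L2} (h : P.HasWeightedDeriv z w) :
    (z, w) ∈ P.graph := by
  obtain ⟨g, hz, hg, hg0, hg1, hw⟩ := h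
  obtain ⟨hx0, hx1⟩ := hP.x₀_mem_Ioo
  have hv : ∀ᵐ x ∂volume.restrict (Ioo (0 : ℝ) 1), P.invSqrt x * w x = deriv g x := by
    filter_upwards [hw, ae_restrict_mem measurableSet_Ioo, ae_ne P.x₀] with x h1 h2 h3
    have h4 := hP.sqrt_mul_invSqrt h2 h3 (deriv g x)
    rw [h1]
    rwa [mul_left_comm]
  have hvI : ∀ c d : ℝ, 0 ≤ c → c ≤ d → d ≤ 1 →
      ∫ r in c..d, P.invSqrt r * w r = ∫ r in c..d, deriv g r := by
    intro c d hc hcd hd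
    rw [intervalIntegral.integral_of_le hcd, intervalIntegral.integral_of_le hcd,
      ← restrict_Ioo_eq_restrict_Ioc]
    exact integral_congr_ae (ae_mono (Measure.restrict_mono (Ioo_subset_Ioo hc hd) le_rfl) hv)
  refine P.mem_graph.2 ⟨?_, fun hk => ?_⟩
  · filter_upwards [hz, ae_restrict_mem measurableSet_Ioo, ae_ne P.x₀] with x h1 h2 h3
    rw [h1, hP.inner_kern h2 h3]
    split_ifs with hlt
    · rw [hvI 0 x le_rfl h2.1.le h2.2.le, (hP.isAC_left hg ⟨h2.1, hlt⟩).integral_deriv_eq_sub, hg0,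
        sub_zero]
    · have hgt : P.x₀ < x := lt_of_le_of_ne (not_lt.1 hlt) (Ne.symm h3)
      rw [intervalIntegral.integral_symm, hvI x 1 h2.1.le h2.2.le le_rfl,
        (hP.isAC_right hg ⟨hgt, h2.2⟩).integral_deriv_eq_sub, hg1]
      ring
  · rw [inner_toL2 (hP.memLp_invSqrt hk), ← integral_Ioc_eq_integral_Ioo,
      ← intervalIntegral.integral_of_le zero_le_one, hvI 0 1 le_rfl zero_le_one le_rfl]
    have hac : AbsolutelyContinuousOnInterval g 0 1 := by
      unfold IsAC at hg
      rwa [hk] at hg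
    rw [hac.integral_deriv_eq_sub, hg0, hg1, sub_zero]

/-- Conversely, the integral representation defines an absolutely continuous representative. -/
theorem hasWeightedDeriv_of_mem_graph {z w : L2} (h : (z, w) ∈ P.graph) :
    P.HasWeightedDeriv z w := by
  obtain ⟨h1, h2⟩ := P.mem_graph.1 h
  obtain ⟨hx0, hx1⟩ := hP.x₀_mem_Ioo
  set v : ℝ → ℝ := fun r => P.invSqrt r * w r with hv
  set g : ℝ → ℝ := fun x => if x < P.x₀ then ∫ r in (0 : ℝ)..x, v r else ∫ r in (1 : ℝ)..x, v r
    with hg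
  have hgl : ∀ x < P.x₀, g x = ∫ r in (0 : ℝ)..x, v r := fun x hx => if_pos hx
  have hgr : ∀ x, P.x₀ ≤ x → g x = ∫ r in (1 : ℝ)..x, v r := fun x hx => if_neg hx.not_gt
  refine ⟨g, ?_, ?_, ?_, ?_, ?_⟩
  · filter_upwards [h1, ae_restrict_mem measurableSet_Ioo, ae_ne P.x₀] with x a b c
    rw [a, hP.inner_kern b c]
  · unfold IsAC
    rcases hk : P.kind with _ | _
    · have hvi : IntervalIntegrable v volume 0 1 := by
        rw [intervalIntegrable_iff_integrableOn_Ioo_of_le zero_le_one]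
        exact MemLp.integrable_mul (hP.memLp_invSqrt hk) (Lp.memLp w)
      have h0 : ∫ r in (0 : ℝ)..1, v r = 0 := by
        have := h2 hk
        rwa [inner_toL2 (hP.memLp_invSqrt hk), ← integral_Ioc_eq_integral_Ioo,
          ← intervalIntegral.integral_of_le zero_le_one] at this
      have hgall : ∀ x ∈ uIcc (0 : ℝ) 1, g x = ∫ r in (0 : ℝ)..x, v r := by
        intro x hx
        rcases lt_or_ge x P.x₀ with hlt | hge
        · exact hgl x hlt
        · rw [hgr x hge]
          rw [uIcc_of_le zero_le_one] at hx
          have e := intervalIntegral.integral_interval_sub_left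
            (hvi.mono_set (uIcc_zero_subset hx)) hvi
          rw [← e, h0, sub_zero]
      exact absolutelyContinuousOnInterval_of_dist_le
        (hvi.absolutelyContinuousOnInterval_intervalIntegral (c := 0) left_mem_uIcc)
        fun s hs t ht => by rw [hgall s hs, hgall t ht]
    · refine ⟨fun b hb => ?_, fun b hb => ?_⟩
      · refine absolutelyContinuousOnInterval_of_dist_le
          ((hP.intervalIntegrable_left hb w).absolutelyContinuousOnInterval_intervalIntegral
            (c := 0) left_mem_uIcc) fun s hs t ht => ?_
        rw [uIcc_of_le hb.1.le] at hs ht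
        rw [hgl s (hs.2.trans_lt hb.2), hgl t (ht.2.trans_lt hb.2)]
      · refine absolutelyContinuousOnInterval_of_dist_le
          ((hP.intervalIntegrable_right hb w).absolutelyContinuousOnInterval_intervalIntegral
            (c := 1) right_mem_uIcc) fun s hs t ht => ?_
        rw [uIcc_of_le hb.2.le] at hs ht
        rw [hgr s (hb.1.le.trans hs.1), hgr t (hb.1.le.trans ht.1)]
  · rw [hgl 0 hx0, intervalIntegral.integral_same]
  · rw [hgr 1 hx1.le, intervalIntegral.integral_same]
  · -- differentiate the primitives on the intervals with rational endpoints
    have dl : ∀ᵐ x, ∀ q : ℚ, (q : ℝ) ∈ Ioo 0 P.x₀ → x ∈ uIcc 0 (q : ℝ) →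
        HasDerivAt (fun x => ∫ r in (0 : ℝ)..x, v r) (v x) x := by
      rw [ae_all_iff]
      intro q
      by_cases hq : (q : ℝ) ∈ Ioo 0 P.x₀
      · filter_upwards [(hP.intervalIntegrable_left hq w).ae_hasDerivAt_integral] with x hx _ hm
        exact hx hm 0 left_mem_uIcc
      · exact Eventually.of_forall fun x h => absurd h hq
    have dr : ∀ᵐ x, ∀ q : ℚ, (q : ℝ) ∈ Ioo P.x₀ 1 → x ∈ uIcc (q : ℝ) 1 →
        HasDerivAt (fun x => ∫ r in (1 : ℝ)..x, v r) (v x) x := by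
      rw [ae_all_iff]
      intro q
      by_cases hq : (q : ℝ) ∈ Ioo P.x₀ 1
      · filter_upwards [(hP.intervalIntegrable_right hq w).ae_hasDerivAt_integral] with x hx _ hm
        exact hx hm 1 right_mem_uIcc
      · exact Eventually.of_forall fun x h => absurd h hq
    filter_upwards [ae_restrict_of_ae dl, ae_restrict_of_ae dr,
      ae_restrict_mem measurableSet_Ioo, ae_ne P.x₀] with x hl hr hx hne
    have hd : HasDerivAt g (v x) x := by
      rcases lt_or_gt_of_ne hne with hlt | hgt
      · obtain ⟨q, hq1, hq2⟩ := exists_rat_btwn hlt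
        have := hl q ⟨hx.1.trans hq1, hq2⟩ (by
          rw [uIcc_of_le (hx.1.trans hq1).le]; exact ⟨hx.1.le, hq1.le⟩)
        refine this.congr_of_eventuallyEq ?_
        filter_upwards [Iio_mem_nhds hlt] with y hy using hgl y hy
      · obtain ⟨q, hq1, hq2⟩ := exists_rat_btwn hgt
        have := hr q ⟨hq1, hq2.trans hx.2⟩ (by
          rw [uIcc_of_le (hq2.trans hx.2).le]; exact ⟨hq2.le, hx.2.le⟩)
        refine this.congr_of_eventuallyEq ?_
        filter_upwards [Ioi_mem_nhds hgt] with y hy using hgr y (le_of_lt hy)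
    rw [hd.deriv, hP.sqrt_mul_invSqrt hx hne]

theorem hasWeightedDeriv_iff {z w : L2} : P.HasWeightedDeriv z w ↔ (z, w) ∈ P.graph :=
  ⟨hP.mem_graph_of_hasWeightedDeriv, hP.hasWeightedDeriv_of_mem_graph⟩

/-- `H¹ₐ(0,1)` is dense in `L²(0,1)`: it contains the test functions that vanish near `x₀`. -/
theorem dense_graph : Dense (Prod.fst '' (P.graph : Set (L2 × L2))) := by
  set V : Submodule ℝ L2 := P.graph.map (LinearMap.fst ℝ L2 L2) with hV
  have hVset : (V : Set L2) = Prod.fst '' (P.graph : Set (L2 × L2)) := rfl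
  rw [← hVset, Submodule.dense_iff_topologicalClosure_eq_top,
    Submodule.topologicalClosure_eq_top_iff, Submodule.eq_bot_iff]
  intro h hh
  rw [Submodule.mem_orthogonal] at hh
  set U : Set ℝ := Ioo 0 1 \ {P.x₀} with hU
  have hUo : IsOpen U := isOpen_Ioo.sdiff isClosed_singleton
  have hUI : U ⊆ Ioo 0 1 := sdiff_subset
  have hloc : LocallyIntegrableOn h U volume := by
    have : IntegrableOn h (Ioo 0 1) volume := (Lp.memLp h).integrable one_le_two
    exact (this.mono_set hUI).locallyIntegrableOn
  have hzero : ∀ᵐ x, x ∈ U → h x = 0 := by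
    refine hUo.ae_eq_zero_of_integral_contDiff_smul_eq_zero hloc fun g hg hgc hgU => ?_
    have hg1 : ContDiff ℝ 1 g := hg.of_le (by exact_mod_cast le_top)
    have hg0 : ∀ x ∉ U, g x = 0 := fun x hx => image_eq_zero_of_notMem_tsupport fun h => hx (hgU h)
    have hgL : MemLp g 2 (volume.restrict (Ioo (0 : ℝ) 1)) :=
      (hg.continuous.memLp_of_hasCompactSupport hgc).restrict _
    have hwc : ContinuousOn (fun x => √(P.a x) * deriv g x) U :=
      (hP.a_C1.continuousOn.mono (sdiff_subset_sdiff_left Ioo_subset_Icc_self)).sqrt.mul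
        (hg1.continuous_deriv_one).continuousOn
    have hwL : MemLp (fun x => √(P.a x) * deriv g x) 2 (volume.restrict (Ioo (0 : ℝ) 1)) := by
      obtain ⟨C, hC⟩ := (IsCompact.exists_bound_of_continuousOn hgc (hwc.mono hgU))
      refine MemLp.of_bound ?_ (max C 0) (Eventually.of_forall fun x => ?_)
      · have : (U : Set ℝ) =ᵐ[volume] Ioo (0 : ℝ) 1 := sdiff_null_ae_eq_self (by simp)
        rw [← Measure.restrict_congr_set this]
        exact hwc.aestronglyMeasurable hUo.measurableSet
      · by_cases hx : x ∈ tsupport g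
        · exact (hC x hx).trans (le_max_left _ _)
        · have : deriv g x = 0 := by
            have h1 : x ∉ tsupport (deriv g) := fun h => hx (closure_minimal
              (support_deriv_subset) (isClosed_tsupport g) h)
            exact image_eq_zero_of_notMem_tsupport h1
          simp [this]
    have hmem : (toL2 g, toL2 fun x => √(P.a x) * deriv g x) ∈ P.graph := by
      refine hP.mem_graph_of_hasWeightedDeriv ⟨g, toL2_coeFn hgL, P.isAC_of_contDiff hg1, ?_, ?_,
        toL2_coeFn hwL⟩
      · exact hg0 0 fun h => (hUI h).1.false
      · exact hg0 1 fun h => (hUI h).2.false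
    have := hh (toL2 g) ⟨_, hmem, rfl⟩
    rw [inner_toL2 hgL] at this
    refine Eq.trans ?_ this
    refine (setIntegral_eq_integral_of_forall_compl_eq_zero fun x hx => ?_).symm
    rw [hg0 x fun h => hx (hUI h), zero_smul]
  rw [Lp.eq_zero_iff_ae_eq_zero]
  filter_upwards [ae_restrict_of_ae hzero, ae_restrict_mem measurableSet_Ioo, ae_ne P.x₀]
    with x h1 h2 h3
  exact h1 ⟨h2, h3⟩

end Standing

end Data

end StackelbergNash

namespace StackelbergNash

/-! ### Multiplication operators and functions of space and time -/

instance : SecondCountableTopology L2 :=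
  haveI : Fact ((2 : ℝ≥0∞) ≠ ∞) := ⟨by simp⟩
  inferInstance

theorem memLp_mul_of_bound {m : ℝ → ℝ} {b : ℝ}
    (h1 : AEStronglyMeasurable m (volume.restrict (Ioo (0 : ℝ) 1)))
    (h2 : ∀ᵐ x ∂volume.restrict (Ioo (0 : ℝ) 1), ‖m x‖ ≤ b) (z : L2) :
    MemLp (fun x => m x * z x) 2 (volume.restrict (Ioo (0 : ℝ) 1)) :=
  (Lp.memLp z).of_le_mul (c := b) (h1.mul (Lp.aestronglyMeasurable z)) (by
    filter_upwards [h2] with x hx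
    rw [norm_mul]
    exact mul_le_mul_of_nonneg_right hx (norm_nonneg _))

/-- Multiplication by a function bounded by `b` on `L²(0,1)`, and zero if `m` is not of
this kind. -/
noncomputable def mulOp (m : ℝ → ℝ) (b : ℝ) : L2 →L[ℝ] L2 :=
  open Classical in
  if h : 0 ≤ b ∧ AEStronglyMeasurable m (volume.restrict (Ioo (0 : ℝ) 1)) ∧
      ∀ᵐ x ∂volume.restrict (Ioo (0 : ℝ) 1), ‖m x‖ ≤ b then
    LinearMap.mkContinuous
      { toFun := fun z => (memLp_mul_of_bound h.2.1 h.2.2 z).toLp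
        map_add' := fun z z' => by
          rw [← MemLp.toLp_add]
          refine MemLp.toLp_congr _ _ ?_
          filter_upwards [Lp.coeFn_add z z'] with x hx
          simp only [hx, Pi.add_apply, mul_add]
        map_smul' := fun r z => by
          rw [RingHom.id_apply, ← MemLp.toLp_const_smul]
          refine MemLp.toLp_congr _ _ ?_
          filter_upwards [Lp.coeFn_smul r z] with x hx
          simp only [hx, Pi.smul_apply, smul_eq_mul]
          ring } b
      (fun z => Lp.norm_le_mul_norm_of_ae_le_mul (by
        filter_upwards [h.2.2, (memLp_mul_of_bound h.2.1 h.2.2 z).coeFn_toLp] with x hx hx'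
        change ‖((memLp_mul_of_bound h.2.1 h.2.2 z).toLp : ℝ → ℝ) x‖ ≤ _
        rw [hx', norm_mul]
        exact mul_le_mul_of_nonneg_right hx (norm_nonneg _)))
  else 0

theorem norm_mulOp_le (m : ℝ → ℝ) {b : ℝ} (hb : 0 ≤ b) : ‖mulOp m b‖ ≤ b := by
  rw [mulOp]
  split_ifs with h
  · exact LinearMap.mkContinuous_norm_le _ hb _
  · simpa using hb

theorem mulOp_coeFn {m : ℝ → ℝ} {b : ℝ} (hb : 0 ≤ b)
    (h1 : AEStronglyMeasurable m (volume.restrict (Ioo (0 : ℝ) 1)))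
    (h2 : ∀ᵐ x ∂volume.restrict (Ioo (0 : ℝ) 1), ‖m x‖ ≤ b) (z : L2) :
    mulOp m b z =ᵐ[volume.restrict (Ioo 0 1)] fun x => m x * z x := by
  rw [mulOp, dif_pos ⟨hb, h1, h2⟩]
  exact (memLp_mul_of_bound h1 h2 z).coeFn_toLp

theorem inner_mulOp {m : ℝ → ℝ} {b : ℝ} (hb : 0 ≤ b)
    (h1 : AEStronglyMeasurable m (volume.restrict (Ioo (0 : ℝ) 1)))
    (h2 : ∀ᵐ x ∂volume.restrict (Ioo (0 : ℝ) 1), ‖m x‖ ≤ b) (z v : L2) :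
    inner ℝ (mulOp m b z) v = ∫ x in Ioo (0 : ℝ) 1, m x * z x * v x := by
  rw [inner_eq_integral]
  refine integral_congr_ae ?_
  filter_upwards [mulOp_coeFn hb h1 h2 z] with x hx
  rw [hx]

theorem mulOp_symm (m : ℝ → ℝ) (b : ℝ) (z v : L2) :
    inner ℝ (mulOp m b z) v = (inner ℝ z (mulOp m b v) : ℝ) := by
  by_cases h : 0 ≤ b ∧ AEStronglyMeasurable m (volume.restrict (Ioo (0 : ℝ) 1)) ∧
      ∀ᵐ x ∂volume.restrict (Ioo (0 : ℝ) 1), ‖m x‖ ≤ b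
  · rw [real_inner_comm (mulOp m b v) z, inner_mulOp h.1 h.2.1 h.2.2, inner_mulOp h.1 h.2.1 h.2.2]
    exact integral_congr_ae (Eventually.of_forall fun x => by ring)
  · simp only [mulOp, dif_neg h, zero_apply, inner_zero_left, inner_zero_right]

/-- The restriction of a function to `D`, extended by zero. -/
noncomputable def restr (D : Set ℝ) : L2 →L[ℝ] L2 := mulOp (D.indicator 1) 1

section restr

variable {D : Set ℝ}

theorem restr_coeFn (hD : MeasurableSet D) (z : L2) :
    restr D z =ᵐ[volume.restrict (Ioo 0 1)] D.indicator z := by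
  have h1 : AEStronglyMeasurable (D.indicator (1 : ℝ → ℝ)) (volume.restrict (Ioo (0 : ℝ) 1)) :=
    (measurable_one.indicator hD).aestronglyMeasurable
  have h2 : ∀ x, ‖D.indicator (1 : ℝ → ℝ) x‖ ≤ 1 := fun x => by
    by_cases hx : x ∈ D <;> simp [hx]
  filter_upwards [mulOp_coeFn zero_le_one h1 (Eventually.of_forall h2) z] with x hx
  rw [restr, hx]
  by_cases h : x ∈ D <;> simp [h]

theorem norm_restr_le (z : L2) : ‖restr D z‖ ≤ ‖z‖ := by
  have := (restr D).le_of_opNorm_le (norm_mulOp_le (D.indicator 1) zero_le_one) z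
  rwa [one_mul] at this

theorem restr_symm (z v : L2) : inner ℝ (restr D z) v = (inner ℝ z (restr D v) : ℝ) :=
  mulOp_symm _ _ _ _

theorem restr_eq_of_ae (hD : MeasurableSet D) {z : L2} {f : ℝ → ℝ}
    (h : z =ᵐ[volume.restrict (Ioo 0 1)] D.indicator f) : restr D z = z := by
  refine Lp.ext ?_
  filter_upwards [restr_coeFn hD z, h] with x h1 h2
  rw [h1]
  by_cases hx : x ∈ D
  · simp [hx]
  · rw [h2]; simp [hx]

theorem restr_restr (hD : MeasurableSet D) (z : L2) : restr D (restr D z) = restr D z :=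
  restr_eq_of_ae hD (restr_coeFn hD z)

end restr

theorem ofReal_norm_toL2_sq {f : ℝ → ℝ} (h : MemLp f 2 (volume.restrict (Ioo (0 : ℝ) 1))) :
    ENNReal.ofReal (‖toL2 f‖ ^ 2) = ∫⁻ x in Ioo (0 : ℝ) 1, ENNReal.ofReal (f x ^ 2) := by
  rw [toL2, dif_pos h, norm_toLp_sq]
  simp only [Real.norm_eq_abs, sq_abs]
  exact ofReal_integral_eq_lintegral_ofReal h.integrable_sq
    (Eventually.of_forall fun x => sq_nonneg _)

theorem ofReal_norm_sq (z : L2) :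
    ENNReal.ofReal (‖z‖ ^ 2) = ∫⁻ x in Ioo (0 : ℝ) 1, ENNReal.ofReal (z x ^ 2) := by
  rw [← ofReal_norm_toL2_sq (Lp.memLp z), toL2, dif_pos (Lp.memLp z), Lp.toLp_coeFn]

/-- The slices of a null set are null. -/
theorem ae_slices {D S : Set ℝ} {p : ℝ × ℝ → Prop}
    (h : ∀ᵐ z ∂volume.restrict (D ×ˢ S), p z) :
    ∀ᵐ t ∂volume.restrict S, ∀ᵐ x ∂volume.restrict D, p (x, t) := by
  rw [Measure.volume_eq_prod, ← Measure.prod_restrict, ← Measure.prod_swap] at h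
  exact Measure.ae_ae_of_ae_prod (ae_of_ae_map measurable_swap.aemeasurable h)

/-- The path in `L²(0,1)` that corresponds to a function on `D × (0,T)`, extended by zero. -/
noncomputable def emb (D : Set ℝ) (u : ℝ × ℝ → ℝ) (t : ℝ) : L2 :=
  toL2 (D.indicator fun ξ => u (ξ, t))

section emb

variable {D S : Set ℝ} {u v : ℝ × ℝ → ℝ}

theorem restrict_prod_eq (D S : Set ℝ) :
    volume.restrict (D ×ˢ S) = (volume.restrict D).prod (volume.restrict S) := by
  rw [Measure.volume_eq_prod, Measure.prod_restrict]

theorem memLp_slice (hD : MeasurableSet D) (hDI : D ⊆ Ioo 0 1)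
    (hu : MemLp u 2 (volume.restrict (D ×ˢ S))) :
    ∀ᵐ t ∂volume.restrict S,
      MemLp (D.indicator fun ξ => u (ξ, t)) 2 (volume.restrict (Ioo (0 : ℝ) 1)) := by
  have hu2 := hu.integrable_sq
  have hu1 := hu.1
  rw [restrict_prod_eq] at hu1 hu2
  filter_upwards [hu1.prodMk_right, hu2.prod_left_ae] with t h1 h2
  rw [memLp_indicator_iff_restrict hD, Measure.restrict_restrict hD, inter_eq_left.2 hDI,
    memLp_two_iff_integrable_sq h1]
  exact h2

theorem emb_coeFn (hD : MeasurableSet D) (hDI : D ⊆ Ioo 0 1)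
    (hu : MemLp u 2 (volume.restrict (D ×ˢ S))) :
    ∀ᵐ t ∂volume.restrict S,
      emb D u t =ᵐ[volume.restrict (Ioo 0 1)] D.indicator fun ξ => u (ξ, t) := by
  filter_upwards [memLp_slice hD hDI hu] with t ht using toL2_coeFn ht

theorem restr_emb (hD : MeasurableSet D) (hDI : D ⊆ Ioo 0 1)
    (hu : MemLp u 2 (volume.restrict (D ×ˢ S))) :
    ∀ᵐ t ∂volume.restrict S, restr D (emb D u t) = emb D u t := by
  filter_upwards [emb_coeFn hD hDI hu] with t ht using restr_eq_of_ae hD ht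

theorem ofReal_norm_emb_sq (hD : MeasurableSet D) (hDI : D ⊆ Ioo 0 1)
    (hu : MemLp u 2 (volume.restrict (D ×ˢ S))) :
    ∀ᵐ t ∂volume.restrict S,
      ENNReal.ofReal (‖emb D u t‖ ^ 2) = ∫⁻ x in D, ENNReal.ofReal (u (x, t) ^ 2) := by
  filter_upwards [memLp_slice hD hDI hu] with t ht
  rw [emb, ofReal_norm_toL2_sq ht]
  have : (fun x => ENNReal.ofReal ((D.indicator (fun ξ => u (ξ, t)) x) ^ 2))
      = D.indicator fun x => ENNReal.ofReal (u (x, t) ^ 2) := by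
    funext x
    by_cases hx : x ∈ D <;> simp [hx]
  rw [this, setLIntegral_indicator hD, inter_eq_left.2 hDI]

theorem emb_eq_of_ae (hD : MeasurableSet D) (hDI : D ⊆ Ioo 0 1)
    (hu : MemLp u 2 (volume.restrict (D ×ˢ S))) {f : ℝ → L2}
    (h : ∀ᵐ t ∂volume.restrict S, ∀ᵐ x ∂volume.restrict D, u (x, t) = f t x) :
    ∀ᵐ t ∂volume.restrict S, emb D u t = restr D (f t) := by
  filter_upwards [emb_coeFn hD hDI hu, h] with t h1 h2
  refine Lp.ext ?_
  have h2' : ∀ᵐ x ∂volume.restrict (Ioo (0 : ℝ) 1), x ∈ D → u (x, t) = f t x :=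
    ae_restrict_of_ae ((ae_restrict_iff' hD).1 h2)
  filter_upwards [h1, restr_coeFn hD (f t), h2'] with x a b c
  rw [a, b]
  by_cases hx : x ∈ D <;> simp [hx, c]

theorem ae_of_emb_eq (hD : MeasurableSet D) (hDI : D ⊆ Ioo 0 1)
    (hu : MemLp u 2 (volume.restrict (D ×ˢ S))) {f : ℝ → L2}
    (h : ∀ᵐ t ∂volume.restrict S, emb D u t = restr D (f t)) :
    ∀ᵐ t ∂volume.restrict S, ∀ᵐ x ∂volume.restrict D, u (x, t) = f t x := by
  filter_upwards [emb_coeFn hD hDI hu, h] with t h1 h2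
  have h3 : ∀ᵐ x ∂volume.restrict D, D.indicator (fun ξ => u (ξ, t)) x = D.indicator (f t) x := by
    refine ae_mono (Measure.restrict_mono hDI le_rfl) ?_
    filter_upwards [h1, restr_coeFn hD (f t)] with x a b
    rw [← a, ← b, h2]
  filter_upwards [h3, ae_restrict_mem hD] with x a b
  simpa [b] using a

theorem lintegral_slices {h : ℝ × ℝ → ℝ≥0∞}
    (hh : AEMeasurable h (volume.restrict (D ×ˢ S))) :
    ∫⁻ z in D ×ˢ S, h z = ∫⁻ t in S, ∫⁻ x in D, h (x, t) := by
  rw [restrict_prod_eq] at hh ⊢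
  exact lintegral_prod_symm _ hh

theorem aestronglyMeasurable_emb (hD : MeasurableSet D) (hDI : D ⊆ Ioo 0 1)
    (hu : MemLp u 2 (volume.restrict (D ×ˢ S))) :
    AEStronglyMeasurable (emb D u) (volume.restrict S) := by
  refine aestronglyMeasurable_of_inner fun w => ?_
  have hmeas : AEStronglyMeasurable (fun z : ℝ × ℝ => (D ×ˢ univ).indicator u z * w z.1)
      ((volume.restrict (Ioo (0 : ℝ) 1)).prod (volume.restrict S)) := by
    refine AEStronglyMeasurable.mul ?_ (Lp.aestronglyMeasurable w).comp_fst
    rw [← restrict_prod_eq, aestronglyMeasurable_indicator_iff (hD.prod MeasurableSet.univ),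
      Measure.restrict_restrict (hD.prod MeasurableSet.univ), prod_inter_prod,
      inter_eq_left.2 hDI, univ_inter]
    exact hu.1
  refine (hmeas.prod_swap.integral_prod_right').congr ?_
  filter_upwards [memLp_slice hD hDI hu] with t ht
  rw [emb, inner_toL2 ht]
  refine integral_congr_ae (Eventually.of_forall fun x => ?_)
  by_cases hx : x ∈ D <;> simp [hx]

theorem lintegral_norm_emb_sq (hD : MeasurableSet D) (hDI : D ⊆ Ioo 0 1)
    (hu : MemLp u 2 (volume.restrict (D ×ˢ S))) :
    ∫⁻ t in S, ENNReal.ofReal (‖emb D u t‖ ^ 2) = ∫⁻ z in D ×ˢ S, ENNReal.ofReal (u z ^ 2) := by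
  rw [lintegral_slices (hu.integrable_sq.1.aemeasurable.ennreal_ofReal)]
  exact lintegral_congr_ae (ofReal_norm_emb_sq hD hDI hu)

theorem memLp_emb (hD : MeasurableSet D) (hDI : D ⊆ Ioo 0 1)
    (hu : MemLp u 2 (volume.restrict (D ×ˢ S))) : MemLp (emb D u) 2 (volume.restrict S) := by
  have hm := aestronglyMeasurable_emb hD hDI hu
  rw [memLp_two_iff_integrable_sq_norm hm]
  refine ⟨hm.norm.pow 2, ?_⟩
  rw [hasFiniteIntegral_iff_ofReal (Eventually.of_forall fun _ => sq_nonneg _),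
    lintegral_norm_emb_sq hD hDI hu]
  exact (hasFiniteIntegral_iff_ofReal (Eventually.of_forall fun _ => sq_nonneg _)).1
    hu.integrable_sq.2

theorem integral_norm_emb_sq (hD : MeasurableSet D) (hDI : D ⊆ Ioo 0 1)
    (hu : MemLp u 2 (volume.restrict (D ×ˢ S))) :
    ∫ t in S, ‖emb D u t‖ ^ 2 = ∫ z in D ×ˢ S, u z ^ 2 := by
  rw [integral_eq_lintegral_of_nonneg_ae (Eventually.of_forall fun _ => sq_nonneg _)
      ((memLp_emb hD hDI hu).1.norm.pow 2), lintegral_norm_emb_sq hD hDI hu,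
    integral_eq_lintegral_of_nonneg_ae (Eventually.of_forall fun _ => sq_nonneg _)
      hu.integrable_sq.1]

/-- The isometry `L²(D × S) → L²(S; L²(0,1))`. -/
noncomputable def embL (hD : MeasurableSet D) (hDI : D ⊆ Ioo 0 1) :
    Lp ℝ 2 (volume.restrict (D ×ˢ S)) →ₗᵢ[ℝ] Lp L2 2 (volume.restrict S) where
  toFun u := (memLp_emb hD hDI (Lp.memLp u)).toLp
  map_add' u v := by
    rw [← MemLp.toLp_add]
    refine MemLp.toLp_congr _ _ ?_
    filter_upwards [emb_coeFn hD hDI (Lp.memLp (u + v)), emb_coeFn hD hDI (Lp.memLp u),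
      emb_coeFn hD hDI (Lp.memLp v), ae_slices (Lp.coeFn_add u v)] with t h1 h2 h3 h4
    refine Lp.ext ?_
    have h4' := ae_restrict_of_ae (s := Ioo (0 : ℝ) 1) ((ae_restrict_iff' hD).1 h4)
    rw [Pi.add_apply]
    filter_upwards [h1, h2, h3, h4', Lp.coeFn_add (emb D u t) (emb D v t)] with x a b c d e
    rw [a, e, Pi.add_apply, b, c]
    by_cases hx : x ∈ D
    · simpa [hx] using d hx
    · simp [hx]
  map_smul' r u := by
    rw [RingHom.id_apply, ← MemLp.toLp_const_smul]
    refine MemLp.toLp_congr _ _ ?_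
    filter_upwards [emb_coeFn hD hDI (Lp.memLp (r • u)), emb_coeFn hD hDI (Lp.memLp u),
      ae_slices (Lp.coeFn_smul r u)] with t h1 h2 h4
    refine Lp.ext ?_
    have h4' := ae_restrict_of_ae (s := Ioo (0 : ℝ) 1) ((ae_restrict_iff' hD).1 h4)
    rw [Pi.smul_apply]
    filter_upwards [h1, h2, h4', Lp.coeFn_smul r (emb D u t)] with x a b d e
    rw [a, e, Pi.smul_apply, b]
    by_cases hx : x ∈ D
    · simpa [hx] using d hx
    · simp [hx]
  norm_map' u := by
    have h : ‖(memLp_emb hD hDI (Lp.memLp u)).toLp‖ ^ 2 = ‖u‖ ^ 2 := by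
      rw [norm_toLp_sq, integral_norm_emb_sq hD hDI (Lp.memLp u)]
      have := norm_toLp_sq (Lp.memLp u)
      rw [Lp.toLp_coeFn] at this
      rw [this]
      simp
    exact (pow_left_inj₀ (norm_nonneg _) (norm_nonneg _) two_ne_zero).1 h

theorem embL_coeFn (hD : MeasurableSet D) (hDI : D ⊆ Ioo 0 1)
    (u : Lp ℝ 2 (volume.restrict (D ×ˢ S))) :
    embL hD hDI u =ᵐ[volume.restrict S] emb D u :=
  (memLp_emb hD hDI (Lp.memLp u)).coeFn_toLp

/-- Every path in `L²(S; L²(0,1))` comes, after restriction to `D`, from a function on `D × S`: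
the adjoint of the isometry `embL` provides it, as `embL` hits all products `1_s(t) χ_D w(x)`. -/
theorem exists_emb_eq (hD : MeasurableSet D) (hDI : D ⊆ Ioo 0 1)
    (hSfin : volume S ≠ ∞) {q : ℝ → L2} (hq : MemLp q 2 (volume.restrict S)) :
    ∃ r : Lp ℝ 2 (volume.restrict (D ×ˢ S)),
      ∀ᵐ t ∂volume.restrict S, emb D r t = restr D (q t) := by
  have : IsFiniteMeasure (volume.restrict S) := ⟨by simpa using hSfin.lt_top⟩
  set E := embL hD hDI
  set r := E.toContinuousLinearMap.adjoint hq.toLp with hr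
  have hEr : MemLp (emb D r) 2 (volume.restrict S) := memLp_emb hD hDI (Lp.memLp r)
  have hd : MemLp (fun t => emb D r t - q t) 2 (volume.restrict S) := hEr.sub hq
  have horth : ∀ u : Lp ℝ 2 (volume.restrict (D ×ˢ S)),
      ∫ t in S, (inner ℝ (emb D u t) (emb D r t - q t) : ℝ) = 0 := by
    intro u
    have e1 : inner ℝ (E u) hq.toLp = (inner ℝ u r : ℝ) := by
      rw [hr, ContinuousLinearMap.adjoint_inner_right]; rfl
    have e2 : inner ℝ (E u) (E r) = (inner ℝ u r : ℝ) := E.inner_map_map u r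
    rw [L2.inner_def] at e1 e2
    have i1 : Integrable (fun t => (inner ℝ (E u t) (E r t) : ℝ)) (volume.restrict S) :=
      L2.integrable_inner _ _
    have i2 : Integrable (fun t => (inner ℝ (E u t) ((hq.toLp : ℝ → L2) t) : ℝ)) (volume.restrict S) :=
      L2.integrable_inner _ _
    have e3 := integral_sub i1 i2
    rw [e1, e2, sub_self] at e3
    refine Eq.trans (integral_congr_ae ?_) e3
    filter_upwards [embL_coeFn hD hDI u, embL_coeFn hD hDI r, hq.coeFn_toLp] with t a b c
    rw [a, b, c, inner_sub_right]
  refine ⟨r, ?_⟩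
  have hzero : (fun t => restr D (emb D r t - q t)) =ᵐ[volume.restrict S] 0 := by
    refine ae_eq_zero_of_forall_inner (𝕜 := ℝ) fun w => ?_
    have hint : Integrable (fun t => (inner ℝ w (restr D (emb D r t - q t)) : ℝ))
        (volume.restrict S) :=
      (innerSL ℝ w).integrable_comp ((restr D).integrable_comp (hd.integrable one_le_two))
    refine hint.ae_eq_zero_of_forall_setIntegral_eq_zero fun s hs _ => ?_
    -- test with the control `1_s(t) w(x)`
    have hmem : MemLp (fun z : ℝ × ℝ => w z.1 * s.indicator (1 : ℝ → ℝ) z.2) 2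
        (volume.restrict (D ×ˢ S)) := by
      have hwD : MemLp w 2 (volume.restrict D) :=
        (Lp.memLp w).mono_measure (Measure.restrict_mono hDI le_rfl)
      have hs2 : MemLp (s.indicator (1 : ℝ → ℝ)) 2 (volume.restrict S) :=
        (memLp_const (1 : ℝ)).indicator hs
      rw [restrict_prod_eq]
      refine (memLp_two_iff_integrable_sq (hwD.1.comp_fst.mul hs2.1.comp_snd)).2 ?_
      have := hwD.integrable_sq.mul_prod hs2.integrable_sq
      simpa only [Pi.mul_apply, mul_pow] using this
    have := horth hmem.toLp
    rw [← integral_indicator hs]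
    refine Eq.trans (integral_congr_ae ?_) this
    have hemb := emb_eq_of_ae hD hDI (Lp.memLp hmem.toLp)
      (f := fun t => (s.indicator (1 : ℝ → ℝ) t) • w) (by
        have hsm : ∀ᵐ t ∂volume.restrict S, ∀ᵐ x ∂volume.restrict D,
            ((s.indicator (1 : ℝ → ℝ) t) • w : L2) x = s.indicator (1 : ℝ → ℝ) t * w x :=
          Eventually.of_forall fun t => ae_mono (Measure.restrict_mono hDI le_rfl) (by
            filter_upwards [Lp.coeFn_smul (s.indicator (1 : ℝ → ℝ) t) w] with x hx
            rw [hx, Pi.smul_apply, smul_eq_mul])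
        filter_upwards [ae_slices hmem.coeFn_toLp, hsm] with t a b
        filter_upwards [a, b] with x a b
        rw [a, b, mul_comm])
    filter_upwards [hemb] with t ht
    rw [ht, map_smul, real_inner_smul_left, restr_symm]
    by_cases hts : t ∈ s <;> simp [hts]
  filter_upwards [hzero, restr_emb hD hDI (Lp.memLp r)] with t h1 h2
  simp only [Pi.zero_apply, map_sub, h2] at h1
  exact sub_eq_zero.1 h1

theorem integral_norm_emb_sq_eq (hD : MeasurableSet D) (hDI : D ⊆ Ioo 0 1)
    (u : Lp ℝ 2 (volume.restrict (D ×ˢ S))) : ∫ t in S, ‖emb D u t‖ ^ 2 = ‖u‖ ^ 2 := by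
  have h := norm_toLp_sq (Lp.memLp u)
  rw [Lp.toLp_coeFn] at h
  rw [integral_norm_emb_sq hD hDI (Lp.memLp u), h]
  simp

theorem integral_inner_emb (hD : MeasurableSet D) (hDI : D ⊆ Ioo 0 1)
    (u v : Lp ℝ 2 (volume.restrict (D ×ˢ S))) :
    ∫ t in S, (inner ℝ (emb D u t) (emb D v t) : ℝ) = ∫ z in D ×ˢ S, u z * v z := by
  have h := (embL (S := S) hD hDI).inner_map_map u v
  rw [L2.inner_def, L2.inner_def] at h
  rw [show ∫ z in D ×ˢ S, u z * v z = ∫ z in D ×ˢ S, (inner ℝ (u z) (v z) : ℝ) from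
    integral_congr_ae (Eventually.of_forall fun z => by simp [mul_comm]), ← h]
  refine integral_congr_ae ?_
  filter_upwards [embL_coeFn hD hDI u, embL_coeFn hD hDI v] with t a b
  rw [a, b]

theorem emb_sub (hD : MeasurableSet D) (hDI : D ⊆ Ioo 0 1)
    (u v : Lp ℝ 2 (volume.restrict (D ×ˢ S))) :
    ∀ᵐ t ∂volume.restrict S, emb D (u - v : Lp ℝ 2 (volume.restrict (D ×ˢ S))) t
      = emb D u t - emb D v t := by
  have h := Lp.coeFn_sub (embL hD hDI u) (embL hD hDI v)
  rw [← map_sub] at h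
  filter_upwards [h, embL_coeFn hD hDI u, embL_coeFn hD hDI v, embL_coeFn hD hDI (u - v)]
    with t a b c d
  rw [← d, a, Pi.sub_apply, b, c]

theorem eq_of_emb_eq (hD : MeasurableSet D) (hDI : D ⊆ Ioo 0 1)
    {u v : Lp ℝ 2 (volume.restrict (D ×ˢ S))}
    (h : ∀ᵐ t ∂volume.restrict S, emb D u t = emb D v t) : u = v := by
  refine (embL hD hDI).injective (Lp.ext ?_)
  filter_upwards [h, embL_coeFn hD hDI u, embL_coeFn hD hDI v] with t a b c
  rw [b, c, a]

end emb

end StackelbergNash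

namespace StackelbergNash

/-! ### The parabolic problem as an abstract evolution equation -/

theorem integral_reverse {E : Type*} [NormedAddCommGroup E]
    [NormedSpace ℝ E] (f : ℝ → E) (t T : ℝ) :
    ∫ τ in (0 : ℝ)..t, f (T - τ) = ∫ τ in (T - t)..T, f τ := by
  rw [intervalIntegral.integral_comp_sub_left, sub_zero]

namespace Data

variable (P : Data)

/-- An essential bound of the potential `c`. -/
noncomputable def cBound : ℝ :=
  (eLpNorm P.c ∞ (volume.restrict (Ioo (0 : ℝ) 1 ×ˢ P.time))).toReal

/-- The multiplication by `c(·,t)` on `L²(0,1)`. -/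
noncomputable def pot (t : ℝ) : L2 →L[ℝ] L2 := mulOp (fun x => P.c (x, t)) P.cBound

theorem cBound_nonneg : 0 ≤ P.cBound := ENNReal.toReal_nonneg

theorem slice_of_mem (y : P.Path) {t : ℝ} (ht : t ∈ Icc 0 P.T) : P.slice y t = y ⟨t, ht⟩ := by
  rw [slice, dif_pos ht]

theorem continuousOn_slice (y : P.Path) : ContinuousOn (P.slice y) (Icc 0 P.T) := by
  rw [continuousOn_iff_continuous_domRestrict]
  refine y.continuous.congr fun t => ?_
  rw [domRestrict_apply, P.slice_of_mem y t.2]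

theorem memLp_slice (y : P.Path) : MemLp (P.slice y) 2 (volume.restrict P.time) :=
  memLp_of_continuousOn_Icc (P.continuousOn_slice y)

theorem path_ext {y y' : P.Path} (h : ∀ t ∈ Icc 0 P.T, P.slice y t = P.slice y' t) : y = y' := by
  ext1 t
  rw [← P.slice_of_mem y t.2, ← P.slice_of_mem y' t.2, h t t.2]

theorem exists_slice_eq {y : ℝ → L2} (hy : ContinuousOn y (Icc 0 P.T)) :
    ∃ Y : P.Path, ∀ t ∈ Icc 0 P.T, P.slice Y t = y t :=
  ⟨⟨(Icc 0 P.T).domRestrict y, continuousOn_iff_continuous_domRestrict.1 hy⟩,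
    fun t ht => by rw [P.slice_of_mem _ ht]; rfl⟩

/-- `𝔽` is the function `F` of space and time, read as a path in `L²(0,1)`. -/
def Represents (𝔽 : ℝ → L2) (F : ℝ → ℝ → ℝ) : Prop :=
  ∀ᵐ t ∂volume.restrict P.time, 𝔽 t =ᵐ[volume.restrict (Ioo 0 1)] fun x => F x t

variable {P} in
theorem Represents.inner_eq {𝔽 : ℝ → L2} {F : ℝ → ℝ → ℝ} (hF : P.Represents 𝔽 F) (v : L2) :
    ∀ᵐ t ∂volume.restrict P.time,
      inner ℝ (𝔽 t) v = ∫ x in Ioo (0 : ℝ) 1, F x t * v x := by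
  filter_upwards [hF] with t ht
  rw [inner_eq_integral]
  refine integral_congr_ae ?_
  filter_upwards [ht] with x hx
  rw [hx]

namespace Standing

variable {P} (hP : P.Standing)
include hP

theorem ae_c : ∀ᵐ t ∂volume.restrict P.time,
    AEStronglyMeasurable (fun x => P.c (x, t)) (volume.restrict (Ioo (0 : ℝ) 1)) ∧
      ∀ᵐ x ∂volume.restrict (Ioo (0 : ℝ) 1), ‖P.c (x, t)‖ ≤ P.cBound := by
  have h1 := hP.c_bdd.1
  rw [restrict_prod_eq] at h1
  have h2 : ∀ᵐ z ∂volume.restrict (Ioo (0 : ℝ) 1 ×ˢ P.time), ‖P.c z‖ ≤ P.cBound := by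
    filter_upwards [ae_le_eLpNormEssSup (f := P.c)
      (μ := volume.restrict (Ioo (0 : ℝ) 1 ×ˢ P.time))] with z hz
    rw [cBound, eLpNorm_exponent_top]
    have h3 := hP.c_bdd.2.ne
    rw [eLpNorm_exponent_top] at h3
    simpa using ENNReal.toReal_mono h3 hz
  filter_upwards [h1.prodMk_right, ae_slices h2] with t a b using ⟨a, b⟩

theorem inner_pot : ∀ᵐ t ∂volume.restrict P.time, ∀ z v : L2,
    inner ℝ (P.pot t z) v = ∫ x in Ioo (0 : ℝ) 1, P.c (x, t) * z x * v x := by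
  filter_upwards [hP.ae_c] with t ht z v using inner_mulOp P.cBound_nonneg ht.1 ht.2 z v

theorem isPotential : IsPotential P.pot P.cBound P.T := by
  refine ⟨fun t => norm_mulOp_le _ P.cBound_nonneg, fun t => mulOp_symm _ _, fun v => ?_⟩
  refine aestronglyMeasurable_of_inner fun w => ?_
  have h1 := hP.c_bdd.1
  rw [restrict_prod_eq] at h1
  have hm := (h1.mul (Lp.aestronglyMeasurable v).comp_fst).mul (Lp.aestronglyMeasurable w).comp_fst
  refine (hm.prod_swap.integral_prod_right').congr ?_
  filter_upwards [hP.inner_pot] with t ht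
  exact (ht v w).symm

theorem integral_form_eq {y p : ℝ → L2} {v w : L2} {t : ℝ} (ht : t ∈ Icc 0 P.T) :
    ∫ τ in (0 : ℝ)..t, P.form τ (y τ) (p τ) v w
      = ∫ τ in (0 : ℝ)..t, (inner ℝ (p τ) w + inner ℝ (P.pot τ (y τ)) v) := by
  refine integral_zero_congr_ae ht ?_
  filter_upwards [hP.inner_pot] with τ hτ
  rw [form, hτ]

variable {𝔽 : ℝ → L2} {F : ℝ → ℝ → ℝ}

theorem isForwardSol_iff (hF : P.Represents 𝔽 F) {y₀ : L2} {y : P.Path} :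
    P.IsForwardSol F y₀ y ↔ ∃ p, IsWeakSol P.graph P.pot P.T 𝔽 y₀ (P.slice y) p := by
  constructor
  · rintro ⟨h0, p, hp, h⟩
    refine ⟨p, P.continuousOn_slice y, h0, hp.1, ?_, fun q hq t ht => ?_⟩
    · filter_upwards [hp.2] with t ht using hP.hasWeightedDeriv_iff.1 ht
    · rw [← hP.integral_form_eq ht, h q.1 q.2 (hP.hasWeightedDeriv_iff.2 hq) t ht]
      exact (integral_zero_congr_ae ht (hF.inner_eq q.1)).symm
  · rintro ⟨p, h⟩
    refine ⟨h.init, p, ⟨h.memLp, ?_⟩, fun v w hvw t ht => ?_⟩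
    · filter_upwards [h.mem] with t ht using hP.hasWeightedDeriv_iff.2 ht
    · have := h.eq (v, w) (hP.hasWeightedDeriv_iff.1 hvw) t ht
      rw [hP.integral_form_eq ht, this]
      exact integral_zero_congr_ae ht (hF.inner_eq v)

/-- Backward solutions are the time reversals of forward solutions for the reversed data. -/
theorem isBackwardSol_iff (hF : P.Represents 𝔽 F) {q : P.Path} :
    P.IsBackwardSol F q ↔ ∃ r, IsWeakSol P.graph (fun τ => P.pot (P.T - τ)) P.T
      (fun τ => 𝔽 (P.T - τ)) 0 (fun τ => P.slice q (P.T - τ)) r := by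
  have hrev : ∀ {p : ℝ → Prop}, (∀ᵐ t ∂volume.restrict P.time, p t) →
      ∀ᵐ t ∂volume.restrict P.time, p (P.T - t) := fun h =>
    (measurePreserving_reverse P.T).quasiMeasurePreserving.ae h
  have hmap : MapsTo (fun t => P.T - t) (Icc 0 P.T) (Icc 0 P.T) := fun t ht =>
    ⟨sub_nonneg.2 ht.2, sub_le_self _ ht.1⟩
  have hform : ∀ (p : ℝ → L2) (v w : L2) {t : ℝ}, t ∈ Icc 0 P.T →
      ∫ τ in (P.T - t)..P.T, P.form τ (P.slice q τ) (p τ) v w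
        = ∫ τ in (0 : ℝ)..t, (inner ℝ (p (P.T - τ)) w
          + inner ℝ (P.pot (P.T - τ) (P.slice q (P.T - τ))) v) := by
    intro p v w t ht
    rw [← integral_reverse]
    refine integral_zero_congr_ae ht ?_
    filter_upwards [hrev hP.inner_pot] with τ hτ
    rw [form, hτ]
  have hsource : ∀ (v : L2) {t : ℝ}, t ∈ Icc 0 P.T →
      ∫ τ in (P.T - t)..P.T, ∫ x in Ioo (0 : ℝ) 1, F x τ * v x
        = ∫ τ in (0 : ℝ)..t, (inner ℝ (𝔽 (P.T - τ)) v : ℝ) := by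
    intro v t ht
    rw [← integral_reverse (fun τ => ∫ x in Ioo (0 : ℝ) 1, F x τ * v x)]
    refine integral_zero_congr_ae ht ?_
    filter_upwards [hrev (hF.inner_eq v)] with τ hτ
    rw [hτ]
  constructor
  · rintro ⟨h0, p, hp, h⟩
    refine ⟨fun τ => p (P.T - τ), (P.continuousOn_slice q).comp (by fun_prop) hmap, by simpa using h0,
      hp.1.comp_measurePreserving (measurePreserving_reverse P.T), ?_, fun v hv t ht => ?_⟩
    · filter_upwards [hrev hp.2] with t ht using hP.hasWeightedDeriv_iff.1 ht
    · have := h v.1 v.2 (hP.hasWeightedDeriv_iff.2 hv) (P.T - t) (hmap ht)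
      rw [hform p _ _ ht, hsource _ ht] at this
      rw [inner_zero_left, sub_zero, this]
  · rintro ⟨r, h⟩
    refine ⟨by simpa using h.init, fun τ => r (P.T - τ),
      ⟨h.memLp.comp_measurePreserving (measurePreserving_reverse P.T), ?_⟩, fun v w hvw t ht => ?_⟩
    · filter_upwards [hrev h.mem] with t ht
      simp only [sub_sub_cancel] at ht
      exact hP.hasWeightedDeriv_iff.2 ht
    · have h1 := h.eq (v, w) (hP.hasWeightedDeriv_iff.1 hvw) (P.T - t) (hmap ht)
      have h2 := hform (fun τ => r (P.T - τ)) v w (hmap ht)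
      have h3 := hsource v (hmap ht)
      simp only [sub_sub_cancel, inner_zero_left, sub_zero] at h1 h2 h3
      rw [h2, h3, h1]

theorem existsUnique_forward (h𝔽 : MemLp 𝔽 2 (volume.restrict P.time)) (hF : P.Represents 𝔽 F)
    (y₀ : L2) : ∃! y : P.Path, P.IsForwardSol F y₀ y := by
  obtain ⟨y, p, h⟩ := exists_isWeakSol P.isClosed_graph hP.dense_graph hP.T_pos hP.isPotential h𝔽 y₀
  obtain ⟨Y, hY⟩ := P.exists_slice_eq h.cont
  refine ⟨Y, (hP.isForwardSol_iff hF).2 ⟨p, h.congr hP.T_pos.le hY⟩, fun Y' hY' => ?_⟩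
  obtain ⟨p', h'⟩ := (hP.isForwardSol_iff hF).1 hY'
  refine P.path_ext fun t ht => ?_
  rw [hY t ht, h'.unique P.isClosed_graph hP.dense_graph hP.isPotential h𝔽 h ht]

theorem existsUnique_backward (h𝔽 : MemLp 𝔽 2 (volume.restrict P.time))
    (hF : P.Represents 𝔽 F) : ∃! q : P.Path, P.IsBackwardSol F q := by
  have h𝔽' := h𝔽.comp_measurePreserving (measurePreserving_reverse P.T)
  have hmap : MapsTo (fun t => P.T - t) (Icc 0 P.T) (Icc 0 P.T) := fun t ht =>
    ⟨sub_nonneg.2 ht.2, sub_le_self _ ht.1⟩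
  obtain ⟨z, r, h⟩ := exists_isWeakSol P.isClosed_graph hP.dense_graph hP.T_pos
    hP.isPotential.reverse h𝔽' 0
  obtain ⟨Q, hQ⟩ := P.exists_slice_eq (y := fun t => z (P.T - t))
    (h.cont.comp (by fun_prop) hmap)
  have hQ' : ∀ t ∈ Icc 0 P.T, P.slice Q (P.T - t) = z t := fun t ht => by
    rw [hQ _ (hmap ht), sub_sub_cancel]
  refine ⟨Q, (hP.isBackwardSol_iff hF).2 ⟨r, h.congr hP.T_pos.le hQ'⟩, fun Q' h'' => ?_⟩
  obtain ⟨r', h'⟩ := (hP.isBackwardSol_iff hF).1 h''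
  refine P.path_ext fun t ht => ?_
  have := h'.unique P.isClosed_graph hP.dense_graph hP.isPotential.reverse h𝔽' h (hmap ht)
  simp only [sub_sub_cancel] at this
  rw [hQ t ht, this]

end Standing

end Data

end StackelbergNash

namespace StackelbergNash

/-! ### The weight -/

namespace Data.Standing

variable {P : Data} (hP : P.Standing)
include hP

theorem K_lt_two : P.K < 2 := by
  rcases h : P.kind with _ | _
  · exact (hP.a_weak h).2.trans one_lt_two
  · exact (hP.a_strong h).1.2

theorem a_nonneg {x : ℝ} (hx : x ∈ Icc (0 : ℝ) 1) : 0 ≤ P.a x := by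
  by_cases h : x = P.x₀
  · rw [h, hP.a_zero]
  · exact (hP.a_pos x ⟨hx, h⟩).le

theorem weight_bound_pos {c₂ : ℝ}
    (hc₂ : max ((1 - P.x₀) ^ 2 / (P.a 1 * (2 - P.K))) (P.x₀ ^ 2 / (P.a 0 * (2 - P.K))) < c₂) :
    0 < c₂ := by
  refine lt_of_le_of_lt ?_ ((le_max_left _ _).trans_lt hc₂)
  exact div_nonneg (sq_nonneg _)
    (mul_nonneg (hP.a_nonneg ⟨zero_le_one, le_rfl⟩) (sub_nonneg.2 hP.K_lt_two.le))

theorem integral_weight_nonneg {x : ℝ} (hx : x ∈ Icc (0 : ℝ) 1) :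
    0 ≤ ∫ r in P.x₀..x, (r - P.x₀) / P.a r := by
  have h₀ := hP.x₀_mem_Ioo
  rcases le_total P.x₀ x with h | h
  · refine intervalIntegral.integral_nonneg h fun r hr => ?_
    exact div_nonneg (sub_nonneg.2 hr.1) (hP.a_nonneg ⟨h₀.1.le.trans hr.1, hr.2.trans hx.2⟩)
  · rw [intervalIntegral.integral_symm, ← intervalIntegral.integral_neg]
    refine intervalIntegral.integral_nonneg h fun r hr => ?_
    rw [← neg_div]
    exact div_nonneg (by linarith [hr.2]) (hP.a_nonneg ⟨hx.1.trans hr.1, hr.2.trans h₀.2.le⟩)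

/-- The minimum of `ψ` is attained at the point of degeneracy, because `(r - x₀)/a(r)` has the sign
of `r - x₀`. -/
theorem σ_eq {ϑ : ℝ → ℝ} {c₁ : ℝ} (c₂ s t : ℝ) (hϑ : 0 ≤ ϑ t) (hc₁ : 0 < c₁) :
    P.σ ϑ c₁ c₂ s t = Real.exp (s * (ϑ t * (c₁ * c₂)) / 2) := by
  have hmin : IsLeast ((fun x => ϑ t * P.ψ c₁ c₂ x) '' Icc 0 1) (-(ϑ t * (c₁ * c₂))) := by
    refine ⟨⟨P.x₀, Ioo_subset_Icc_self hP.x₀_mem_Ioo, ?_⟩, ?_⟩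
    · simp only [Data.ψ, intervalIntegral.integral_same]; ring
    · rintro _ ⟨x, hx, rfl⟩
      have h1 := mul_nonneg (mul_nonneg hϑ hc₁.le) (hP.integral_weight_nonneg hx)
      simp only [Data.ψ]
      nlinarith
  rw [Data.σ, hmin.csInf_eq]
  congr 1
  ring

theorem ϑ_nonneg {ϑ : ℝ → ℝ} (hϑ : ϑ = P.θ ∨ ϑ = P.η) (t : ℝ) : 0 ≤ ϑ t := by
  have hT := hP.T_pos
  have hθ : 0 ≤ P.θ t := one_div_nonneg.2 (Even.pow_nonneg (by decide) _)
  rcases hϑ with rfl | rfl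
  · exact hθ
  · rw [Data.η]
    split_ifs
    · positivity
    · exact hθ

omit hP in
theorem measurable_ϑ {ϑ : ℝ → ℝ} (hϑ : ϑ = P.θ ∨ ϑ = P.η) : Measurable ϑ := by
  have hθ : Measurable P.θ := by unfold Data.θ; fun_prop
  rcases hϑ with rfl | rfl
  · exact hθ
  · exact Measurable.ite measurableSet_Iic measurable_const hθ

theorem measurable_σ {ϑ : ℝ → ℝ} (hϑ : ϑ = P.θ ∨ ϑ = P.η) {c₁ : ℝ} (c₂ s : ℝ) (hc₁ : 0 < c₁) :
    Measurable (P.σ ϑ c₁ c₂ s) := by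
  have h : P.σ ϑ c₁ c₂ s = fun t => Real.exp (s * (ϑ t * (c₁ * c₂)) / 2) :=
    funext fun t => hP.σ_eq c₂ s t (hP.ϑ_nonneg hϑ t) hc₁
  have := measurable_ϑ hϑ
  rw [h]
  fun_prop

theorem one_le_σ {ϑ : ℝ → ℝ} (hϑ : ϑ = P.θ ∨ ϑ = P.η) {c₁ c₂ s : ℝ} (hc₁ : 0 < c₁) (hc₂ : 0 < c₂)
    (hs : 0 < s) (t : ℝ) : 1 ≤ P.σ ϑ c₁ c₂ s t := by
  have h := hP.ϑ_nonneg hϑ t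
  rw [hP.σ_eq c₂ s t h hc₁, Real.one_le_exp_iff]
  positivity

end Data.Standing

end StackelbergNash

namespace StackelbergNash

/-! ### Minimizers of a quadratic cost with an unbounded weight -/

section

variable {Ω : Type*} [MeasurableSpace Ω] {m : Measure Ω}

theorem integrable_mul_of_memLp {f g : Ω → ℝ} (hf : MemLp f 2 m) (hg : MemLp g 2 m) :
    Integrable (fun z => f z * g z) m := by
  have := hf.integrable_mul hg
  exact this

theorem memLp_two_of_lintegral {f : Ω → ℝ} (hf : AEStronglyMeasurable f m)
    (h : ∫⁻ z, ENNReal.ofReal (f z ^ 2) ∂m ≠ ∞) : MemLp f 2 m := by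
  rw [memLp_two_iff_integrable_sq hf]
  exact ⟨hf.pow 2, (hasFiniteIntegral_iff_ofReal (Eventually.of_forall fun _ => sq_nonneg _)).2
    h.lt_top⟩

/-- Let `N` be a cost with derivative `r` at `0`, up to quadratic terms. Then `0` minimizes
`N(v) + (μ/2) ∫ ρ²(u+v)²` if and only if `r + μ ρ² u = 0`. As `ρ` may be unbounded, the cost can
be infinite, and `ρ u ∈ L²` is part of the conclusion rather than an assumption. -/
theorem isMin_weighted_iff {ρ : Ω → ℝ} (hρ : AEStronglyMeasurable ρ m) (h1 : ∀ z, 1 ≤ ρ z)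
    {μ : ℝ} (hμ : 0 < μ) {C : ℝ} {N : Lp ℝ 2 m → ℝ} {r : Lp ℝ 2 m} (hN : ∀ v, 0 ≤ N v)
    (hl : ∀ v, N 0 + ∫ z, r z * v z ∂m ≤ N v)
    (hu : ∀ v, N v ≤ N 0 + ∫ z, r z * v z ∂m + C * ‖v‖ ^ 2) (u : Lp ℝ 2 m) :
    (∀ v : Lp ℝ 2 m, ENNReal.ofReal (N 0)
        + ENNReal.ofReal (μ / 2) * ∫⁻ z, ENNReal.ofReal (ρ z ^ 2 * u z ^ 2) ∂m
      ≤ ENNReal.ofReal (N v)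
        + ENNReal.ofReal (μ / 2) * ∫⁻ z, ENNReal.ofReal (ρ z ^ 2 * (u + v) z ^ 2) ∂m) ↔
    ∀ᵐ z ∂m, u z = -(1 / μ) * (ρ z ^ 2)⁻¹ * r z := by
  have hρ0 : ∀ z, 0 < ρ z := fun z => zero_lt_one.trans_le (h1 z)
  have hcost : ∀ {w : Lp ℝ 2 m}, MemLp (fun z => ρ z * w z) 2 m → ∀ v,
      ENNReal.ofReal (N v) + ENNReal.ofReal (μ / 2) * ∫⁻ z, ENNReal.ofReal (ρ z ^ 2 * w z ^ 2) ∂m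
        = ENNReal.ofReal (N v + μ / 2 * ∫ z, (ρ z * w z) ^ 2 ∂m) := by
    intro w hw v
    have hnn : 0 ≤ ∫ z, (ρ z * w z) ^ 2 ∂m := integral_nonneg fun _ => sq_nonneg _
    rw [ENNReal.ofReal_add (hN v) (by positivity), ENNReal.ofReal_mul (by positivity),
      ofReal_integral_eq_lintegral_ofReal hw.integrable_sq
        (Eventually.of_forall fun _ => sq_nonneg _)]
    simp only [mul_pow]
  have htop : ∀ {w : Lp ℝ 2 m}, ¬ MemLp (fun z => ρ z * w z) 2 m → ∀ v,
      ENNReal.ofReal (N v) + ENNReal.ofReal (μ / 2) * ∫⁻ z, ENNReal.ofReal (ρ z ^ 2 * w z ^ 2) ∂m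
        = ∞ := by
    intro w hw v
    have : ∫⁻ z, ENNReal.ofReal (ρ z ^ 2 * w z ^ 2) ∂m = ∞ := by
      by_contra h
      simp only [← mul_pow] at h
      exact hw (memLp_two_of_lintegral (hρ.mul (Lp.aestronglyMeasurable w)) h)
    rw [this, ENNReal.mul_top (by simpa using hμ), add_top]
  have hinv : ∀ z, ‖(ρ z)⁻¹‖ ≤ 1 := fun z => by
    rw [Real.norm_of_nonneg (inv_nonneg.2 (hρ0 z).le)]
    exact inv_le_one_of_one_le₀ (h1 z)
  have hρr : MemLp (fun z => (ρ z)⁻¹ * r z) 2 m :=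
    (Lp.memLp r).of_le_mul (c := 1) (hρ.inv₀.mul (Lp.aestronglyMeasurable r))
      (Eventually.of_forall fun z => by
        rw [norm_mul]
        exact mul_le_mul_of_nonneg_right (hinv z) (norm_nonneg _))
  constructor
  · intro h
    -- comparison with the zero control shows that the cost of `u` is finite
    have hρu : MemLp (fun z => ρ z * u z) 2 m := by
      by_contra hc
      have h2 := h (-u)
      rw [htop hc, add_neg_cancel, top_le_iff] at h2
      have h3 : MemLp (fun z => ρ z * (0 : Lp ℝ 2 m) z) 2 m := by
        refine (memLp_congr_ae ?_).2 (MemLp.zero (ε := ℝ))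
        filter_upwards [Lp.coeFn_zero ℝ 2 m] with z hz
        simp only [Pi.zero_apply] at hz ⊢
        rw [hz, mul_zero]
      rw [hcost h3] at h2
      exact ENNReal.ofReal_ne_top h2
    -- the direction of descent `w = -(ρ⁻² r + μ u)`
    have hρ2r : MemLp (fun z => (ρ z)⁻¹ * ((ρ z)⁻¹ * r z)) 2 m :=
      hρr.of_le_mul (c := 1) (hρ.inv₀.mul hρr.1)
        (Eventually.of_forall fun z => by
          rw [norm_mul]
          exact mul_le_mul_of_nonneg_right (hinv z) (norm_nonneg _))
    have hw : MemLp (fun z => -((ρ z)⁻¹ * ((ρ z)⁻¹ * r z) + μ * u z)) 2 m :=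
      (hρ2r.add ((Lp.memLp u).const_mul μ)).neg
    have hρw : MemLp (fun z => -((ρ z)⁻¹ * r z + μ * (ρ z * u z))) 2 m :=
      (hρr.add (hρu.const_mul μ)).neg
    set w := hw.toLp with hw_def
    have hwz : ∀ᵐ z ∂m, ρ z * w z = -((ρ z)⁻¹ * r z + μ * (ρ z * u z)) := by
      filter_upwards [hw.coeFn_toLp] with z hz
      rw [hw_def, hz]
      have := (hρ0 z).ne'
      field_simp
    have hρw' : MemLp (fun z => ρ z * w z) 2 m := (memLp_congr_ae hwz).2 hρw
    set I := ∫ z, (ρ z * w z) ^ 2 ∂m with hI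
    have hI0 : 0 ≤ I := integral_nonneg fun _ => sq_nonneg _
    have hru : Integrable (fun z => r z * w z) m := integrable_mul_of_memLp (Lp.memLp r) (Lp.memLp w)
    have hρuw := integrable_mul_of_memLp hρu hρw'
    have hcross : ∫ z, r z * w z ∂m + μ * ∫ z, ρ z * u z * (ρ z * w z) ∂m = -I := by
      rw [← integral_const_mul, ← integral_add hru (hρuw.const_mul μ), hI, ← integral_neg]
      refine integral_congr_ae ?_
      filter_upwards [hwz] with z hz
      have h2 : r z * w z = ((ρ z)⁻¹ * r z) * (ρ z * w z) := by
        have := (hρ0 z).ne'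
        field_simp
      rw [h2]
      linear_combination (ρ z * w z) * hz
    have hε : ∀ ε : ℝ, 0 < ε → I ≤ ε * (C * ‖w‖ ^ 2 + μ / 2 * I) := by
      intro ε hε
      have hsum : ∀ᵐ z ∂m, ρ z * (u + ε • w) z = ρ z * u z + ε * (ρ z * w z) := by
        filter_upwards [Lp.coeFn_add u (ε • w), Lp.coeFn_smul ε w] with z h2 h3
        rw [h2, Pi.add_apply, h3, Pi.smul_apply, smul_eq_mul]
        ring
      have hmem : MemLp (fun z => ρ z * (u + ε • w) z) 2 m :=
        (memLp_congr_ae hsum).2 (hρu.add (hρw'.const_mul ε))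
      have h2 := h (ε • w)
      rw [hcost hρu, hcost hmem, ENNReal.ofReal_le_ofReal_iff (add_nonneg (hN _)
        (mul_nonneg (by positivity) (integral_nonneg fun _ => sq_nonneg _)))] at h2
      have h3 : ∫ z, (ρ z * (u + ε • w) z) ^ 2 ∂m = ∫ z, (ρ z * u z) ^ 2 ∂m
          + 2 * ε * ∫ z, ρ z * u z * (ρ z * w z) ∂m + ε ^ 2 * I := by
        have hadd : Integrable (fun z => (ρ z * u z) ^ 2 + 2 * ε * (ρ z * u z * (ρ z * w z))) m :=
          hρu.integrable_sq.add (hρuw.const_mul _)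
        rw [← integral_const_mul, hI, ← integral_const_mul,
          ← integral_add hρu.integrable_sq (hρuw.const_mul _),
          ← integral_add hadd (hρw'.integrable_sq.const_mul _)]
        refine integral_congr_ae ?_
        filter_upwards [hsum] with z hz
        rw [hz]; ring
      have h4 := hu (ε • w)
      have h5 : ∫ z, r z * (ε • w : Lp ℝ 2 m) z ∂m = ε * ∫ z, r z * w z ∂m := by
        rw [← integral_const_mul]
        refine integral_congr_ae ?_
        filter_upwards [Lp.coeFn_smul ε w] with z hz
        rw [hz, Pi.smul_apply, smul_eq_mul]; ring
      rw [h5, norm_smul, Real.norm_of_nonneg hε.le, mul_pow] at h4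
      rw [h3] at h2
      have h6 : 0 ≤ ε * (ε * (C * ‖w‖ ^ 2 + μ / 2 * I) - I) := by
        have : I = -(∫ z, r z * w z ∂m + μ * ∫ z, ρ z * u z * (ρ z * w z) ∂m) := by linarith
        calc (0 : ℝ) ≤ ε * (∫ z, r z * w z ∂m + μ * ∫ z, ρ z * u z * (ρ z * w z) ∂m)
              + ε ^ 2 * (C * ‖w‖ ^ 2 + μ / 2 * I) := by linarith
          _ = _ := by rw [hcross]; ring
      have := nonneg_of_mul_nonneg_right h6 hε
      linarith
    have hI' : I ≤ 0 := by
      refine ge_of_tendsto (f := fun ε : ℝ => ε * (C * ‖w‖ ^ 2 + μ / 2 * I))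
        (x := 𝓝[>] 0) ?_ ?_
      · have : Tendsto (fun ε : ℝ => ε * (C * ‖w‖ ^ 2 + μ / 2 * I)) (𝓝 0)
            (𝓝 (0 * (C * ‖w‖ ^ 2 + μ / 2 * I))) := tendsto_id.mul_const _
        rw [zero_mul] at this
        exact this.mono_left nhdsWithin_le_nhds
      · filter_upwards [self_mem_nhdsWithin] with ε h using hε ε h
    have hI'' : I = 0 := le_antisymm hI' hI0
    rw [hI, integral_eq_zero_iff_of_nonneg (fun _ => sq_nonneg _) hρw'.integrable_sq] at hI''
    filter_upwards [hI'', hwz] with z h2 h3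
    have h4 : ρ z * w z = 0 := pow_eq_zero_iff two_ne_zero |>.1 h2
    rw [h4] at h3
    have := (hρ0 z).ne'
    field_simp at h3 ⊢
    linarith
  · intro h v
    have hρu : MemLp (fun z => ρ z * u z) 2 m := by
      refine (memLp_congr_ae ?_).2 (hρr.const_mul (-(1 / μ)))
      filter_upwards [h] with z hz
      have := (hρ0 z).ne'
      rw [hz]
      field_simp
    by_cases hv : MemLp (fun z => ρ z * (u + v) z) 2 m
    · rw [hcost hρu, hcost hv]
      refine ENNReal.ofReal_le_ofReal ?_
      have hrv : Integrable (fun z => r z * v z) m :=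
        integrable_mul_of_memLp (Lp.memLp r) (Lp.memLp v)
      have h2 : ∫ z, (ρ z * u z) ^ 2 ∂m - 2 / μ * ∫ z, r z * v z ∂m
          ≤ ∫ z, (ρ z * (u + v) z) ^ 2 ∂m := by
        rw [← integral_const_mul, ← integral_sub hρu.integrable_sq (hrv.const_mul _)]
        refine integral_mono_ae (hρu.integrable_sq.sub (hrv.const_mul _)) hv.integrable_sq ?_
        filter_upwards [h, Lp.coeFn_add u v] with z h3 h4
        rw [h4, Pi.add_apply]
        have h5 : r z = -μ * ρ z ^ 2 * u z := by
          have := (hρ0 z).ne'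
          rw [h3]
          field_simp
        have h6 : 2 / μ * (r z * v z) = -(2 * (ρ z * u z) * (ρ z * v z)) := by
          rw [h5]
          field_simp
        rw [h6]
        nlinarith [sq_nonneg (ρ z * v z)]
      have h3 := hl v
      have h4 : μ / 2 * (2 / μ * ∫ z, r z * v z ∂m) = ∫ z, r z * v z ∂m := by
        field_simp
      have h5 := mul_le_mul_of_nonneg_left h2 (half_pos hμ).le
      rw [mul_sub, h4] at h5
      linarith
    · rw [htop hv]
      exact le_top

end

end StackelbergNash

namespace StackelbergNash

/-! ### The state, the adjoint states, and the feedback -/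

namespace Data

variable (P : Data)

/-- The source of the state equation, as a path in `L²(0,1)`. -/
noncomputable def stateSource (f : P.Leader) (u : ∀ i, P.Follower i) (t : ℝ) : L2 :=
  emb P.ω f t + ∑ i, emb (P.ωF i) (u i) t

/-- The source of the `i`-th adjoint equation, as a path in `L²(0,1)`. -/
noncomputable def adjSource (yd : ∀ i, P.Target i) (y : P.Path) (i : Fin 2) (t : ℝ) : L2 :=
  P.α i • (restr (P.O i) (P.slice y t) - emb (P.O i) (yd i) t)

/-- `q` is the `i`-th adjoint state of `y`. -/
def IsAdjoint (yd : ∀ i, P.Target i) (y : P.Path) (i : Fin 2) (q : P.Path) : Prop :=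
  P.IsBackwardSol
    (fun x t => (P.O i).indicator (fun ξ => P.α i * (P.slice y t ξ - yd i (ξ, t))) x) q

/-- The `i`-th adjoint state of `y`. -/
noncomputable def adj (yd : ∀ i, P.Target i) (y : P.Path) (i : Fin 2) : P.Path :=
  Classical.epsilon (P.IsAdjoint yd y i)

/-- The restriction of a path to `ωᵢ × (0,T)`, as a function of space and time. -/
noncomputable def trace (q : P.Path) (i : Fin 2) : P.Follower i :=
  Classical.epsilon fun r => ∀ᵐ t ∂volume.restrict P.time,
    emb (P.ωF i) r t = restr (P.ωF i) (P.slice q t)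

/-- The feedback control `-(1/μᵢ) σ⁻² q` on `ωᵢ × (0,T)`. -/
noncomputable def feedback (μ : Fin 2 → ℝ) (σ : ℝ → ℝ) (q : P.Path) (i : Fin 2) : P.Follower i :=
  Classical.epsilon fun r => ∀ᵐ z ∂volume.restrict (P.ωF i ×ˢ P.time),
    r z = -(1 / μ i) * (σ z.2 ^ 2)⁻¹ * P.trace q i z

theorem volume_time_ne_top : volume P.time ≠ ∞ := by
  rw [time, Real.volume_Ioo]
  exact ENNReal.ofReal_ne_top

namespace Standing

variable {P} (hP : P.Standing)
include hP

theorem ω_meas : MeasurableSet P.ω := hP.ω_open.measurableSet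

theorem ωF_meas (i : Fin 2) : MeasurableSet (P.ωF i) := (hP.ωF_open i).measurableSet

theorem memLp_stateSource (f : P.Leader) (u : ∀ i, P.Follower i) :
    MemLp (P.stateSource f u) 2 (volume.restrict P.time) := by
  refine (memLp_emb hP.ω_meas hP.ω_subset (Lp.memLp f)).add ?_
  exact memLp_finsetSum _ fun i _ =>
    memLp_emb (hP.ωF_meas i) (hP.ωF_subset i) (Lp.memLp (u i))

theorem represents_stateSource (f : P.Leader) (u : ∀ i, P.Follower i) :
    P.Represents (P.stateSource f u) (fun x t => P.ω.indicator (fun ξ => f (ξ, t)) x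
      + ∑ i, (P.ωF i).indicator (fun ξ => u i (ξ, t)) x) := by
  have h : ∀ᵐ t ∂volume.restrict P.time, ∀ i, emb (P.ωF i) (u i) t
      =ᵐ[volume.restrict (Ioo 0 1)] (P.ωF i).indicator fun ξ => u i (ξ, t) :=
    ae_all_iff.2 fun i => emb_coeFn (hP.ωF_meas i) (hP.ωF_subset i) (Lp.memLp (u i))
  filter_upwards [emb_coeFn hP.ω_meas hP.ω_subset (Lp.memLp f), h] with t h1 h2
  simp only [stateSource, Fin.sum_univ_two]
  filter_upwards [h1, h2 0, h2 1, Lp.coeFn_add (emb P.ω f t)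
    (emb (P.ωF 0) (u 0) t + emb (P.ωF 1) (u 1) t),
    Lp.coeFn_add (emb (P.ωF 0) (u 0) t) (emb (P.ωF 1) (u 1) t)] with x a b c d e
  rw [d, Pi.add_apply, e, Pi.add_apply, a, b, c]

theorem memLp_adjSource (yd : ∀ i, P.Target i) (y : P.Path) (i : Fin 2) :
    MemLp (P.adjSource yd y i) 2 (volume.restrict P.time) := by
  have h1 : MemLp (fun t => restr (P.O i) (P.slice y t)) 2 (volume.restrict P.time) :=
    (restr (P.O i)).comp_memLp' (P.memLp_slice y)
  exact (h1.sub (memLp_emb (hP.O_meas i) (hP.O_subset i) (Lp.memLp (yd i)))).const_smul (P.α i)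

theorem deviation_coeFn (yd : ∀ i, P.Target i) (y : P.Path) (i : Fin 2) :
    ∀ᵐ t ∂volume.restrict P.time, restr (P.O i) (P.slice y t) - emb (P.O i) (yd i) t
      =ᵐ[volume.restrict (Ioo 0 1)]
        (P.O i).indicator fun ξ => P.slice y t ξ - yd i (ξ, t) := by
  filter_upwards [emb_coeFn (hP.O_meas i) (hP.O_subset i) (Lp.memLp (yd i))] with t h1
  filter_upwards [h1, restr_coeFn (hP.O_meas i) (P.slice y t),
    Lp.coeFn_sub (restr (P.O i) (P.slice y t)) (emb (P.O i) (yd i) t)] with x a b c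
  rw [c, Pi.sub_apply, a, b]
  by_cases hx : x ∈ P.O i <;> simp [hx]

theorem represents_adjSource (yd : ∀ i, P.Target i) (y : P.Path) (i : Fin 2) :
    P.Represents (P.adjSource yd y i)
      (fun x t => (P.O i).indicator (fun ξ => P.α i * (P.slice y t ξ - yd i (ξ, t))) x) := by
  filter_upwards [hP.deviation_coeFn yd y i] with t h1
  filter_upwards [h1, Lp.coeFn_smul (P.α i)
    (restr (P.O i) (P.slice y t) - emb (P.O i) (yd i) t)] with x a b
  rw [adjSource, b, Pi.smul_apply, a]
  by_cases hx : x ∈ P.O i <;> simp [hx]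

theorem existsUnique_state (y₀ : L2) (f : P.Leader) (u : ∀ i, P.Follower i) :
    ∃! y, P.IsState y₀ f u y :=
  hP.existsUnique_forward (hP.memLp_stateSource f u) (hP.represents_stateSource f u) y₀

theorem isState_state (y₀ : L2) (f : P.Leader) (u : ∀ i, P.Follower i) :
    P.IsState y₀ f u (P.state y₀ f u) := by
  have h := (hP.existsUnique_state y₀ f u).exists
  rw [state, dif_pos h]
  exact h.choose_spec

theorem isState_iff {y₀ : L2} {f : P.Leader} {u : ∀ i, P.Follower i} {y : P.Path} :
    P.IsState y₀ f u y ↔ y = P.state y₀ f u :=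
  ⟨fun h => (hP.existsUnique_state y₀ f u).unique h (hP.isState_state y₀ f u),
    fun h => h ▸ hP.isState_state y₀ f u⟩

theorem isAdjoint_adj (yd : ∀ i, P.Target i) (y : P.Path) (i : Fin 2) :
    P.IsAdjoint yd y i (P.adj yd y i) :=
  Classical.epsilon_spec (hP.existsUnique_backward (hP.memLp_adjSource yd y i)
    (hP.represents_adjSource yd y i)).exists

theorem isAdjoint_iff {yd : ∀ i, P.Target i} {y : P.Path} {i : Fin 2} {q : P.Path} :
    P.IsAdjoint yd y i q ↔ q = P.adj yd y i :=
  ⟨fun h => (hP.existsUnique_backward (hP.memLp_adjSource yd y i)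
    (hP.represents_adjSource yd y i)).unique h (hP.isAdjoint_adj yd y i),
    fun h => h ▸ hP.isAdjoint_adj yd y i⟩

theorem emb_trace (q : P.Path) (i : Fin 2) : ∀ᵐ t ∂volume.restrict P.time,
    emb (P.ωF i) (P.trace q i) t = restr (P.ωF i) (P.slice q t) :=
  Classical.epsilon_spec (exists_emb_eq (hP.ωF_meas i) (hP.ωF_subset i) P.volume_time_ne_top
    (P.memLp_slice q))

variable {μ : Fin 2 → ℝ} {σ : ℝ → ℝ}

omit hP in
theorem feedback_coeFn (hσ : Measurable σ) (hσ1 : ∀ t, 1 ≤ σ t) (q : P.Path) (i : Fin 2) :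
    ∀ᵐ z ∂volume.restrict (P.ωF i ×ˢ P.time),
      P.feedback μ σ q i z = -(1 / μ i) * (σ z.2 ^ 2)⁻¹ * P.trace q i z := by
  have hm : MemLp (fun z : ℝ × ℝ => -(1 / μ i) * (σ z.2 ^ 2)⁻¹ * P.trace q i z) 2
      (volume.restrict (P.ωF i ×ˢ P.time)) := by
    refine (Lp.memLp (P.trace q i)).of_le_mul (c := |1 / μ i|)
      (AEStronglyMeasurable.mul ?_ (Lp.aestronglyMeasurable _)) (Eventually.of_forall fun z => ?_)
    · exact Measurable.aestronglyMeasurable (by fun_prop)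
    · have h1 : (σ z.2 ^ 2)⁻¹ ≤ 1 := inv_le_one_of_one_le₀ (one_le_pow₀ (hσ1 z.2))
      have h2 : 0 ≤ (σ z.2 ^ 2)⁻¹ := inv_nonneg.2 (sq_nonneg _)
      rw [norm_mul, norm_mul, norm_neg, Real.norm_eq_abs, Real.norm_of_nonneg h2]
      exact mul_le_mul_of_nonneg_right (mul_le_of_le_one_right (abs_nonneg _) h1) (norm_nonneg _)
  exact Classical.epsilon_spec (p := fun r : P.Follower i =>
    ∀ᵐ z ∂volume.restrict (P.ωF i ×ˢ P.time),
      r z = -(1 / μ i) * (σ z.2 ^ 2)⁻¹ * P.trace q i z) ⟨hm.toLp, hm.coeFn_toLp⟩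

theorem emb_feedback (hσ : Measurable σ) (hσ1 : ∀ t, 1 ≤ σ t) (q : P.Path) (i : Fin 2) :
    ∀ᵐ t ∂volume.restrict P.time, emb (P.ωF i) (P.feedback μ σ q i) t
      = (-(1 / μ i) * (σ t ^ 2)⁻¹) • restr (P.ωF i) (P.slice q t) := by
  have h1 := ae_slices (feedback_coeFn (μ := μ) hσ hσ1 q i)
  have h2 := ae_of_emb_eq (hP.ωF_meas i) (hP.ωF_subset i) (Lp.memLp (P.trace q i))
    (hP.emb_trace q i)
  have h3 := emb_eq_of_ae (hP.ωF_meas i) (hP.ωF_subset i) (Lp.memLp (P.feedback μ σ q i))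
    (f := fun t => (-(1 / μ i) * (σ t ^ 2)⁻¹) • P.slice q t) (by
      filter_upwards [h1, h2] with t a b
      filter_upwards [a, b, ae_mono (Measure.restrict_mono (hP.ωF_subset i) le_rfl)
        (Lp.coeFn_smul (-(1 / μ i) * (σ t ^ 2)⁻¹) (P.slice q t))] with x a b c
      rw [a, b, c, Pi.smul_apply, smul_eq_mul])
  filter_upwards [h3] with t ht
  rw [ht, map_smul]

theorem eq_feedback_iff (hσ : Measurable σ) (hσ1 : ∀ t, 1 ≤ σ t) (q : P.Path) (i : Fin 2)
    (u : P.Follower i) : u = P.feedback μ σ q i ↔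
      ∀ᵐ t ∂volume.restrict P.time, ∀ᵐ x ∂volume.restrict (P.ωF i),
        u (x, t) = -(1 / μ i) * (σ t ^ 2)⁻¹ * P.slice q t x := by
  have hsm : ∀ t : ℝ, ∀ᵐ x ∂volume.restrict (P.ωF i),
      ((-(1 / μ i) * (σ t ^ 2)⁻¹) • P.slice q t : L2) x
        = -(1 / μ i) * (σ t ^ 2)⁻¹ * P.slice q t x := fun t =>
    ae_mono (Measure.restrict_mono (hP.ωF_subset i) le_rfl)
      (Lp.coeFn_smul (-(1 / μ i) * (σ t ^ 2)⁻¹) (P.slice q t))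
  have hfb := hP.emb_feedback (μ := μ) hσ hσ1 q i
  constructor
  · rintro rfl
    have := ae_of_emb_eq (hP.ωF_meas i) (hP.ωF_subset i) (Lp.memLp (P.feedback μ σ q i))
      (f := fun t => (-(1 / μ i) * (σ t ^ 2)⁻¹) • P.slice q t) (by
        filter_upwards [hfb] with t ht
        rw [ht, map_smul])
    filter_upwards [this] with t ht
    filter_upwards [ht, hsm t] with x a b
    rw [a, b]
  · intro h
    refine eq_of_emb_eq (hP.ωF_meas i) (hP.ωF_subset i) ?_
    have := emb_eq_of_ae (hP.ωF_meas i) (hP.ωF_subset i) (Lp.memLp u)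
      (f := fun t => (-(1 / μ i) * (σ t ^ 2)⁻¹) • P.slice q t) (by
        filter_upwards [h] with t ht
        filter_upwards [ht, hsm t] with x a b
        rw [a, b])
    filter_upwards [this, hfb] with t a b
    rw [a, b, map_smul]

theorem isFeedback_iff (hσ : Measurable σ) (hσ1 : ∀ t, 1 ≤ σ t) {u : ∀ i, P.Follower i}
    {q : Fin 2 → P.Path} :
    P.IsFeedback μ σ u q ↔ u = fun i => P.feedback μ σ (q i) i := by
  rw [funext_iff]
  exact forall_congr' fun i => (hP.eq_feedback_iff hσ hσ1 (q i) i (u i)).symm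

theorem isOptimalitySol_iff (hσ : Measurable σ) (hσ1 : ∀ t, 1 ≤ σ t) {y₀ : L2}
    {yd : ∀ i, P.Target i} {f : P.Leader} {y : P.Path} {q : Fin 2 → P.Path} :
    P.IsOptimalitySol μ σ y₀ yd f y q ↔
      y = P.state y₀ f (fun i => P.feedback μ σ (q i) i) ∧ q = P.adj yd y := by
  rw [funext_iff, ← hP.isState_iff]
  refine and_congr ?_ (forall_congr' fun i => hP.isAdjoint_iff)
  set u : ∀ i, P.Follower i := fun i => P.feedback μ σ (q i) i
  have h : P.Represents (P.stateSource f u) (fun x t => P.ω.indicator (fun ξ => f (ξ, t)) x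
      - ∑ i, (P.ωF i).indicator
          (fun ξ => 1 / μ i * (σ t ^ 2)⁻¹ * P.slice (q i) t ξ) x) := by
    have hu := ae_all_iff.2 fun i => (hP.eq_feedback_iff (μ := μ) hσ hσ1 (q i) i (u i)).1 rfl
    filter_upwards [hP.represents_stateSource f u, hu] with t h1 h2
    have h3 : ∀ᵐ x ∂volume.restrict (Ioo (0 : ℝ) 1), ∀ i, x ∈ P.ωF i →
        u i (x, t) = -(1 / μ i) * (σ t ^ 2)⁻¹ * P.slice (q i) t x :=
      ae_all_iff.2 fun i => ae_restrict_of_ae ((ae_restrict_iff' (hP.ωF_meas i)).1 (h2 i))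
    filter_upwards [h1, h3] with x a b
    rw [a, sub_eq_add_neg, ← Finset.sum_neg_distrib]
    congr 1
    refine Finset.sum_congr rfl fun i _ => ?_
    by_cases hx : x ∈ P.ωF i
    · simp only [indicator_of_mem hx, b i hx]; ring
    · simp [hx]
  rw [IsState, hP.isForwardSol_iff h, hP.isForwardSol_iff (hP.represents_stateSource f u)]

end Standing

end Data

end StackelbergNash

namespace StackelbergNash

/-! ### Nash equilibria as fixed points -/

namespace Data

variable (P : Data)

/-- The constant of the energy estimate for the state and the adjoint equations. -/
noncomputable def energyConst : ℝ := P.T * Real.exp ((1 + 2 * P.cBound) * P.T)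

variable {P} in
theorem integral_time_eq (hT : 0 ≤ P.T) {E : Type*} [NormedAddCommGroup E] [NormedSpace ℝ E]
    (g : ℝ → E) : ∫ t in P.time, g t = ∫ t in (0 : ℝ)..P.T, g t := by
  rw [intervalIntegral.integral_of_le hT, integral_Ioc_eq_integral_Ioo, time]

/-- The feedback controls of the adjoint states that belong to the state of `u`. The fixed points
of this map are the equilibria. -/
noncomputable def response (μ : Fin 2 → ℝ) (σ : ℝ → ℝ) (y₀ : L2) (yd : ∀ i, P.Target i)
    (f : P.Leader) (u : ∀ i, P.Follower i) (i : Fin 2) : P.Follower i :=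
  P.feedback μ σ (P.adj yd (P.state y₀ f u) i) i

/-- The tracking part of the cost `Jᵢ`, which is always finite. -/
noncomputable def tracking (y₀ : L2) (yd : ∀ i, P.Target i)
    (f : P.Leader) (i : Fin 2) (u : ∀ i, P.Follower i) : ℝ :=
  P.α i / 2 * ∫ t in P.time,
    ‖restr (P.O i) (P.slice (P.state y₀ f u) t) - emb (P.O i) (yd i) t‖ ^ 2

namespace Standing

variable {P} (hP : P.Standing)
include hP

theorem energyConst_nonneg : 0 ≤ P.energyConst := mul_nonneg hP.T_pos.le (Real.exp_pos _).le

theorem integral_norm_sq_le {B : ℝ → L2 →L[ℝ] L2} (hB : IsPotential B P.cBound P.T)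
    {F y p : ℝ → L2} (hF : MemLp F 2 (volume.restrict P.time))
    (h : IsWeakSol P.graph B P.T F 0 y p) :
    ∫ t in P.time, ‖y t‖ ^ 2 ≤ P.energyConst * ∫ t in P.time, ‖F t‖ ^ 2 := by
  have hT := hP.T_pos.le
  rw [integral_time_eq hT, integral_time_eq hT]
  have hle : ∀ t ∈ Icc 0 P.T, ‖y t‖ ^ 2
      ≤ (∫ t in (0 : ℝ)..P.T, ‖F t‖ ^ 2) * Real.exp ((1 + 2 * P.cBound) * P.T) := fun t ht => by
    have := h.norm_sq_le P.isClosed_graph hP.dense_graph hB hF ht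
    simpa using this
  have := intervalIntegral.integral_mono_on hT
    (intervalIntegrable_norm_sq_of_memLp hT (memLp_of_continuousOn_Icc h.cont))
    intervalIntegrable_const hle
  refine this.trans (le_of_eq ?_)
  rw [intervalIntegral.integral_const, sub_zero, smul_eq_mul, energyConst]
  ring

variable {y₀ : L2} {f : P.Leader} {yd : ∀ i, P.Target i}

theorem exists_isWeakSol_state_sub (u u' : ∀ i, P.Follower i) :
    ∃ p, IsWeakSol P.graph P.pot P.T (fun t => P.stateSource f u t - P.stateSource f u' t) 0
      (fun t => P.slice (P.state y₀ f u) t - P.slice (P.state y₀ f u') t) p := by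
  obtain ⟨p, h⟩ := (hP.isForwardSol_iff (hP.represents_stateSource f u)).1
    (hP.isState_state y₀ f u)
  obtain ⟨p', h'⟩ := (hP.isForwardSol_iff (hP.represents_stateSource f u')).1
    (hP.isState_state y₀ f u')
  have := h.sub hP.isPotential hP.T_pos.le (hP.memLp_stateSource f u)
    (hP.memLp_stateSource f u') h'
  rw [sub_self] at this
  exact ⟨_, this⟩

theorem integral_norm_state_sub_sq_le (u u' : ∀ i, P.Follower i) :
    ∫ t in P.time, ‖P.slice (P.state y₀ f u) t - P.slice (P.state y₀ f u') t‖ ^ 2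
      ≤ P.energyConst * ∫ t in P.time, ‖P.stateSource f u t - P.stateSource f u' t‖ ^ 2 := by
  obtain ⟨p, h⟩ := hP.exists_isWeakSol_state_sub (y₀ := y₀) (f := f) u u'
  exact hP.integral_norm_sq_le hP.isPotential
    ((hP.memLp_stateSource f u).sub (hP.memLp_stateSource f u')) h

theorem integral_reverse_time (g : ℝ → ℝ) :
    ∫ t in P.time, g (P.T - t) = ∫ t in P.time, g t := by
  rw [integral_time_eq hP.T_pos.le, integral_time_eq hP.T_pos.le, integral_reverse, sub_self]

theorem integral_norm_adj_sub_sq_le (y y' : P.Path) (i : Fin 2) :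
    ∫ t in P.time, ‖P.slice (P.adj yd y i) t - P.slice (P.adj yd y' i) t‖ ^ 2
      ≤ P.energyConst * P.α i ^ 2 * ∫ t in P.time, ‖P.slice y t - P.slice y' t‖ ^ 2 := by
  obtain ⟨r, h⟩ := (hP.isBackwardSol_iff (hP.represents_adjSource yd y i)).1
    (hP.isAdjoint_adj yd y i)
  obtain ⟨r', h'⟩ := (hP.isBackwardSol_iff (hP.represents_adjSource yd y' i)).1
    (hP.isAdjoint_adj yd y' i)
  have hK := (hP.memLp_adjSource yd y i).comp_measurePreserving (measurePreserving_reverse P.T)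
  have hK' := (hP.memLp_adjSource yd y' i).comp_measurePreserving (measurePreserving_reverse P.T)
  have h2 := h.sub hP.isPotential.reverse hP.T_pos.le hK hK' h'
  rw [sub_self] at h2
  have h3 : ∫ t in P.time, ‖P.slice (P.adj yd y i) (P.T - t)
        - P.slice (P.adj yd y' i) (P.T - t)‖ ^ 2 ≤ P.energyConst * ∫ t in P.time,
          ‖P.adjSource yd y i (P.T - t) - P.adjSource yd y' i (P.T - t)‖ ^ 2 :=
    hP.integral_norm_sq_le hP.isPotential.reverse (hK.sub hK') h2
  rw [hP.integral_reverse_time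
      (fun t => ‖P.slice (P.adj yd y i) t - P.slice (P.adj yd y' i) t‖ ^ 2),
    hP.integral_reverse_time (fun t => ‖P.adjSource yd y i t - P.adjSource yd y' i t‖ ^ 2)] at h3
  refine h3.trans ?_
  rw [mul_assoc]
  refine mul_le_mul_of_nonneg_left ?_ hP.energyConst_nonneg
  rw [← integral_const_mul]
  have hy := ((P.memLp_slice y).sub (P.memLp_slice y')).integrable_norm_pow two_ne_zero
  refine integral_mono_of_nonneg (Eventually.of_forall fun _ => sq_nonneg _)
    (hy.const_mul _) (Eventually.of_forall fun t => ?_)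
  have e : P.adjSource yd y i t - P.adjSource yd y' i t
      = P.α i • restr (P.O i) (P.slice y t - P.slice y' t) := by
    rw [adjSource, adjSource, ← smul_sub, sub_sub_sub_cancel_right, map_sub]
  simp only [e, norm_smul, mul_pow, Real.norm_eq_abs, sq_abs]
  exact mul_le_mul_of_nonneg_left
    (pow_le_pow_left₀ (norm_nonneg _) (norm_restr_le _) 2) (sq_nonneg _)

theorem integral_norm_source_sub_sq_le (u u' : ∀ i, P.Follower i) :
    ∫ t in P.time, ‖P.stateSource f u t - P.stateSource f u' t‖ ^ 2 ≤ 4 * ‖u - u'‖ ^ 2 := by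
  have hsub := ae_all_iff.2 fun i =>
    emb_sub (S := P.time) (hP.ωF_meas i) (hP.ωF_subset i) (u i) (u' i)
  have hint : ∀ i, Integrable (fun t => ‖emb (P.ωF i) (u i - u' i : P.Follower i) t‖ ^ 2)
      (volume.restrict P.time) := fun i =>
    (memLp_emb (hP.ωF_meas i) (hP.ωF_subset i) (Lp.memLp (u i - u' i))).integrable_norm_pow
      two_ne_zero
  have hle : ∀ i, ∫ t in P.time, ‖emb (P.ωF i) (u i - u' i : P.Follower i) t‖ ^ 2
      ≤ ‖u - u'‖ ^ 2 := fun i => by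
    rw [integral_norm_emb_sq_eq (hP.ωF_meas i) (hP.ωF_subset i)]
    exact pow_le_pow_left₀ (norm_nonneg _) (norm_le_pi_norm (u - u') i) 2
  calc ∫ t in P.time, ‖P.stateSource f u t - P.stateSource f u' t‖ ^ 2
      ≤ ∫ t in P.time, (2 * ‖emb (P.ωF 0) (u 0 - u' 0 : P.Follower 0) t‖ ^ 2
        + 2 * ‖emb (P.ωF 1) (u 1 - u' 1 : P.Follower 1) t‖ ^ 2) := by
        refine integral_mono_of_nonneg (Eventually.of_forall fun _ => sq_nonneg _)
          (((hint 0).const_mul 2).add ((hint 1).const_mul 2)) ?_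
        filter_upwards [hsub] with t ht
        have e : P.stateSource f u t - P.stateSource f u' t
            = emb (P.ωF 0) (u 0 - u' 0 : P.Follower 0) t
              + emb (P.ωF 1) (u 1 - u' 1 : P.Follower 1) t := by
          rw [ht 0, ht 1, stateSource, stateSource, Fin.sum_univ_two, Fin.sum_univ_two]
          abel
        rw [e]
        have h1 := norm_add_le (emb (P.ωF 0) (u 0 - u' 0 : P.Follower 0) t)
          (emb (P.ωF 1) (u 1 - u' 1 : P.Follower 1) t)
        have h2 := pow_le_pow_left₀ (norm_nonneg _) h1 2
        nlinarith [sq_nonneg (‖emb (P.ωF 0) (u 0 - u' 0 : P.Follower 0) t‖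
          - ‖emb (P.ωF 1) (u 1 - u' 1 : P.Follower 1) t‖)]
    _ = 2 * (∫ t in P.time, ‖emb (P.ωF 0) (u 0 - u' 0 : P.Follower 0) t‖ ^ 2)
        + 2 * ∫ t in P.time, ‖emb (P.ωF 1) (u 1 - u' 1 : P.Follower 1) t‖ ^ 2 := by
        rw [integral_add ((hint 0).const_mul 2) ((hint 1).const_mul 2), integral_const_mul,
          integral_const_mul]
    _ ≤ 4 * ‖u - u'‖ ^ 2 := by linarith [hle 0, hle 1]

variable {μ : Fin 2 → ℝ} {σ : ℝ → ℝ}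

theorem norm_feedback_sub_sq_le (hσ : Measurable σ) (hσ1 : ∀ t, 1 ≤ σ t) (q q' : P.Path)
    (i : Fin 2) : ‖P.feedback μ σ q i - P.feedback μ σ q' i‖ ^ 2
      ≤ (1 / μ i) ^ 2 * ∫ t in P.time, ‖P.slice q t - P.slice q' t‖ ^ 2 := by
  rw [← integral_norm_emb_sq_eq (hP.ωF_meas i) (hP.ωF_subset i), ← integral_const_mul]
  have hq := ((P.memLp_slice q).sub (P.memLp_slice q')).integrable_norm_pow two_ne_zero
  refine integral_mono_of_nonneg (Eventually.of_forall fun _ => sq_nonneg _) (hq.const_mul _) ?_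
  filter_upwards [hP.emb_feedback (μ := μ) hσ hσ1 q i, hP.emb_feedback (μ := μ) hσ hσ1 q' i,
    emb_sub (hP.ωF_meas i) (hP.ωF_subset i) (P.feedback μ σ q i) (P.feedback μ σ q' i)]
    with t a b c
  have h1 : (σ t ^ 2)⁻¹ ^ 2 ≤ 1 :=
    pow_le_one₀ (inv_nonneg.2 (sq_nonneg _)) (inv_le_one_of_one_le₀ (one_le_pow₀ (hσ1 t)))
  simp only [c, a, b, ← smul_sub, ← map_sub, norm_smul, mul_pow, Real.norm_eq_abs, sq_abs,
    neg_sq]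
  refine mul_le_mul ?_ (pow_le_pow_left₀ (norm_nonneg _) (norm_restr_le _) 2) (sq_nonneg _)
    (sq_nonneg _)
  exact mul_le_of_le_one_right (sq_nonneg _) h1

/-- For large `μ` the response map is a contraction. The constant does not depend on `σ`, as
`σ⁻² ≤ 1`. -/
theorem norm_response_sub_le (hσ : Measurable σ) (hσ1 : ∀ t, 1 ≤ σ t)
    (hμ : ∀ i, 1 + 4 * P.energyConst * ∑ j, P.α j ≤ μ i) (u u' : ∀ i, P.Follower i) :
    ‖P.response μ σ y₀ yd f u - P.response μ σ y₀ yd f u'‖ ≤ 1 / 2 * ‖u - u'‖ := by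
  have hC := hP.energyConst_nonneg
  refine (pi_norm_le_iff_of_nonneg (by positivity)).2 fun i => ?_
  refine (sq_le_sq₀ (norm_nonneg _) (by positivity)).1 ?_
  have h1 := hP.norm_feedback_sub_sq_le (μ := μ) hσ hσ1 (P.adj yd (P.state y₀ f u) i)
    (P.adj yd (P.state y₀ f u') i) i
  have h2 := hP.integral_norm_adj_sub_sq_le (yd := yd) (P.state y₀ f u) (P.state y₀ f u') i
  have h3 := hP.integral_norm_state_sub_sq_le (y₀ := y₀) (f := f) u u'
  have h4 := hP.integral_norm_source_sub_sq_le (f := f) u u'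
  have hα : P.α i ≤ ∑ j, P.α j :=
    Finset.single_le_sum (fun j _ => (hP.α_pos j).le) (Finset.mem_univ i)
  have hαi := (hP.α_pos i).le
  have hμi : 4 * P.energyConst * P.α i ≤ μ i := by
    have := mul_le_mul_of_nonneg_left hα (mul_nonneg zero_le_four hC)
    linarith [hμ i]
  have hμ0 : 0 < μ i := by
    have : 0 ≤ 4 * P.energyConst * ∑ j, P.α j :=
      mul_nonneg (by positivity) (hαi.trans hα)
    linarith [hμ i]
  have h5 : 2 * P.energyConst * P.α i / μ i ≤ 1 / 2 := by
    rw [div_le_iff₀ hμ0]; linarith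
  have h5' : 0 ≤ 2 * P.energyConst * P.α i / μ i := by positivity
  calc ‖P.response μ σ y₀ yd f u i - P.response μ σ y₀ yd f u' i‖ ^ 2
      ≤ (1 / μ i) ^ 2 * (P.energyConst * P.α i ^ 2 * (P.energyConst * (4 * ‖u - u'‖ ^ 2))) := by
        refine h1.trans (mul_le_mul_of_nonneg_left ?_ (sq_nonneg _))
        refine h2.trans (mul_le_mul_of_nonneg_left ?_ (by positivity))
        exact h3.trans (mul_le_mul_of_nonneg_left h4 hC)
    _ = (2 * P.energyConst * P.α i / μ i) ^ 2 * ‖u - u'‖ ^ 2 := by ring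
    _ ≤ (1 / 2) ^ 2 * ‖u - u'‖ ^ 2 :=
        mul_le_mul_of_nonneg_right (pow_le_pow_left₀ h5' h5 2) (sq_nonneg _)
    _ = (1 / 2 * ‖u - u'‖) ^ 2 := by ring

theorem existsUnique_response_eq (hσ : Measurable σ) (hσ1 : ∀ t, 1 ≤ σ t)
    (hμ : ∀ i, 1 + 4 * P.energyConst * ∑ j, P.α j ≤ μ i) :
    ∃! u, P.response μ σ y₀ yd f u = u := by
  have hc : ContractingWith (1 / 2) (P.response μ σ y₀ yd f) := by
    refine ⟨by norm_num, LipschitzWith.of_dist_le_mul fun u u' => ?_⟩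
    rw [dist_eq_norm, dist_eq_norm]
    simpa using hP.norm_response_sub_le hσ hσ1 hμ u u'
  exact ⟨hc.fixedPoint, hc.fixedPoint_isFixedPt, fun u hu => hc.fixedPoint_unique hu⟩

/-! ### The first variation of the costs -/

theorem memLp_deviation (y : P.Path) (i : Fin 2) :
    MemLp (fun t => restr (P.O i) (P.slice y t) - emb (P.O i) (yd i) t) 2
      (volume.restrict P.time) := by
  have h1 : MemLp (fun t => restr (P.O i) (P.slice y t)) 2 (volume.restrict P.time) :=
    (restr (P.O i)).comp_memLp' (P.memLp_slice y)
  exact h1.sub (memLp_emb (hP.O_meas i) (hP.O_subset i) (Lp.memLp (yd i)))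

theorem tracking_nonneg (i : Fin 2) (u : ∀ i, P.Follower i) : 0 ≤ P.tracking y₀ yd f i u :=
  mul_nonneg (half_pos (hP.α_pos i)).le (integral_nonneg fun _ => sq_nonneg _)

theorem J_eq (i : Fin 2) (u : ∀ i, P.Follower i) :
    P.J μ σ y₀ yd i f u = ENNReal.ofReal (P.tracking y₀ yd f i u)
      + ENNReal.ofReal (μ i / 2) *
        ∫⁻ z in P.ωF i ×ˢ P.time, ENNReal.ofReal (σ z.2 ^ 2 * u i z ^ 2) := by
  rw [J, tracking, ENNReal.ofReal_mul (half_pos (hP.α_pos i)).le,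
    ofReal_integral_eq_lintegral_ofReal ((hP.memLp_deviation _ i).integrable_norm_pow two_ne_zero)
      (Eventually.of_forall fun _ => sq_nonneg _)]
  congr 2
  refine lintegral_congr_ae ?_
  filter_upwards [hP.deviation_coeFn yd (P.state y₀ f u) i] with t ht
  rw [ofReal_norm_sq]
  have e : (fun x => ENNReal.ofReal ((P.O i).indicator
      (fun ξ => P.slice (P.state y₀ f u) t ξ - yd i (ξ, t)) x ^ 2)) = (P.O i).indicator fun x =>
        ENNReal.ofReal ((P.slice (P.state y₀ f u) t x - yd i (x, t)) ^ 2) := by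
    funext x
    by_cases hx : x ∈ P.O i <;> simp [hx]
  have e2 : ∫⁻ x in Ioo (0 : ℝ) 1, ENNReal.ofReal
      ((restr (P.O i) (P.slice (P.state y₀ f u) t) - emb (P.O i) (yd i) t : L2) x ^ 2)
      = ∫⁻ x in Ioo (0 : ℝ) 1, (P.O i).indicator (fun x =>
        ENNReal.ofReal ((P.slice (P.state y₀ f u) t x - yd i (x, t)) ^ 2)) x := by
    rw [← e]
    refine lintegral_congr_ae ?_
    filter_upwards [ht] with x hx
    rw [hx]
  rw [e2, setLIntegral_indicator (hP.O_meas i), inter_eq_left.2 (hP.O_subset i)]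

theorem stateSource_update_sub (u : ∀ i, P.Follower i) (i : Fin 2) (v : P.Follower i) :
    ∀ᵐ t ∂volume.restrict P.time,
      P.stateSource f (Function.update u i (u i + v)) t - P.stateSource f u t
        = emb (P.ωF i) v t := by
  filter_upwards [emb_sub (hP.ωF_meas i) (hP.ωF_subset i) (u i + v) (u i)] with t ht
  rw [add_sub_cancel_left] at ht
  rw [stateSource, stateSource, add_sub_add_left_eq_sub, ← Finset.sum_sub_distrib,
    Finset.sum_eq_single i, Function.update_self, ht]
  · intro j _ hj
    rw [Function.update_of_ne hj, sub_self]
  · simp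

/-- The adjoint state represents the derivative of the tracking part of the cost. -/
theorem tracking_update (u : ∀ i, P.Follower i) (i : Fin 2) (v : P.Follower i) :
    P.tracking y₀ yd f i (Function.update u i (u i + v)) = P.tracking y₀ yd f i u
      + (∫ z in P.ωF i ×ˢ P.time, P.trace (P.adj yd (P.state y₀ f u) i) i z * v z)
      + P.α i / 2 * ∫ t in P.time, ‖restr (P.O i)
          (P.slice (P.state y₀ f (Function.update u i (u i + v))) t
            - P.slice (P.state y₀ f u) t)‖ ^ 2 := by
  set u' := Function.update u i (u i + v) with hu'
  set y := P.state y₀ f u with hy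
  set y' := P.state y₀ f u' with hy'
  set q := P.adj yd y i with hq
  set e : ℝ → L2 := fun t => restr (P.O i) (P.slice y t) - emb (P.O i) (yd i) t with he
  set d : ℝ → L2 := fun t => P.slice y' t - P.slice y t with hd
  have heL : MemLp e 2 (volume.restrict P.time) := hP.memLp_deviation y i
  have hdL : MemLp (fun t => restr (P.O i) (d t)) 2 (volume.restrict P.time) :=
    (restr (P.O i)).comp_memLp' ((P.memLp_slice y').sub (P.memLp_slice y))
  have hinner : Integrable (fun t => (inner ℝ (e t) (restr (P.O i) (d t)) : ℝ))
      (volume.restrict P.time) := by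
    refine (L2.integrable_inner (𝕜 := ℝ) heL.toLp hdL.toLp).congr ?_
    filter_upwards [heL.coeFn_toLp, hdL.coeFn_toLp] with t a b
    rw [a, b]
  obtain ⟨p, hfw⟩ := hP.exists_isWeakSol_state_sub (y₀ := y₀) (f := f) u' u
  obtain ⟨r, hbw⟩ := (hP.isBackwardSol_iff (hP.represents_adjSource yd y i)).1
    (hP.isAdjoint_adj yd y i)
  have hdual : ∫ τ in (0 : ℝ)..P.T, inner ℝ (P.stateSource f u' τ - P.stateSource f u τ)
        (P.slice q (P.T - (P.T - τ)))
      = ∫ τ in (0 : ℝ)..P.T, (inner ℝ (P.slice y' τ - P.slice y τ) (P.adjSource yd y i τ) : ℝ) :=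
    hfw.duality P.isClosed_graph hP.dense_graph hP.T_pos.le hP.isPotential
      ((hP.memLp_stateSource f u').sub (hP.memLp_stateSource f u))
      ((hP.memLp_adjSource yd y i).comp_measurePreserving (measurePreserving_reverse P.T)) hbw
  rw [← integral_time_eq hP.T_pos.le, ← integral_time_eq hP.T_pos.le] at hdual
  have hder : P.α i * ∫ t in P.time, inner ℝ (e t) (restr (P.O i) (d t))
      = ∫ z in P.ωF i ×ˢ P.time, P.trace q i z * v z := by
    rw [← integral_inner_emb (hP.ωF_meas i) (hP.ωF_subset i), ← integral_const_mul]
    have h1 : ∫ t in P.time, P.α i * (inner ℝ (e t) (restr (P.O i) (d t)) : ℝ)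
        = ∫ t in P.time, (inner ℝ (P.slice y' t - P.slice y t) (P.adjSource yd y i t) : ℝ) := by
      refine integral_congr_ae ?_
      filter_upwards [restr_emb (hP.O_meas i) (hP.O_subset i) (Lp.memLp (yd i))] with t ht
      rw [← restr_symm, adjSource, real_inner_smul_right, real_inner_comm, he, hd]
      simp only [map_sub, restr_restr (hP.O_meas i), ht]
    rw [h1, ← hdual]
    refine integral_congr_ae ?_
    have hsrc : ∀ᵐ t ∂volume.restrict P.time,
        P.stateSource f u' t - P.stateSource f u t = emb (P.ωF i) v t :=
      hP.stateSource_update_sub u i v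
    filter_upwards [hsrc, hP.emb_trace q i,
      restr_emb (hP.ωF_meas i) (hP.ωF_subset i) (Lp.memLp v)] with t a b c
    rw [a, b, sub_sub_cancel, restr_symm, c, real_inner_comm]
  have hexp : ∫ t in P.time, ‖restr (P.O i) (P.slice y' t) - emb (P.O i) (yd i) t‖ ^ 2
      = (∫ t in P.time, ‖e t‖ ^ 2)
        + 2 * (∫ t in P.time, inner ℝ (e t) (restr (P.O i) (d t)))
        + ∫ t in P.time, ‖restr (P.O i) (d t)‖ ^ 2 := by
    have i1 := heL.integrable_norm_pow two_ne_zero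
    have i2 := hdL.integrable_norm_pow two_ne_zero
    have i12 : Integrable (fun t => ‖e t‖ ^ 2 + 2 * (inner ℝ (e t) (restr (P.O i) (d t)) : ℝ))
        (volume.restrict P.time) := i1.add (hinner.const_mul 2)
    rw [← integral_const_mul, ← integral_add i1 (hinner.const_mul 2), ← integral_add i12 i2]
    refine integral_congr_ae (Eventually.of_forall fun t => ?_)
    have : restr (P.O i) (P.slice y' t) - emb (P.O i) (yd i) t = e t + restr (P.O i) (d t) := by
      simp only [he, hd, map_sub]; abel
    simp only [this]
    exact norm_add_sq_real _ _
  rw [tracking, tracking, ← hy, ← hy', hexp, ← hder]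
  ring

/-- The cost of the `i`-th follower has the form treated in `isMin_weighted_iff`. -/
theorem isNash_iff (hσ : Measurable σ) (hσ1 : ∀ t, 1 ≤ σ t) (hμ : ∀ i, 0 < μ i)
    (u : ∀ i, P.Follower i) :
    P.IsNash μ σ y₀ yd f u ↔ P.response μ σ y₀ yd f u = u := by
  rw [IsNash, funext_iff]
  refine forall_congr' fun i => ?_
  set q := P.adj yd (P.state y₀ f u) i with hq
  set N : P.Follower i → ℝ := fun v =>
    P.tracking y₀ yd f i (Function.update u i (u i + v)) with hN
  have hN0 : N 0 = P.tracking y₀ yd f i u := by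
    rw [hN]; simp
  have hquad : ∀ v : P.Follower i, ∫ t in P.time, ‖restr (P.O i)
      (P.slice (P.state y₀ f (Function.update u i (u i + v))) t
        - P.slice (P.state y₀ f u) t)‖ ^ 2 ≤ P.energyConst * ‖v‖ ^ 2 := by
    intro v
    have hdL := ((P.memLp_slice (P.state y₀ f (Function.update u i (u i + v)))).sub
      (P.memLp_slice (P.state y₀ f u))).integrable_norm_pow two_ne_zero
    calc _ ≤ ∫ t in P.time, ‖P.slice (P.state y₀ f (Function.update u i (u i + v))) t
        - P.slice (P.state y₀ f u) t‖ ^ 2 :=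
          integral_mono_of_nonneg (Eventually.of_forall fun _ => sq_nonneg _) hdL
            (Eventually.of_forall fun t => pow_le_pow_left₀ (norm_nonneg _) (norm_restr_le _) 2)
      _ ≤ _ := hP.integral_norm_state_sub_sq_le _ _
      _ = _ := by
          rw [← integral_norm_emb_sq_eq (hP.ωF_meas i) (hP.ωF_subset i) v]
          congr 1
          refine integral_congr_ae ?_
          filter_upwards [hP.stateSource_update_sub (f := f) u i v] with t ht
          rw [ht]
  have hα := half_pos (hP.α_pos i)
  have hmain := isMin_weighted_iff (m := volume.restrict (P.ωF i ×ˢ P.time))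
    (ρ := fun z : ℝ × ℝ => σ z.2) (hσ.comp measurable_snd).aestronglyMeasurable
    (fun z => hσ1 z.2) (hμ i) (C := P.α i / 2 * P.energyConst) (N := N) (r := P.trace q i)
    (fun v => hP.tracking_nonneg i _)
    (fun v => by
      rw [hN0, hN]
      simp only
      rw [hP.tracking_update]
      exact le_add_of_nonneg_right
        (mul_nonneg hα.le (integral_nonneg fun _ => sq_nonneg _)))
    (fun v => by
      rw [hN0, hN]
      simp only
      rw [hP.tracking_update, mul_assoc]
      gcongr
      exact hquad v) (u i)
  have hfb : P.response μ σ y₀ yd f u i = u i ↔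
      ∀ᵐ z ∂volume.restrict (P.ωF i ×ˢ P.time),
        u i z = -(1 / μ i) * (σ z.2 ^ 2)⁻¹ * P.trace q i z := by
    have h := feedback_coeFn (μ := μ) hσ hσ1 q i
    constructor
    · intro h1
      rw [← h1]
      exact h
    · intro h1
      refine Lp.ext ?_
      filter_upwards [h, h1] with z a b
      exact a.trans b.symm
  rw [hfb, ← hmain]
  have hJ : ∀ v : P.Follower i, P.J μ σ y₀ yd i f (Function.update u i (u i + v))
      = ENNReal.ofReal (N v) + ENNReal.ofReal (μ i / 2) *
        ∫⁻ z in P.ωF i ×ˢ P.time, ENNReal.ofReal (σ z.2 ^ 2 * (u i + v) z ^ 2) := fun v => by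
    rw [hP.J_eq, Function.update_self]
  constructor
  · intro h v
    rw [← hJ, hN0, ← hP.J_eq]
    exact h _
  · intro h v
    have := h (v - u i)
    rwa [← hJ, hN0, ← hP.J_eq, add_sub_cancel] at this

end Standing

end Data

end StackelbergNash

/-! ### Existence, uniqueness and characterization of the equilibrium -/

theorem proposition3p1 (P : StackelbergNash.Data) (hP : P.Standing) :
    ∃ M : ℝ, 0 < M ∧ ∀ μ : Fin 2 → ℝ, (∀ i, M ≤ μ i) →
      ∀ ϑ : ℝ → ℝ, (ϑ = P.θ ∨ ϑ = P.η) →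
      ∀ c₁ c₂ s : ℝ, 0 < c₁ →
        max ((1 - P.x₀) ^ 2 / (P.a 1 * (2 - P.K))) (P.x₀ ^ 2 / (P.a 0 * (2 - P.K))) < c₂ →
        0 < s →
      ∀ (y₀ : StackelbergNash.L2) (yd : ∀ i, P.Target i) (f : P.Leader),
        -- every choice of the followers' controls determines exactly one state
        (∀ u : ∀ i, P.Follower i, ∃! y : P.Path, P.IsState y₀ f u y) ∧
        -- existence and uniqueness of the Nash equilibrium pair
        (∃! u : ∀ i, P.Follower i, P.IsNash μ (P.σ ϑ c₁ c₂ s) y₀ yd f u) ∧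
        -- the coupled system has exactly one solution, and it characterizes the equilibrium
        ∃ (y : P.Path) (q : Fin 2 → P.Path),
          P.IsOptimalitySol μ (P.σ ϑ c₁ c₂ s) y₀ yd f y q ∧
          (∀ (y' : P.Path) (q' : Fin 2 → P.Path),
            P.IsOptimalitySol μ (P.σ ϑ c₁ c₂ s) y₀ yd f y' q' → y' = y ∧ q' = q) ∧
          ∀ u : ∀ i, P.Follower i, P.IsNash μ (P.σ ϑ c₁ c₂ s) y₀ yd f u ↔
            (P.IsFeedback μ (P.σ ϑ c₁ c₂ s) u q ∧ P.IsState y₀ f u y) := by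
  have hC : 0 ≤ 4 * P.energyConst * ∑ j, P.α j :=
    mul_nonneg (mul_nonneg zero_le_four hP.energyConst_nonneg)
      (Finset.sum_nonneg fun j _ => (hP.α_pos j).le)
  refine ⟨1 + 4 * P.energyConst * ∑ j, P.α j, by linarith, ?_⟩
  intro μ hμ ϑ hϑ c₁ c₂ s hc₁ hc₂ hs y₀ yd f
  have hσ := hP.measurable_σ hϑ c₂ s hc₁
  have hσ1 := hP.one_le_σ hϑ hc₁ (hP.weight_bound_pos hc₂) hs
  have hμ0 : ∀ i, 0 < μ i := fun i => by linarith [hμ i]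
  have hNash := hP.isNash_iff (y₀ := y₀) (yd := yd) (f := f) hσ hσ1 hμ0
  obtain ⟨u, hu, huniq⟩ := hP.existsUnique_response_eq (y₀ := y₀) (yd := yd) (f := f) hσ hσ1 hμ
  refine ⟨hP.existsUnique_state y₀ f, ⟨u, (hNash u).2 hu, fun v hv => huniq v ((hNash v).1 hv)⟩,
    P.state y₀ f u, P.adj yd (P.state y₀ f u), ?_, ?_, fun v => ?_⟩
  · rw [hP.isOptimalitySol_iff hσ hσ1]
    exact ⟨congrArg (P.state y₀ f) hu.symm, rfl⟩
  · intro y' q' h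
    rw [hP.isOptimalitySol_iff hσ hσ1] at h
    obtain ⟨hy', rfl⟩ := h
    -- the feedback of a solution is a fixed point of the response map
    have hfix : (fun i => P.feedback μ (P.σ ϑ c₁ c₂ s) (P.adj yd y' i) i) = u :=
      huniq _ (by
        funext i
        rw [StackelbergNash.Data.response, ← hy'])
    rw [hfix] at hy'
    rw [hy']
    exact ⟨rfl, rfl⟩
  · rw [hNash, hP.isFeedback_iff hσ hσ1, hP.isState_iff]
    constructor
    · intro hv
      obtain rfl := huniq v hv
      exact ⟨hv.symm, rfl⟩
    · rintro ⟨hv, -⟩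
      have : v = u := hv.trans hu
      rwa [this]
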